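/- **Setting.** Let $d_1,d_2\ge 1$ be integers, $d=d_1+d_2$, and let $G_1\subset\mathbb R^{d_1}$, $G_2\subset\mathbb R^{d_2}$ be bounded open sets with $0\in\overline{G_2}$. For $\varepsilon>0$ put $G_\varepsilon=G_1\times\varepsilon G_2\subset\mathbb R^d$, and identify $G_0=G_1\times\{0\}$ with $G_1$; write $x=(\overline x,\widehat x)\in\mathbb R^{d_1}\times\mathbb R^{d_2}$. All functions are real-valued. Let $\mathcal A$ be an algebra with mean value on $\mathbb R^{d_1}$: a closed subalgebra of the algebra of bounded uniformly continuous functions on $\mathbb R^{d_1}$ (sup norm) that contains the constants, is translation invariant, and is such that for every $u\in\mathcal A$ the functions $x\mapsto u(x/\varepsilon)$ converge weakly-$*$ in $L^\infty(\mathbb R^{d_1})$, as $\varepsilon\to0^+$, to a constant. For a Banach space $\mathbb F$, $\mathcal A(\mathbb R^{d_1};\mathbb F)$ is the closure in the sup norm of the finite sums $\sum_i u_i(\cdot)\,e_i$ with $u_i\in\mathcal A$, $e_i\in\mathbb F$. For $1\le p<\infty$ set $\|u\|_p=\big(\limsup_{R\to\infty}|B_R|^{-1}\int_{B_R}\|u(y)\|_{\mathbb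 F}^p\,dy\big)^{1/p}$, where $B_R$ is the open ball of radius $R$ centred at the origin of $\mathbb R^{d_1}$; $B^p_{\mathcal A}(\mathbb R^{d_1};\mathbb F)$ is the closure of $\mathcal A(\mathbb R^{d_1};\mathbb F)$, for this seminorm, in the space of $u\in L^p_{loc}(\mathbb R^{d_1};\mathbb F)$ with $\|u\|_p<\infty$, and $\mathcal B^p_{\mathcal A}(\mathbb R^{d_1};\mathbb F)$ is its quotient by $\{\|u\|_p=0\}$. The mean value is $M(u)=\lim_{R\to\infty}|B_R|^{-1}\int_{B_R}u(y)\,dy\in\mathbb F$. Let $E=(\varepsilon_n)_{n}$ be a sequence with $0<\varepsilon_n\le 1$ and $\varepsilon_n\to0$; below $\varepsilon$ runs through $E$ and $\varepsilon\to0$ means $n\to\infty$. For $1\le p<\infty$ and $\frac1{p'}=1-\frac1p$, a sequence $(u_\varepsilon)_{\varepsilon\in E}$ with $u_\varepsilon\in L^p(G_\varepsilon)$ *weakly $\Sigma_{\mathcal A}$-converges in $L^p(G_\varepsilon)$* to $u_0\in L^p(G_0;\mathcal B^p_{\mathcal A}(\mathbb R^{d_1};L^p(G_2)))$ if $$\varepsilon^{-d_2}\int_{G_\varepsilon}u_\varepsilon(x)\,f\Big(\overline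 x,\frac x\varepsilon\Big)dx\ \longrightarrow\ \int_{G_0}\int_{G_2}M\big(u_0(\overline x,\cdot,\zeta)f(\overline x,\cdot,\zeta)\big)\,d\zeta\,d\overline x$$ for every $f\in L^{p'}(G_0;\mathcal A(\mathbb R^{d_1};L^{p'}(G_2)))$. It *strongly $\Sigma_{\mathcal A}$-converges in $L^p(G_\varepsilon)$* to $u_0$ if, in addition, $\varepsilon^{-d_2/p}\|u_\varepsilon\|_{L^p(G_\varepsilon)}\to\|u_0\|_{L^p(G_0;\mathcal B^p_{\mathcal A}(\mathbb R^{d_1};L^p(G_2)))}$. **Theorem 2.4.** Let $1<p,q<\infty$ and $r\ge1$ be such that $\frac1r=\frac1p+\frac1q\le1$. Assume that $(u_\varepsilon)_{\varepsilon\in E}$, $u_\varepsilon\in L^q(G_\varepsilon)$, is weakly $\Sigma_{\mathcal A}$-convergent in $L^q(G_\varepsilon)$ to some $u_0\in L^q(G_0;\mathcal B^q_{\mathcal A}(\mathbb R^{d_1};L^q(G_2)))$, and that $(v_\varepsilon)_{\varepsilon\in E}$, $v_\varepsilon\in L^p(G_\varepsilon)$, is strongly $\Sigma_{\mathcal A}$-convergent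 in $L^p(G_\varepsilon)$ to some $v_0\in L^p(G_0;\mathcal B^p_{\mathcal A}(\mathbb R^{d_1};L^p(G_2)))$. Then the pointwise product $u_0v_0$ (formed with representatives; its class does not depend on them) belongs to $L^r(G_0;\mathcal B^r_{\mathcal A}(\mathbb R^{d_1};L^r(G_2)))$, and $(u_\varepsilon v_\varepsilon)_{\varepsilon\in E}$ is weakly $\Sigma_{\mathcal A}$-convergent in $L^r(G_\varepsilon)$ to $u_0v_0$. -/

import Mathlib

open MeasureTheory ProbabilityTheory Filter Topology
open scoped ENNReal BoundedContinuousFunction Pointwise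

noncomputable section

namespace ThinSigma

/-- The numerical space `ℝ^m` (Euclidean norm, Lebesgue measure). -/
abbrev Eu (m : ℕ) : Type := EuclideanSpace ℝ (Fin m)

/-- An algebra with mean value on `ℝ^m`: a closed subalgebra (containing the constants) of the
algebra of real bounded uniformly continuous functions on `ℝ^m`, translation invariant, and such
that for each of its elements `u` the functions `x ↦ u (x / ε)` converge weakly-* in `L^∞(ℝ^m)`,
as `ε → 0⁺`, to a real constant. -/
structure MeanValueAlgebra (m : ℕ) where
  carrier : Subalgebra ℝ (Eu m →ᵇ ℝ)
  isClosed : IsClosed (carrier : Set (Eu m →ᵇ ℝ))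
  uniformContinuous : ∀ u ∈ carrier, UniformContinuous u
  translation : ∀ u ∈ carrier, ∀ h : Eu m, ∃ v ∈ carrier, ∀ y, v y = u (y + h)
  mean : ∀ u ∈ carrier, ∃ M : ℝ, ∀ φ : Eu m → ℝ, Integrable φ →
    Tendsto (fun ε : ℝ => ∫ x, u (ε⁻¹ • x) * φ x) (𝓝[>] 0) (𝓝 (M * ∫ x, φ x))

section VectorValued

variable {m : ℕ} {F : Type*} [NormedAddCommGroup F] [NormedSpace ℝ F]

/-- The vector-valued algebra with mean value `A(ℝ^m; F)`: the closure, for the sup norm, of the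
finite sums of functions `y ↦ u y • v` with `u ∈ A` and `v ∈ F`. -/
def MeanValueAlgebra.vec (A : MeanValueAlgebra m) (F : Type*) [NormedAddCommGroup F]
    [NormedSpace ℝ F] : Submodule ℝ (Eu m →ᵇ F) :=
  (Submodule.span ℝ
    {g : Eu m →ᵇ F | ∃ u ∈ A.carrier, ∃ v : F, ∀ y, g y = u y • v}).topologicalClosure

/-- The seminorm `limsup_{R → ∞} (⨍_{B_R} ‖u‖^p)^{1/p}` (with value in `[0, ∞]`): here
`volume[|B_R]` is the normalized Lebesgue measure `|B_R|⁻¹ • volume` on the ball `B_R`. -/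
def besicovitchSeminorm (p : ℝ≥0∞) (u : Eu m → F) : ℝ≥0∞ :=
  limsup (fun R : ℝ => eLpNorm u p (volume[|Metric.ball (0 : Eu m) R])) atTop

/-- The functions underlying the Marcinkiewicz-type space: `u ∈ L^p_loc(ℝ^m; F)` with finite
seminorm. -/
def IsMarcinkiewicz (p : ℝ≥0∞) (u : Eu m → F) : Prop :=
  (∀ R : ℝ, MemLp u p (volume.restrict (Metric.ball 0 R))) ∧ besicovitchSeminorm p u < ∞

lemma memLp_cond_ball {p : ℝ≥0∞} {u : Eu m → F} {R : ℝ}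
    (h : MemLp u p (volume.restrict (Metric.ball 0 R))) :
    MemLp u p (volume[|Metric.ball (0 : Eu m) R]) := by
  rcases lt_or_ge 0 R with hR | hR
  · exact h.smul_measure (ENNReal.inv_ne_top.2 (Metric.measure_ball_pos _ _ hR).ne')
  · have : Metric.ball (0 : Eu m) R = ∅ := Metric.ball_eq_empty.2 hR
    simp [ProbabilityTheory.cond, this]

lemma besicovitchSeminorm_add_le {p : ℝ≥0∞} (hp : 1 ≤ p) {u v : Eu m → F}
    (hu : IsMarcinkiewicz p u) (hv : IsMarcinkiewicz p v) :
    besicovitchSeminorm p (u + v) ≤ besicovitchSeminorm p u + besicovitchSeminorm p v := by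
  refine ENNReal.le_of_forall_pos_le_add fun δ hδ _ => ?_
  have hδ2 : (δ / 2 : ℝ≥0∞) ≠ 0 := by simpa using hδ.ne'
  have h1 := eventually_lt_of_limsup_lt (ENNReal.lt_add_right hu.2.ne hδ2)
  have h2 := eventually_lt_of_limsup_lt (ENNReal.lt_add_right hv.2.ne hδ2)
  refine limsup_le_of_le (by isBoundedDefault) ?_
  filter_upwards [h1, h2] with R hR1 hR2
  refine (eLpNorm_add_le (memLp_cond_ball (hu.1 R)).1 (memLp_cond_ball (hv.1 R)).1 hp).trans ?_
  refine (add_le_add hR1.le hR2.le).trans (le_of_eq ?_)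
  rw [add_add_add_comm, ENNReal.add_halves]
  rfl

lemma besicovitchSeminorm_smul (p : ℝ≥0∞) (c : ℝ) (u : Eu m → F) :
    besicovitchSeminorm p (c • u) = ‖c‖ₑ * besicovitchSeminorm p u := by
  simp only [besicovitchSeminorm, eLpNorm_const_smul]
  exact ENNReal.limsup_const_mul_of_ne_top (by simp)

/-- The Marcinkiewicz-type space as a vector space of functions. -/
def marcinkiewiczSubmodule (m : ℕ) (F : Type*) [NormedAddCommGroup F] [NormedSpace ℝ F]
    (p : ℝ≥0∞) [Fact (1 ≤ p)] : Submodule ℝ (Eu m → F) where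
  carrier := {u | IsMarcinkiewicz p u}
  zero_mem' := ⟨fun _ => MemLp.zero, by simp [besicovitchSeminorm]⟩
  add_mem' := fun hu hv => ⟨fun R => (hu.1 R).add (hv.1 R),
    (besicovitchSeminorm_add_le Fact.out hu hv).trans_lt (ENNReal.add_lt_top.2 ⟨hu.2, hv.2⟩)⟩
  smul_mem' := fun c u hu => ⟨fun R => (hu.1 R).const_smul c, by
    rw [besicovitchSeminorm_smul]; exact ENNReal.mul_lt_top (by simp) hu.2⟩

/-- The Marcinkiewicz-type space as a type of its own, carrying the seminorm
`besicovitchSeminorm p` (and not the topology of pointwise convergence). -/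
def Marcinkiewicz (m : ℕ) (F : Type*) [NormedAddCommGroup F] [NormedSpace ℝ F]
    (p : ℝ≥0∞) [Fact (1 ≤ p)] : Type _ := marcinkiewiczSubmodule m F p

variable {p : ℝ≥0∞} [Fact (1 ≤ p)]

instance : AddCommGroup (Marcinkiewicz m F p) :=
  inferInstanceAs (AddCommGroup (marcinkiewiczSubmodule m F p))

instance : Module ℝ (Marcinkiewicz m F p) :=
  inferInstanceAs (Module ℝ (marcinkiewiczSubmodule m F p))

/-- The function underlying an element of the Marcinkiewicz-type space. -/
def Marcinkiewicz.toFun (u : Marcinkiewicz m F p) : Eu m → F := Subtype.val u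

lemma Marcinkiewicz.prop (u : Marcinkiewicz m F p) : IsMarcinkiewicz p u.toFun := Subtype.property u

lemma Marcinkiewicz.toFun_add (u v : Marcinkiewicz m F p) :
    (u + v).toFun = u.toFun + v.toFun := rfl

lemma Marcinkiewicz.toFun_sub (u v : Marcinkiewicz m F p) :
    (u - v).toFun = u.toFun - v.toFun := rfl

lemma Marcinkiewicz.toFun_smul (c : ℝ) (u : Marcinkiewicz m F p) :
    (c • u).toFun = c • u.toFun := rfl

instance : SeminormedAddCommGroup (Marcinkiewicz m F p) :=
  AddGroupSeminorm.toSeminormedAddCommGroup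
    { toFun := fun u => (besicovitchSeminorm p u.toFun).toReal
      map_zero' := by
        change (besicovitchSeminorm p (0 : Eu m → F)).toReal = 0
        simp [besicovitchSeminorm]
      add_le' := fun u v => by
        rw [← ENNReal.toReal_add u.prop.2.ne v.prop.2.ne]
        exact ENNReal.toReal_mono (ENNReal.add_lt_top.2 ⟨u.prop.2, v.prop.2⟩).ne
          (besicovitchSeminorm_add_le Fact.out u.prop v.prop)
      neg' := fun u => by
        change (besicovitchSeminorm p (-u.toFun)).toReal = _
        simp [besicovitchSeminorm, eLpNorm_neg] }

lemma Marcinkiewicz.norm_def (u : Marcinkiewicz m F p) :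
    ‖u‖ = (besicovitchSeminorm p u.toFun).toReal := rfl

instance : NormedSpace ℝ (Marcinkiewicz m F p) where
  norm_smul_le c u := by
    rw [Marcinkiewicz.norm_def, Marcinkiewicz.norm_def, Marcinkiewicz.toFun_smul,
      besicovitchSeminorm_smul, ENNReal.toReal_mul]
    simp

/-- The elements of the Marcinkiewicz-type space that belong to `A(ℝ^m; F)`. -/
def MeanValueAlgebra.vecMarcinkiewicz (A : MeanValueAlgebra m) (F : Type*) [NormedAddCommGroup F]
    [NormedSpace ℝ F] (p : ℝ≥0∞) [Fact (1 ≤ p)] : Submodule ℝ (Marcinkiewicz m F p) where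
  carrier := {u | ∃ a ∈ A.vec F, u.toFun = a}
  zero_mem' := ⟨0, zero_mem _, rfl⟩
  add_mem' := by
    rintro u v ⟨a, ha, hu⟩ ⟨b, hb, hv⟩
    exact ⟨a + b, add_mem ha hb, by rw [Marcinkiewicz.toFun_add, hu, hv]; rfl⟩
  smul_mem' := by
    rintro c u ⟨a, ha, hu⟩
    exact ⟨c • a, Submodule.smul_mem _ c ha, by rw [Marcinkiewicz.toFun_smul, hu]; rfl⟩

/-- The generalized Besicovitch space `B_A^p(ℝ^m; F)` (a seminormed space): the closure of
`A(ℝ^m; F)` in the Marcinkiewicz-type space. -/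
def MeanValueAlgebra.BesicovitchFun (A : MeanValueAlgebra m) (F : Type*) [NormedAddCommGroup F]
    [NormedSpace ℝ F] (p : ℝ≥0∞) [Fact (1 ≤ p)] : Type _ :=
  (A.vecMarcinkiewicz F p).topologicalClosure

instance (A : MeanValueAlgebra m) : SeminormedAddCommGroup (A.BesicovitchFun F p) :=
  inferInstanceAs (SeminormedAddCommGroup (A.vecMarcinkiewicz F p).topologicalClosure)

instance (A : MeanValueAlgebra m) : NormedSpace ℝ (A.BesicovitchFun F p) :=
  inferInstanceAs (NormedSpace ℝ (A.vecMarcinkiewicz F p).topologicalClosure)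

/-- The normed space `𝓑_A^p(ℝ^m; F)`: the quotient of `B_A^p(ℝ^m; F)` by the elements of
seminorm `0`. -/
abbrev MeanValueAlgebra.Besicovitch (A : MeanValueAlgebra m) (F : Type*) [NormedAddCommGroup F]
    [NormedSpace ℝ F] (p : ℝ≥0∞) [Fact (1 ≤ p)] : Type _ :=
  SeparationQuotient (A.BesicovitchFun F p)

/-- The function underlying an element of `B_A^p(ℝ^m; F)`. -/
def MeanValueAlgebra.BesicovitchFun.toFun {A : MeanValueAlgebra m} (u : A.BesicovitchFun F p) :
    Eu m → F := Marcinkiewicz.toFun (Subtype.val u)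

/-- The mean value `M(u) = lim_{R → ∞} ⨍_{B_R} u` of a function with values in `F`. The limit
exists in `F` (complete) for `u ∈ B_A^p(ℝ^m; F)`, and there it is the continuous extension of the
mean value on `A(ℝ^m; F)`. -/
def meanValue (u : Eu m → F) : F :=
  limUnder atTop (fun R : ℝ => ⨍ y in Metric.ball (0 : Eu m) R, u y)

end VectorValued

/-- The space `L^p(G)`, `G ⊆ ℝ^n` carrying the Lebesgue measure. -/
abbrev LpOn {n : ℕ} (G : Set (Eu n)) (p : ℝ≥0∞) : Type :=
  Lp ℝ p ((volume : Measure (Eu n)).restrict G)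

instance (p : ℝ≥0∞) : Fact (1 ≤ p.conjExponent) := ⟨by simp [ENNReal.conjExponent]⟩

section Pairing

variable {m n : ℕ} {G₂ : Set (Eu n)} {p : ℝ≥0∞} [Fact (1 ≤ p)]

/-- Pointwise multiplication `L^p(G) × L^{p'}(G) → L^1(G)`, `1/p + 1/p' = 1`. -/
def mulL1 (G : Set (Eu n)) (p : ℝ≥0∞) [Fact (1 ≤ p)] :
    LpOn G p →L[ℝ] LpOn G p.conjExponent →L[ℝ] LpOn G 1 :=
  (ContinuousLinearMap.mul ℝ ℝ).holderL (volume.restrict G) p p.conjExponent 1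

/-- The mean value `M(U a) ∈ L^1(G₂)` for functions `U : ℝ^m → L^p(G₂)`, `a : ℝ^m → L^{p'}(G₂)`. -/
def meanMulFun (U : Eu m → LpOn G₂ p) (a : Eu m →ᵇ LpOn G₂ p.conjExponent) : LpOn G₂ 1 :=
  meanValue fun y => mulL1 G₂ p (U y) (a y)

lemma integrableOn_mul {U : Eu m → LpOn G₂ p} (hU : IsMarcinkiewicz p U)
    (a : Eu m →ᵇ LpOn G₂ p.conjExponent) (R : ℝ) :
    IntegrableOn (fun y => mulL1 G₂ p (U y) (a y)) (Metric.ball 0 R) := by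
  have hfin : volume (Metric.ball (0 : Eu m) R) < ∞ := measure_ball_lt_top
  have : IsFiniteMeasure ((volume : Measure (Eu m)).restrict (Metric.ball 0 R)) :=
    ⟨by simpa using hfin⟩
  exact ContinuousLinearMap.integrable_of_bilin_of_bdd_right (mulL1 G₂ p) ‖a‖
    ((hU.1 R).integrable Fact.out) a.continuous.aestronglyMeasurable
    (Eventually.of_forall a.norm_coe_le_norm)

/-- `M(U a)` does not depend on the choice of `U` in its class. -/
lemma meanMulFun_congr {A : MeanValueAlgebra m} (a : Eu m →ᵇ LpOn G₂ p.conjExponent)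
    (U V : A.BesicovitchFun (LpOn G₂ p) p) (h : Inseparable U V) :
    meanMulFun U.toFun a = meanMulFun V.toFun a := by
  have hnorm : besicovitchSeminorm p (U.toFun - V.toFun) = 0 := by
    have h0 : ‖U - V‖ = 0 := by rw [← dist_eq_norm]; exact Metric.inseparable_iff.1 h
    have h1 : (besicovitchSeminorm p (U.1 - V.1).toFun).toReal = 0 := h0
    exact (ENNReal.toReal_eq_zero_iff _).1 h1 |>.resolve_right (U.1 - V.1).prop.2.ne
  have hlim : Tendsto (fun R : ℝ => eLpNorm (U.toFun - V.toFun) p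
      (volume[|Metric.ball (0 : Eu m) R])) atTop (𝓝 0) := by
    refine ENNReal.tendsto_nhds_zero.2 fun δ hδ => ?_
    refine (eventually_lt_of_limsup_lt (b := δ) ?_).mono fun _ => le_of_lt
    exact lt_of_eq_of_lt hnorm hδ
  have hdiff : Tendsto (fun R : ℝ =>
      (⨍ y in Metric.ball (0 : Eu m) R, mulL1 G₂ p (U.toFun y) (a y)) -
      ⨍ y in Metric.ball (0 : Eu m) R, mulL1 G₂ p (V.toFun y) (a y)) atTop (𝓝 0) := by
    set C : ℝ≥0∞ := ‖mulL1 G₂ p‖ₑ * ‖a‖ₑ with hC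
    have hCtop : C ≠ ∞ := ENNReal.mul_ne_top (by simp) (by simp)
    rw [tendsto_iff_edist_tendsto_0]
    refine tendsto_of_tendsto_of_tendsto_of_le_of_le' tendsto_const_nhds
      (by simpa using ENNReal.Tendsto.const_mul hlim (Or.inr hCtop) :
        Tendsto (fun R : ℝ => C * eLpNorm (U.toFun - V.toFun) p
          (volume[|Metric.ball (0 : Eu m) R])) atTop (𝓝 0))
      (Eventually.of_forall fun _ => zero_le) ?_
    filter_upwards [eventually_gt_atTop 0] with R hR
    have hpos : volume (Metric.ball (0 : Eu m) R) ≠ 0 := (Metric.measure_ball_pos _ _ hR).ne'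
    have : IsProbabilityMeasure (volume[|Metric.ball (0 : Eu m) R]) :=
      cond_isProbabilityMeasure_of_finite hpos measure_ball_lt_top.ne
    have hav : ∀ g : Eu m → LpOn G₂ 1, (⨍ y in Metric.ball (0 : Eu m) R, g y) =
        ∫ y, g y ∂(volume[|Metric.ball (0 : Eu m) R]) := by
      intro g
      simp [average, ProbabilityTheory.cond]
    have hint : ∀ W : A.BesicovitchFun (LpOn G₂ p) p, Integrable
        (fun y => mulL1 G₂ p (W.toFun y) (a y)) (volume[|Metric.ball (0 : Eu m) R]) := fun W =>
      (integrableOn_mul (Marcinkiewicz.prop W.1) a R).smul_measure (ENNReal.inv_ne_top.2 hpos)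
    rw [hav, hav, edist_zero_right, ← integral_sub (hint U) (hint V)]
    refine (enorm_integral_le_lintegral_enorm _).trans ?_
    have hmeas : AEStronglyMeasurable (U.toFun - V.toFun) (volume[|Metric.ball (0 : Eu m) R]) :=
      (memLp_cond_ball ((U.1 - V.1).prop.1 R)).1
    refine le_trans ?_ (mul_le_mul_right (eLpNorm_le_eLpNorm_of_exponent_le
      (Fact.out : 1 ≤ p) hmeas) C)
    rw [eLpNorm_one_eq_lintegral_enorm, ← lintegral_const_mul' _ _ hCtop]
    refine lintegral_mono fun y => ?_
    have h1 : mulL1 G₂ p (U.toFun y) (a y) - mulL1 G₂ p (V.toFun y) (a y) =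
        mulL1 G₂ p (U.toFun y - V.toFun y) (a y) := by simp
    have h2 : ‖a y‖ₑ ≤ ‖a‖ₑ := by
      rw [enorm_le_iff_norm_le]; exact a.norm_coe_le_norm y
    simp only [h1]
    calc ‖mulL1 G₂ p (U.toFun y - V.toFun y) (a y)‖ₑ
        ≤ ‖mulL1 G₂ p (U.toFun y - V.toFun y)‖ₑ * ‖a y‖ₑ := ContinuousLinearMap.le_opENorm _ _
      _ ≤ (‖mulL1 G₂ p‖ₑ * ‖U.toFun y - V.toFun y‖ₑ) * ‖a‖ₑ :=
          mul_le_mul' (ContinuousLinearMap.le_opENorm _ _) h2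
      _ = C * ‖(U.toFun - V.toFun) y‖ₑ := by rw [hC, Pi.sub_apply]; ring
  unfold meanMulFun meanValue limUnder lim
  congr 1
  funext x
  refine propext ⟨fun hx => ?_, fun hx => ?_⟩
  · exact (by simpa using Tendsto.sub hx hdiff : Tendsto _ _ _)
  · exact (by simpa using Tendsto.add hx hdiff : Tendsto _ _ _)

/-- The mean value `M(b a) ∈ L^1(G₂)` of the product of a class `b ∈ 𝓑_A^p(ℝ^m; L^p(G₂))` and a
function `a ∈ A(ℝ^m; L^{p'}(G₂))`. -/
def meanMul {A : MeanValueAlgebra m} (b : A.Besicovitch (LpOn G₂ p) p)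
    (a : A.vec (LpOn G₂ p.conjExponent)) : LpOn G₂ 1 :=
  SeparationQuotient.lift (fun U : A.BesicovitchFun (LpOn G₂ p) p => meanMulFun U.toFun a.1)
    (fun U V h => meanMulFun_congr a.1 U V h) b

/-- The pairing `∫_{G₂} M(b(·, ζ) a(·, ζ)) dζ`. -/
def meanPairing {A : MeanValueAlgebra m} (b : A.Besicovitch (LpOn G₂ p) p)
    (a : A.vec (LpOn G₂ p.conjExponent)) : ℝ :=
  ∫ ζ in G₂, meanMul b a ζ

end Pairing

section SigmaConvergence

variable {d₁ d₂ : ℕ}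

/-- The thin domain `G_ε = G₁ × ε G₂` in `ℝ^{d₁} × ℝ^{d₂}` (with the product Lebesgue measure). -/
def thinDomain (G₁ : Set (Eu d₁)) (G₂ : Set (Eu d₂)) (ε : ℝ) : Set (Eu d₁ × Eu d₂) :=
  G₁ ×ˢ (ε • G₂)

/-- The space `L^p(G₀; 𝓑_A^p(ℝ^{d₁}; L^p(G₂)))` (Bochner), `G₀ = G₁ × {0}` being identified
with `G₁`. -/
abbrev LimitSpace (A : MeanValueAlgebra d₁) (G₁ : Set (Eu d₁)) (G₂ : Set (Eu d₂))
    (p : ℝ≥0∞) [Fact (1 ≤ p)] : Type :=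
  Lp (A.Besicovitch (LpOn G₂ p) p) p ((volume : Measure (Eu d₁)).restrict G₁)

/-- The space of test functions `L^{p'}(G₀; A(ℝ^{d₁}; L^{p'}(G₂)))`, `1/p + 1/p' = 1`. -/
abbrev TestSpace (A : MeanValueAlgebra d₁) (G₁ : Set (Eu d₁)) (G₂ : Set (Eu d₂))
    (p : ℝ≥0∞) [Fact (1 ≤ p)] : Type :=
  Lp (A.vec (LpOn G₂ p.conjExponent)) p.conjExponent ((volume : Measure (Eu d₁)).restrict G₁)

/-- `∫_{G_ε} u(x) f(x̄, x / ε) dx` for `x = (x̄, z)`, `x / ε = (x̄ / ε, z / ε)`. Since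
`f x̄ (x̄ / ε)` is an element of `L^{p'}(G₂)`, i.e. a class of functions of `ζ = z / ε`, the
integral over `G_ε = G₁ × ε G₂` is written as an iterated integral, which does not depend on the
representatives of these classes. -/
def testIntegral {A : MeanValueAlgebra d₁} {G₁ : Set (Eu d₁)} {G₂ : Set (Eu d₂)} {p : ℝ≥0∞}
    [Fact (1 ≤ p)] (ε : ℝ) (u : Eu d₁ × Eu d₂ → ℝ) (f : TestSpace A G₁ G₂ p) : ℝ :=
  ∫ x in G₁, ∫ z in ε • G₂,
    u (x, z) * ((f x : Eu d₁ →ᵇ LpOn G₂ p.conjExponent) (ε⁻¹ • x)) (ε⁻¹ • z)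

/-- Weak `Σ_A`-convergence in `L^p(G_ε)` of `(u_n)`, `u_n ∈ L^p(G_{ε_n})`, to `u₀`, along the
sequence `(ε_n)`. -/
def WeakSigma (A : MeanValueAlgebra d₁) (G₁ : Set (Eu d₁)) (G₂ : Set (Eu d₂)) (p : ℝ≥0∞)
    [Fact (1 ≤ p)] (ε : ℕ → ℝ) (u : ℕ → Eu d₁ × Eu d₂ → ℝ) (u₀ : LimitSpace A G₁ G₂ p) : Prop :=
  (∀ n, MemLp (u n) p (volume.restrict (thinDomain G₁ G₂ (ε n)))) ∧
  ∀ f : TestSpace A G₁ G₂ p,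
    Tendsto (fun n => (ε n ^ d₂)⁻¹ * testIntegral (ε n) (u n) f) atTop
      (𝓝 (∫ x in G₁, meanPairing (u₀ x) (f x)))

/-- Strong `Σ_A`-convergence in `L^p(G_ε)`: weak convergence together with
`ε^{-d₂/p} ‖u_ε‖_{L^p(G_ε)} → ‖u₀‖`. -/
def StrongSigma (A : MeanValueAlgebra d₁) (G₁ : Set (Eu d₁)) (G₂ : Set (Eu d₂)) (p : ℝ≥0∞)
    [Fact (1 ≤ p)] (ε : ℕ → ℝ) (u : ℕ → Eu d₁ × Eu d₂ → ℝ) (u₀ : LimitSpace A G₁ G₂ p) : Prop :=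
  WeakSigma A G₁ G₂ p ε u u₀ ∧
  Tendsto (fun n => ε n ^ (-(d₂ : ℝ) / p.toReal) *
    (eLpNorm (u n) p (volume.restrict (thinDomain G₁ G₂ (ε n)))).toReal) atTop (𝓝 ‖u₀‖)

/-- `w = b c` for classes `b ∈ 𝓑_A^q(ℝ^m; L^q(G₂))`, `c ∈ 𝓑_A^p(ℝ^m; L^p(G₂))` and
`w ∈ 𝓑_A^r(ℝ^m; L^r(G₂))`: for all representatives `U` of `b` and `V` of `c`, the pointwise
product `(y, ζ) ↦ U y ζ * V y ζ` is a representative of `w`. -/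
def IsProduct {A : MeanValueAlgebra d₁} {G₂ : Set (Eu d₂)} {p q r : ℝ≥0∞}
    [Fact (1 ≤ p)] [Fact (1 ≤ q)] [Fact (1 ≤ r)] (b : A.Besicovitch (LpOn G₂ q) q)
    (c : A.Besicovitch (LpOn G₂ p) p) (w : A.Besicovitch (LpOn G₂ r) r) : Prop :=
  ∀ (U : A.BesicovitchFun (LpOn G₂ q) q) (V : A.BesicovitchFun (LpOn G₂ p) p),
    SeparationQuotient.mk U = b → SeparationQuotient.mk V = c →
    ∃ W : A.BesicovitchFun (LpOn G₂ r) r, SeparationQuotient.mk W = w ∧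
      ∀ y, (W.toFun y : Eu d₂ → ℝ) =ᵐ[volume.restrict G₂] fun ζ => U.toFun y ζ * V.toFun y ζ

end SigmaConvergence

end ThinSigma

end

set_option linter.unusedSectionVars false

noncomputable section

namespace ThinSigma

/-! ### Averages over balls and the Besicovitch seminorm -/

section Averages

variable {m : ℕ} {F F₁ F₂ F₃ : Type*} [NormedAddCommGroup F] [NormedSpace ℝ F]
  [NormedAddCommGroup F₁] [NormedSpace ℝ F₁] [NormedAddCommGroup F₂] [NormedSpace ℝ F₂]
  [NormedAddCommGroup F₃] [NormedSpace ℝ F₃]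

/-! The substitution `z = ε ζ` turns the sequences into elements `U_n`, `V_n` of the fixed spaces
`L^q(G₁; L^q(G₂))` and `L^p(G₁; L^p(G₂))`, the weighted norms into plain norms, and the weighted
test integral into the duality pairing with `f_ε(x) = f(x)(x / ε)`. For `ψ` in `L^p(G₁; A(L^p(G₂)))`
one has `(ψ f)_ε = ψ_ε f_ε`, and `ψ f` is a test function for the first sequence, whence `⟨U_n V_n,
f_ε⟩ = ⟨U_n, V_n f_ε⟩ ≈ ⟨U_n, (ψ f)_ε⟩ → ⟨u₀, ψ f⟩ = ⟨u₀ ψ, f⟩ ≈ ⟨u₀ v₀, f⟩`. Both errors are small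
once `U_n` is bounded, `ψ` is close to `v₀` and `V_n` is eventually close to `ψ_ε`
(`tendsto_bochnerPairing_mul`).

Boundedness (`exists_norm_le_of_tendsto`) is Banach–Steinhaus on the test space, applied to test
functions constant in `y`, for which `f_ε = f`.

Closeness (`exists_approx_of_strong`) is a quantitative Radon–Riesz argument. The divergence `|a|^p
+ (p-1)|b|^p - p a |b|^{p-1} sign b` controls `|a - b|^p` up to `δ (|a|^p + |b|^p)`
(`exists_abs_sub_rpow_le`). Integrated with `a = V_n`, `b = ψ_ε`, it involves only `‖V_n‖`, `‖ψ_ε‖`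
and `⟨V_n, ψ'_ε⟩`, where `ψ'` is the image of `ψ` under the duality map. All three converge if `ψ'`
is itself a test function, and the limit is small when `ψ` is near `v₀`.

Such `ψ` are dense (`exists_approx_with_dual`): step functions in `ζ` with coefficients in `A` will
do, since `A` is stable under composition with continuous functions by Weierstrass. For them `y ↦
‖ψ(x)(y)‖^p = ⟨ψ(x)(y), ψ'(x)(y)⟩` lies in `A`, so that the weak-* convergence built into `A` gives
the limit of `‖ψ_ε‖`. -/

lemma setAverage_ball_eq (u : Eu m → F) (R : ℝ) :
    (⨍ y in Metric.ball (0 : Eu m) R, u y) = ∫ y, u y ∂(volume[|Metric.ball (0 : Eu m) R]) := by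
  simp [average, ProbabilityTheory.cond]

lemma enorm_setAverage_ball_le (u : Eu m → F) (R : ℝ) :
    ‖⨍ y in Metric.ball (0 : Eu m) R, u y‖ₑ ≤
      eLpNorm u 1 (volume[|Metric.ball (0 : Eu m) R]) := by
  rw [setAverage_ball_eq, eLpNorm_one_eq_lintegral_enorm]
  exact enorm_integral_le_lintegral_enorm _

lemma isProbabilityMeasure_cond_ball {R : ℝ} (hR : 0 < R) :
    IsProbabilityMeasure (volume[|Metric.ball (0 : Eu m) R]) :=
  cond_isProbabilityMeasure_of_finite (Metric.measure_ball_pos _ _ hR).ne' measure_ball_lt_top.ne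

lemma IsMarcinkiewicz.integrable_cond {p : ℝ≥0∞} (hp : 1 ≤ p) {u : Eu m → F}
    (hu : IsMarcinkiewicz p u) (R : ℝ) :
    Integrable u (volume[|Metric.ball (0 : Eu m) R]) := by
  have : IsFiniteMeasure (volume[|Metric.ball (0 : Eu m) R]) := by
    rcases lt_or_ge 0 R with hR | hR
    · have := isProbabilityMeasure_cond_ball (m := m) hR
      infer_instance
    · have : Metric.ball (0 : Eu m) R = ∅ := Metric.ball_eq_empty.2 hR
      simp only [ProbabilityTheory.cond, this, Measure.restrict_empty, smul_zero]
      infer_instance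
  exact (memLp_cond_ball (hu.1 R)).integrable hp

lemma besicovitchSeminorm_mono_exponent {p q : ℝ≥0∞} (hpq : p ≤ q) {u : Eu m → F}
    (hu : ∀ R, AEStronglyMeasurable u (volume[|Metric.ball (0 : Eu m) R])) :
    besicovitchSeminorm p u ≤ besicovitchSeminorm q u := by
  refine limsup_le_limsup ?_
  filter_upwards [eventually_gt_atTop 0] with R hR
  have := isProbabilityMeasure_cond_ball (m := m) hR
  exact eLpNorm_le_eLpNorm_of_exponent_le hpq (hu R)

lemma IsMarcinkiewicz.mono_exponent {p q : ℝ≥0∞} (hpq : p ≤ q) {u : Eu m → F}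
    (hu : IsMarcinkiewicz q u) : IsMarcinkiewicz p u := by
  refine ⟨fun R => ?_, ?_⟩
  · have : IsFiniteMeasure ((volume : Measure (Eu m)).restrict (Metric.ball 0 R)) :=
      ⟨by simpa using measure_ball_lt_top⟩
    exact (hu.1 R).mono_exponent hpq
  · exact (besicovitchSeminorm_mono_exponent hpq fun R => (memLp_cond_ball (hu.1 R)).1).trans_lt hu.2

lemma besicovitchSeminorm_le_of_bound {p : ℝ≥0∞} {u : Eu m → F} {C : ℝ}
    (h : ∀ y, ‖u y‖ ≤ C) : besicovitchSeminorm p u ≤ ENNReal.ofReal C := by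
  refine limsup_le_of_le (by isBoundedDefault) ?_
  filter_upwards [eventually_gt_atTop 0] with R hR
  have := isProbabilityMeasure_cond_ball (m := m) hR
  refine (eLpNorm_le_of_ae_bound (Eventually.of_forall h)).trans ?_
  simp

lemma isMarcinkiewicz_bcf (p : ℝ≥0∞) (a : Eu m →ᵇ F) : IsMarcinkiewicz p a := by
  refine ⟨fun R => ?_, (besicovitchSeminorm_le_of_bound a.norm_coe_le_norm).trans_lt
    ENNReal.ofReal_lt_top⟩
  have : IsFiniteMeasure ((volume : Measure (Eu m)).restrict (Metric.ball 0 R)) :=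
    ⟨by simpa using measure_ball_lt_top⟩
  exact MemLp.of_bound a.continuous.aestronglyMeasurable ‖a‖
    (Eventually.of_forall a.norm_coe_le_norm)

/-- `u` has a mean value: its averages over the balls `B_R` converge as `R → ∞`. -/
def HasMeanValue (u : Eu m → F) (c : F) : Prop :=
  Tendsto (fun R : ℝ => ⨍ y in Metric.ball (0 : Eu m) R, u y) atTop (𝓝 c)

lemma HasMeanValue.meanValue_eq {u : Eu m → F} {c : F} (h : HasMeanValue u c) :
    meanValue u = c := h.limUnder_eq

lemma HasMeanValue.add {u v : Eu m → F} {c d : F} (hu : HasMeanValue u c) (hv : HasMeanValue v d)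
    (iu : IsMarcinkiewicz 1 u) (iv : IsMarcinkiewicz 1 v) : HasMeanValue (u + v) (c + d) := by
  refine (Tendsto.add hu hv).congr fun R => ?_
  simp only [setAverage_ball_eq]
  exact (integral_add (iu.integrable_cond le_rfl R) (iv.integrable_cond le_rfl R)).symm

lemma HasMeanValue.smul {u : Eu m → F} {c : F} (hu : HasMeanValue u c) (k : ℝ) :
    HasMeanValue (k • u) (k • c) := by
  refine (Tendsto.const_smul hu k).congr fun R => ?_
  simp only [setAverage_ball_eq]
  exact (integral_smul k _).symm

lemma HasMeanValue.clm_comp [CompleteSpace F₁] [CompleteSpace F₂] {u : Eu m → F₁} {c : F₁}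
    (hu : HasMeanValue u c) (iu : IsMarcinkiewicz 1 u) (L : F₁ →L[ℝ] F₂) :
    HasMeanValue (fun y => L (u y)) (L c) := by
  refine ((L.continuous.tendsto c).comp hu).congr fun R => ?_
  simp only [setAverage_ball_eq, Function.comp_apply]
  exact (L.integral_comp_comm (iu.integrable_cond le_rfl R)).symm

lemma HasMeanValue.enorm_le {u : Eu m → F} {c : F} (hu : HasMeanValue u c) :
    ‖c‖ₑ ≤ besicovitchSeminorm 1 u := by
  have h : Tendsto (fun R : ℝ => ‖⨍ y in Metric.ball (0 : Eu m) R, u y‖ₑ) atTop (𝓝 ‖c‖ₑ) :=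
    (continuous_enorm.tendsto c).comp hu
  rw [← h.limsup_eq]
  exact limsup_le_limsup (Eventually.of_forall fun R => enorm_setAverage_ball_le u R)

/-- On large balls the averages of `u` and `g` differ by less than any number exceeding the seminorm
of `u - g`. An `η / 3` argument makes the averages of `u` Cauchy, and `F` is complete. -/
lemma exists_hasMeanValue_of_approx [CompleteSpace F] {u : Eu m → F} (hu : IsMarcinkiewicz 1 u)
    (h : ∀ η : ℝ≥0∞, 0 < η → ∃ g : Eu m → F, IsMarcinkiewicz 1 g ∧ (∃ c, HasMeanValue g c) ∧
      besicovitchSeminorm 1 (u - g) < η) : ∃ c, HasMeanValue u c := by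
  refine cauchy_map_iff_exists_tendsto.1 (EMetric.cauchy_iff.2 ⟨NeBot.ne inferInstance, fun η hη => ?_⟩)
  have h3 : 0 < η / 3 := ENNReal.div_pos hη.ne' (by simp)
  obtain ⟨g, ig, ⟨c, hc⟩, hg⟩ := h _ h3
  have hclose : ∀ᶠ R : ℝ in atTop, edist (⨍ y in Metric.ball (0 : Eu m) R, u y)
      (⨍ y in Metric.ball (0 : Eu m) R, g y) < η / 3 := by
    filter_upwards [eventually_lt_of_limsup_lt hg] with R hR
    refine lt_of_le_of_lt ?_ hR
    refine le_trans (le_of_eq ?_) (enorm_setAverage_ball_le (u - g) R)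
    rw [edist_eq_enorm_sub]
    simp only [setAverage_ball_eq]
    rw [← integral_sub (hu.integrable_cond le_rfl R) (ig.integrable_cond le_rfl R)]
    rfl
  obtain ⟨t, ht, htg⟩ := (EMetric.cauchy_iff.1 (Tendsto.cauchy_map hc)).2 (η / 3) h3
  refine ⟨_, image_mem_map (inter_mem hclose (mem_map.1 ht)), ?_⟩
  rintro _ ⟨R, ⟨hR, hRt⟩, rfl⟩ _ ⟨S, ⟨hS, hSt⟩, rfl⟩
  have hRS := htg _ hRt _ hSt
  calc _ ≤ _ := edist_triangle4 _ (⨍ y in Metric.ball (0 : Eu m) R, g y)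
        (⨍ y in Metric.ball (0 : Eu m) S, g y) _
    _ < η / 3 + η / 3 + η / 3 := by
        refine ENNReal.add_lt_add (ENNReal.add_lt_add hR hRS) ?_
        rw [edist_comm]; exact hS
    _ = η := ENNReal.add_thirds η

/-- Hölder's inequality for the Besicovitch seminorms. -/
lemma IsMarcinkiewicz.bilin {p q r : ℝ≥0∞} [ENNReal.HolderTriple q p r]
    (B : F₁ →L[ℝ] F₂ →L[ℝ] F₃) {u : Eu m → F₁} {v : Eu m → F₂}
    (hu : IsMarcinkiewicz q u) (hv : IsMarcinkiewicz p v) :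
    IsMarcinkiewicz r (fun y => B (u y) (v y)) ∧
    besicovitchSeminorm r (fun y => B (u y) (v y)) ≤
      ‖B‖ₑ * (besicovitchSeminorm q u * besicovitchSeminorm p v) := by
  have key : besicovitchSeminorm r (fun y => B (u y) (v y)) ≤
      ‖B‖ₑ * (besicovitchSeminorm q u * besicovitchSeminorm p v) := by
    have h1 : ∀ R : ℝ, eLpNorm (fun y => B (u y) (v y)) r (volume[|Metric.ball (0 : Eu m) R]) ≤
        ‖B‖ₑ * (eLpNorm u q (volume[|Metric.ball (0 : Eu m) R]) *
          eLpNorm v p (volume[|Metric.ball (0 : Eu m) R])) := fun R => by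
      rw [← mul_assoc]
      exact eLpNorm_le_eLpNorm_mul_eLpNorm_of_nnnorm (memLp_cond_ball (hu.1 R)).1
        (memLp_cond_ball (hv.1 R)).1 (B · ·) ‖B‖₊
        (Eventually.of_forall fun _ => B.le_opNorm₂ _ _)
    refine (limsup_le_limsup (Eventually.of_forall h1)).trans ?_
    rw [ENNReal.limsup_const_mul_of_ne_top (by simp)]
    -- Finiteness of both seminorms excludes the form `0 · ∞`, for which the limsup of a product may
    -- exceed the product of the limsups.
    exact mul_le_mul_right (ENNReal.limsup_mul_le' (Or.inr hv.2.ne) (Or.inl hu.2.ne)) _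
  refine ⟨⟨fun R => B.memLp_of_bilin r (hu.1 R) (hv.1 R), key.trans_lt ?_⟩, key⟩
  exact ENNReal.mul_lt_top (by simp) (ENNReal.mul_lt_top hu.2 hv.2)

end Averages

/-! ### The vector-valued algebra -/

section Vec

variable {m : ℕ} {F F₁ F₂ F₃ : Type*} [NormedAddCommGroup F] [NormedSpace ℝ F]
  [NormedAddCommGroup F₁] [NormedSpace ℝ F₁] [NormedAddCommGroup F₂] [NormedSpace ℝ F₂]
  [NormedAddCommGroup F₃] [NormedSpace ℝ F₃]

/-- The function `y ↦ u y • v`. -/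
def tmul (u : Eu m →ᵇ ℝ) (v : F) : Eu m →ᵇ F :=
  BoundedContinuousFunction.ofNormedAddCommGroup (fun y => u y • v) (by fun_prop) (‖u‖ * ‖v‖)
    fun y => by
      rw [norm_smul]
      exact mul_le_mul_of_nonneg_right (u.norm_coe_le_norm y) (norm_nonneg v)

@[simp] lemma tmul_apply (u : Eu m →ᵇ ℝ) (v : F) (y : Eu m) : tmul u v y = u y • v := rfl

lemma MeanValueAlgebra.tmul_mem_vec (A : MeanValueAlgebra m) {u : Eu m →ᵇ ℝ}
    (hu : u ∈ A.carrier) (v : F) : tmul u v ∈ A.vec F :=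
  Submodule.le_topologicalClosure _ (Submodule.subset_span ⟨u, hu, v, fun _ => rfl⟩)

/-- Induction principle for `A(ℝ^m; F)`: a property defining a closed subspace need only be checked
on elementary tensors. -/
lemma MeanValueAlgebra.vec_le (A : MeanValueAlgebra m) {S : Submodule ℝ (Eu m →ᵇ F)}
    (hS : IsClosed (S : Set (Eu m →ᵇ F))) (h : ∀ u ∈ A.carrier, ∀ v : F, tmul u v ∈ S) :
    A.vec F ≤ S := by
  refine Submodule.topologicalClosure_minimal _ (Submodule.span_le.2 ?_) hS
  rintro g ⟨u, hu, v, hg⟩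
  have : g = tmul u v := by ext y; exact hg y
  rw [this]
  exact h u hu v

lemma MeanValueAlgebra.isClosed_vec (A : MeanValueAlgebra m) :
    IsClosed (A.vec F : Set (Eu m →ᵇ F)) := Submodule.isClosed_topologicalClosure _

instance (A : MeanValueAlgebra m) [CompleteSpace F] : CompleteSpace (A.vec F) :=
  A.isClosed_vec.completeSpace_coe

/-- Scalar values add nothing because `A` is already closed. This brings scalar pairings of
vector-valued elements back into `A`, where the weak-* limit is available. -/
lemma MeanValueAlgebra.mem_carrier_of_mem_vec (A : MeanValueAlgebra m) {a : Eu m →ᵇ ℝ}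
    (ha : a ∈ A.vec ℝ) : a ∈ A.carrier := by
  have h : A.vec ℝ ≤ Subalgebra.toSubmodule A.carrier := by
    refine A.vec_le A.isClosed fun u hu v => ?_
    have : tmul u v = v • u := by ext y; simp [mul_comm]
    rw [this]
    exact Subalgebra.smul_mem _ hu v
  exact h ha

/-- The bilinear map `(a, b) ↦ (y ↦ B (a y) (b y))` on bounded continuous functions. -/
def bcfBilin (m : ℕ) (B : F₁ →L[ℝ] F₂ →L[ℝ] F₃) :
    (Eu m →ᵇ F₁) →L[ℝ] (Eu m →ᵇ F₂) →L[ℝ] (Eu m →ᵇ F₃) :=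
  have hb : ∀ (a : Eu m →ᵇ F₁) (b : Eu m →ᵇ F₂) (y : Eu m),
      ‖B (a y) (b y)‖ ≤ ‖B‖ * ‖a‖ * ‖b‖ := fun a b y => by
    refine (B.le_opNorm₂ _ _).trans ?_
    gcongr
    · exact a.norm_coe_le_norm y
    · exact b.norm_coe_le_norm y
  LinearMap.mkContinuous₂ (LinearMap.mk₂ ℝ
    (fun a b => BoundedContinuousFunction.ofNormedAddCommGroup (fun y => B (a y) (b y))
      (by fun_prop) (‖B‖ * ‖a‖ * ‖b‖) (hb a b))
    (fun a a' b => by ext y; simp) (fun c a b => by ext y; simp)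
    (fun a b b' => by ext y; simp) (fun c a b => by ext y; simp)) ‖B‖
    fun a b => BoundedContinuousFunction.norm_ofNormedAddCommGroup_le _ (by positivity) (hb a b)

@[simp] lemma bcfBilin_apply (B : F₁ →L[ℝ] F₂ →L[ℝ] F₃) (a : Eu m →ᵇ F₁) (b : Eu m →ᵇ F₂)
    (y : Eu m) : bcfBilin m B a b y = B (a y) (b y) := rfl

/-- By continuity in each variable in turn it is enough to look at two tensors; their product is the
tensor of `u * u'` and `B v v'`, and `A` is an algebra. -/
lemma MeanValueAlgebra.bcfBilin_mem_vec (A : MeanValueAlgebra m) (B : F₁ →L[ℝ] F₂ →L[ℝ] F₃)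
    {a : Eu m →ᵇ F₁} {b : Eu m →ᵇ F₂} (ha : a ∈ A.vec F₁) (hb : b ∈ A.vec F₂) :
    bcfBilin m B a b ∈ A.vec F₃ := by
  have h : A.vec F₁ ≤ (A.vec F₃).comap ((bcfBilin m B).flip b).toLinearMap := by
    refine A.vec_le (A.isClosed_vec.preimage ((bcfBilin m B).flip b).continuous) fun u hu v => ?_
    have h' : A.vec F₂ ≤ (A.vec F₃).comap (bcfBilin m B (tmul u v)).toLinearMap := by
      refine A.vec_le (A.isClosed_vec.preimage (bcfBilin m B (tmul u v)).continuous)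
        fun u' hu' v' => ?_
      have : bcfBilin m B (tmul u v) (tmul u' v') = tmul (u * u') (B v v') := by
        ext y
        simp [smul_smul, mul_comm]
      change bcfBilin m B (tmul u v) (tmul u' v') ∈ A.vec F₃
      rw [this]
      exact A.tmul_mem_vec (mul_mem hu hu') _
    exact h' hb
  exact h ha

/-- The bilinear map `(a, b) ↦ (y ↦ B (a y) (b y))` on the vector-valued algebras. -/
def MeanValueAlgebra.vecBilin (A : MeanValueAlgebra m) (B : F₁ →L[ℝ] F₂ →L[ℝ] F₃) :
    A.vec F₁ →L[ℝ] A.vec F₂ →L[ℝ] A.vec F₃ :=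
  LinearMap.mkContinuous₂ (LinearMap.mk₂ ℝ
    (fun a b => ⟨bcfBilin m B a.1 b.1, A.bcfBilin_mem_vec B a.2 b.2⟩)
    (fun a a' b => by ext y; simp) (fun c a b => by ext y; simp)
    (fun a b b' => by ext y; simp) (fun c a b => by ext y; simp)) ‖bcfBilin m B‖
    fun a b => (bcfBilin m B).le_opNorm₂ a.1 b.1

@[simp] lemma MeanValueAlgebra.vecBilin_apply (A : MeanValueAlgebra m) (B : F₁ →L[ℝ] F₂ →L[ℝ] F₃)
    (a : A.vec F₁) (b : A.vec F₂) (y : Eu m) :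
    (A.vecBilin B a b : Eu m →ᵇ F₃) y = B ((a : Eu m →ᵇ F₁) y) ((b : Eu m →ᵇ F₂) y) := rfl

lemma HasMeanValue.of_uniform_approx [CompleteSpace F] {a : Eu m →ᵇ F}
    (h : ∀ η : ℝ, 0 < η → ∃ b : Eu m →ᵇ F, (∃ c, HasMeanValue b c) ∧ dist a b < η) :
    ∃ c, HasMeanValue a c := by
  refine exists_hasMeanValue_of_approx (isMarcinkiewicz_bcf 1 a) fun η hη => ?_
  obtain ⟨δ, hδ, hδη⟩ : ∃ δ : ℝ, 0 < δ ∧ ENNReal.ofReal δ < η := by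
    obtain ⟨δ, hδ, h'⟩ := ENNReal.lt_iff_exists_nnreal_btwn.1 hη
    exact ⟨δ, by simpa using hδ, by simpa using h'⟩
  obtain ⟨b, hb, hab⟩ := h δ hδ
  refine ⟨b, isMarcinkiewicz_bcf 1 b, hb, lt_of_le_of_lt ?_ hδη⟩
  refine besicovitchSeminorm_le_of_bound fun y => ?_
  rw [Pi.sub_apply, ← dist_eq_norm]
  exact (a.dist_coe_le_dist y).trans hab.le

/-- An element of an algebra with mean value has a mean value in the sense of averages over balls,
and this mean value is the weak-* limit of the rescaled functions. -/
lemma MeanValueAlgebra.exists_hasMeanValue (A : MeanValueAlgebra m) {u : Eu m →ᵇ ℝ}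
    (hu : u ∈ A.carrier) : ∃ M : ℝ, HasMeanValue u M ∧ ∀ φ : Eu m → ℝ, Integrable φ →
      Tendsto (fun ε : ℝ => ∫ x, u (ε⁻¹ • x) * φ x) (𝓝[>] 0) (𝓝 (M * ∫ x, φ x)) := by
  obtain ⟨M, hM⟩ := A.mean u hu
  refine ⟨M, ?_, hM⟩
  have hpos : 0 < (volume : Measure (Eu m)).real (Metric.ball 0 1) :=
    ENNReal.toReal_pos (Metric.measure_ball_pos _ _ one_pos).ne' measure_ball_lt_top.ne
  have hint : Integrable ((Metric.ball (0 : Eu m) 1).indicator (fun _ => (1 : ℝ))) :=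
    (integrable_indicator_iff measurableSet_ball).2 (integrableOn_const measure_ball_lt_top.ne)
  -- Weak-* convergence is tested on the indicator of the unit ball with `ε = 1 / R`; the dilation
  -- by `R` turns the normalized integral into the average over `B_R`.
  have h1 := ((hM _ hint).comp (tendsto_inv_atTop_nhdsGT_zero (𝕜 := ℝ))).const_mul
    ((volume : Measure (Eu m)).real (Metric.ball 0 1))⁻¹
  have h2 : ∫ x, (Metric.ball (0 : Eu m) 1).indicator (fun _ => (1 : ℝ)) x =
      (volume : Measure (Eu m)).real (Metric.ball 0 1) := by
    rw [integral_indicator measurableSet_ball]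
    simp
  rw [h2, mul_comm M, inv_mul_cancel_left₀ hpos.ne'] at h1
  refine h1.congr' ?_
  filter_upwards [eventually_gt_atTop 0] with R hR
  have h3 : ∫ x, u (R • x) * (Metric.ball (0 : Eu m) 1).indicator (fun _ => (1 : ℝ)) x =
      ∫ x in Metric.ball (0 : Eu m) 1, u (R • x) := by
    rw [← integral_indicator measurableSet_ball]
    congr 1
    ext x
    by_cases hx : x ∈ Metric.ball (0 : Eu m) 1
    · rw [Set.indicator_of_mem hx, Set.indicator_of_mem hx, mul_one]
    · rw [Set.indicator_of_notMem hx, Set.indicator_of_notMem hx, mul_zero]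
  simp only [Function.comp_apply, inv_inv]
  rw [h3, Measure.setIntegral_comp_smul_of_pos _ _ _ hR, smul_unitBall hR.ne', setAverage_eq,
    Real.norm_of_nonneg hR.le, measureReal_def (s := Metric.ball 0 R),
    Measure.addHaar_ball_of_pos _ _ hR, ENNReal.toReal_mul,
    ENNReal.toReal_ofReal (by positivity), ← measureReal_def, mul_inv,
    smul_eq_mul, smul_eq_mul, ← mul_assoc, mul_comm (_⁻¹) (_⁻¹)]

/-- Functions with a mean value form a subspace closed under uniform limits, and it contains the
tensors `u ⊗ v`, whose mean is `M(u) • v`. -/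
lemma MeanValueAlgebra.exists_hasMeanValue_vec [CompleteSpace F] (A : MeanValueAlgebra m)
    {a : Eu m →ᵇ F} (ha : a ∈ A.vec F) : ∃ c, HasMeanValue a c := by
  let S : Submodule ℝ (Eu m →ᵇ F) :=
    { carrier := {a | ∃ c, HasMeanValue a c}
      zero_mem' := ⟨0, by simp [HasMeanValue]⟩
      add_mem' := by
        rintro a b ⟨c, hc⟩ ⟨d, hd⟩
        exact ⟨c + d, hc.add hd (isMarcinkiewicz_bcf 1 a) (isMarcinkiewicz_bcf 1 b)⟩
      smul_mem' := by
        rintro k a ⟨c, hc⟩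
        exact ⟨k • c, hc.smul k⟩ }
  have hS : IsClosed (S : Set (Eu m →ᵇ F)) := by
    refine isClosed_of_closure_subset fun a ha => ?_
    exact HasMeanValue.of_uniform_approx fun η hη => Metric.mem_closure_iff.1 ha η hη
  refine A.vec_le hS (fun u hu v => ?_) ha
  obtain ⟨M, hM, -⟩ := A.exists_hasMeanValue hu
  exact ⟨M • v, hM.clm_comp (isMarcinkiewicz_bcf 1 u)
    ((ContinuousLinearMap.id ℝ ℝ).smulRight v)⟩

end Vec

/-! ### Besicovitch spaces -/

section Besicovitch

variable {m : ℕ} {A : MeanValueAlgebra m} {F F₁ F₂ F₃ : Type*}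
  [NormedAddCommGroup F] [NormedSpace ℝ F]
  [NormedAddCommGroup F₁] [NormedSpace ℝ F₁] [NormedAddCommGroup F₂] [NormedSpace ℝ F₂]
  [NormedAddCommGroup F₃] [NormedSpace ℝ F₃]
  {p q r : ℝ≥0∞} [Fact (1 ≤ p)] [Fact (1 ≤ q)] [Fact (1 ≤ r)]

/-- The element of the Marcinkiewicz-type space with given underlying function. -/
def Marcinkiewicz.ofFun (u : Eu m → F) (hu : IsMarcinkiewicz p u) : Marcinkiewicz m F p :=
  (⟨u, hu⟩ : marcinkiewiczSubmodule m F p)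

@[simp] lemma Marcinkiewicz.toFun_ofFun (u : Eu m → F) (hu : IsMarcinkiewicz p u) :
    (Marcinkiewicz.ofFun u hu).toFun = u := rfl

lemma Marcinkiewicz.ext {u v : Marcinkiewicz m F p} (h : u.toFun = v.toFun) : u = v :=
  Subtype.ext h

lemma Marcinkiewicz.enorm_def (u : Marcinkiewicz m F p) :
    ‖u‖ₑ = besicovitchSeminorm p u.toFun := by
  rw [← ofReal_norm, Marcinkiewicz.norm_def, ENNReal.ofReal_toReal u.prop.2.ne]

/-- The bilinear map `(u, v) ↦ (y ↦ B (u y) (v y))` on the Marcinkiewicz-type spaces. -/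
def marcinkiewiczBilin (m : ℕ) [ENNReal.HolderTriple q p r] (B : F₁ →L[ℝ] F₂ →L[ℝ] F₃) :
    Marcinkiewicz m F₁ q →L[ℝ] Marcinkiewicz m F₂ p →L[ℝ] Marcinkiewicz m F₃ r :=
  LinearMap.mkContinuous₂ (LinearMap.mk₂ ℝ
    (fun u v => Marcinkiewicz.ofFun (fun y => B (u.toFun y) (v.toFun y)) (u.prop.bilin B v.prop).1)
    (fun u u' v => Marcinkiewicz.ext (by ext y; simp [Marcinkiewicz.toFun_add]))
    (fun c u v => Marcinkiewicz.ext (by ext y; simp [Marcinkiewicz.toFun_smul]))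
    (fun u v v' => Marcinkiewicz.ext (by ext y; simp [Marcinkiewicz.toFun_add]))
    (fun c u v => Marcinkiewicz.ext (by ext y; simp [Marcinkiewicz.toFun_smul]))) ‖B‖
    fun u v => by
      have h := (u.prop.bilin (r := r) B v.prop).2
      rw [LinearMap.mk₂_apply, Marcinkiewicz.norm_def, Marcinkiewicz.norm_def,
        Marcinkiewicz.norm_def, Marcinkiewicz.toFun_ofFun, mul_assoc, ← ENNReal.toReal_mul]
      refine (ENNReal.toReal_mono ?_ h).trans (le_of_eq ?_)
      · exact ENNReal.mul_ne_top (by simp) (ENNReal.mul_ne_top u.prop.2.ne v.prop.2.ne)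
      · simp [ENNReal.toReal_mul]

lemma marcinkiewiczBilin_toFun [ENNReal.HolderTriple q p r] (B : F₁ →L[ℝ] F₂ →L[ℝ] F₃)
    (u : Marcinkiewicz m F₁ q) (v : Marcinkiewicz m F₂ p) :
    (marcinkiewiczBilin (r := r) m B u v).toFun = fun y => B (u.toFun y) (v.toFun y) := rfl

lemma marcinkiewiczBilin_mem [ENNReal.HolderTriple q p r] (B : F₁ →L[ℝ] F₂ →L[ℝ] F₃)
    {u : Marcinkiewicz m F₁ q} {v : Marcinkiewicz m F₂ p}
    (hu : u ∈ (A.vecMarcinkiewicz F₁ q).topologicalClosure)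
    (hv : v ∈ (A.vecMarcinkiewicz F₂ p).topologicalClosure) :
    marcinkiewiczBilin m B u v ∈ (A.vecMarcinkiewicz F₃ r).topologicalClosure := by
  refine map_mem_closure₂ (f := fun u v => marcinkiewiczBilin m B u v)
    (marcinkiewiczBilin m B).continuous₂ hu hv ?_
  rintro u ⟨a, ha, hua⟩ v ⟨b, hb, hvb⟩
  refine ⟨bcfBilin m B a b, A.bcfBilin_mem_vec B ha hb, ?_⟩
  rw [marcinkiewiczBilin_toFun, hua, hvb]
  rfl

lemma MeanValueAlgebra.BesicovitchFun.enorm_def (U : A.BesicovitchFun F p) :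
    ‖U‖ₑ = besicovitchSeminorm p U.toFun := Marcinkiewicz.enorm_def U.1

lemma MeanValueAlgebra.BesicovitchFun.isMarcinkiewicz (U : A.BesicovitchFun F p) :
    IsMarcinkiewicz p U.toFun := Marcinkiewicz.prop U.1

/-- The bilinear map `(u, v) ↦ (y ↦ B (u y) (v y))` on the generalized Besicovitch spaces of
functions. -/
def MeanValueAlgebra.funBilin (A : MeanValueAlgebra m) [ENNReal.HolderTriple q p r]
    (B : F₁ →L[ℝ] F₂ →L[ℝ] F₃) :
    A.BesicovitchFun F₁ q →L[ℝ] A.BesicovitchFun F₂ p →L[ℝ] A.BesicovitchFun F₃ r :=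
  LinearMap.mkContinuous₂ (LinearMap.mk₂ ℝ
    (fun u v => ⟨marcinkiewiczBilin m B u.1 v.1, marcinkiewiczBilin_mem B u.2 v.2⟩)
    (fun u u' v => Subtype.ext (by
      change marcinkiewiczBilin m B (u.1 + u'.1) v.1 = marcinkiewiczBilin m B u.1 v.1 +
        marcinkiewiczBilin m B u'.1 v.1
      rw [map_add]; rfl))
    (fun c u v => Subtype.ext (by
      change marcinkiewiczBilin m B (c • u.1) v.1 = c • marcinkiewiczBilin m B u.1 v.1
      rw [map_smul]; rfl))
    (fun u v v' => Subtype.ext (map_add (marcinkiewiczBilin m B u.1) v.1 v'.1))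
    (fun c u v => Subtype.ext (map_smul (marcinkiewiczBilin m B u.1) c v.1)))
    ‖marcinkiewiczBilin (q := q) (p := p) (r := r) m B‖
    fun u v => (marcinkiewiczBilin m B).le_opNorm₂ u.1 v.1

/-- The bilinear map induced by `B` on the generalized Besicovitch spaces of classes. -/
def MeanValueAlgebra.bilin (A : MeanValueAlgebra m) [ENNReal.HolderTriple q p r]
    (B : F₁ →L[ℝ] F₂ →L[ℝ] F₃) :
    A.Besicovitch F₁ q →L[ℝ] A.Besicovitch F₂ p →L[ℝ] A.Besicovitch F₃ r :=
  ((ContinuousLinearMap.postcomp _ (SeparationQuotient.mkCLM ℝ (A.BesicovitchFun F₃ r))).comp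
    (A.funBilin B)).bilinearComp (SeparationQuotient.outCLM ℝ _) (SeparationQuotient.outCLM ℝ _)

/-- The choice of linear section hidden in `bilin` is immaterial: a continuous map sends inseparable
pairs to inseparable points. -/
lemma MeanValueAlgebra.bilin_mk [ENNReal.HolderTriple q p r] (B : F₁ →L[ℝ] F₂ →L[ℝ] F₃)
    (U : A.BesicovitchFun F₁ q) (V : A.BesicovitchFun F₂ p) :
    A.bilin (r := r) B (SeparationQuotient.mk U) (SeparationQuotient.mk V) =
      SeparationQuotient.mk (A.funBilin B U V) := by
  change SeparationQuotient.mk (A.funBilin B (SeparationQuotient.outCLM ℝ _ _)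
    (SeparationQuotient.outCLM ℝ _ _)) = _
  refine SeparationQuotient.mk_eq_mk.2 ?_
  have h1 : Inseparable (SeparationQuotient.outCLM ℝ _ (SeparationQuotient.mk U)) U :=
    SeparationQuotient.mk_eq_mk.1 (SeparationQuotient.mk_outCLM ℝ _)
  have h2 : Inseparable (SeparationQuotient.outCLM ℝ _ (SeparationQuotient.mk V)) V :=
    SeparationQuotient.mk_eq_mk.1 (SeparationQuotient.mk_outCLM ℝ _)
  exact (h1.prod h2).map (A.funBilin (r := r) B).continuous₂

lemma norm_besicovitchFun_ofVec_le (a : A.vec F) :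
    (besicovitchSeminorm p (a : Eu m →ᵇ F)).toReal ≤ ‖a‖ :=
  ENNReal.toReal_le_of_le_ofReal (norm_nonneg _)
    (besicovitchSeminorm_le_of_bound (a : Eu m →ᵇ F).norm_coe_le_norm)

/-- The inclusion of the vector-valued algebra into the Besicovitch space of functions. -/
def MeanValueAlgebra.toBesicovitchFun (A : MeanValueAlgebra m) (F : Type*) [NormedAddCommGroup F]
    [NormedSpace ℝ F] (p : ℝ≥0∞) [Fact (1 ≤ p)] : A.vec F →L[ℝ] A.BesicovitchFun F p :=
  LinearMap.mkContinuous
    { toFun := fun a => ⟨Marcinkiewicz.ofFun a.1 (isMarcinkiewicz_bcf p a.1),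
        Submodule.le_topologicalClosure _ ⟨a.1, a.2, rfl⟩⟩
      map_add' := fun _ _ => rfl
      map_smul' := fun _ _ => rfl } 1
    fun a => (norm_besicovitchFun_ofVec_le a).trans_eq (one_mul _).symm

/-- The canonical map from the vector-valued algebra to the Besicovitch space. -/
def MeanValueAlgebra.toBesicovitch (A : MeanValueAlgebra m) (F : Type*) [NormedAddCommGroup F]
    [NormedSpace ℝ F] (p : ℝ≥0∞) [Fact (1 ≤ p)] : A.vec F →L[ℝ] A.Besicovitch F p :=
  (SeparationQuotient.mkCLM ℝ _).comp (A.toBesicovitchFun F p)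

lemma MeanValueAlgebra.toBesicovitch_apply (a : A.vec F) :
    A.toBesicovitch F p a = SeparationQuotient.mk (A.toBesicovitchFun F p a) := rfl

lemma MeanValueAlgebra.norm_toBesicovitch_le (a : A.vec F) :
    ‖A.toBesicovitch F p a‖ ≤ ‖a‖ := norm_besicovitchFun_ofVec_le a

lemma MeanValueAlgebra.BesicovitchFun.exists_norm_sub_lt (U : A.BesicovitchFun F p) {η : ℝ}
    (hη : 0 < η) : ∃ a : A.vec F, ‖U - A.toBesicovitchFun F p a‖ < η := by
  obtain ⟨v, ⟨a, ha, hva⟩, hv⟩ := Metric.mem_closure_iff.1 U.2 η hη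
  refine ⟨⟨a, ha⟩, ?_⟩
  have h1 : v = (A.toBesicovitchFun F p ⟨a, ha⟩).1 := Marcinkiewicz.ext hva
  rw [h1, dist_eq_norm] at hv
  exact hv

lemma MeanValueAlgebra.Besicovitch.exists_norm_sub_lt (b : A.Besicovitch F p) {η : ℝ}
    (hη : 0 < η) : ∃ a : A.vec F, ‖b - A.toBesicovitch F p a‖ < η := by
  obtain ⟨U, rfl⟩ := SeparationQuotient.surjective_mk b
  exact U.exists_norm_sub_lt hη

/-- Elements of `A(ℝ^m; F)` have mean values and are dense for the seminorm of exponent `p`, which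
dominates the one of exponent `1` by Jensen's inequality on balls. -/
lemma MeanValueAlgebra.BesicovitchFun.hasMeanValue [CompleteSpace F] (U : A.BesicovitchFun F p) :
    HasMeanValue U.toFun (meanValue U.toFun) := by
  have h : ∃ c, HasMeanValue U.toFun c := by
    refine exists_hasMeanValue_of_approx (U.isMarcinkiewicz.mono_exponent Fact.out) fun η hη => ?_
    obtain ⟨δ, hδ, hδη⟩ : ∃ δ : ℝ, 0 < δ ∧ ENNReal.ofReal δ < η := by
      obtain ⟨δ, hδ, h'⟩ := ENNReal.lt_iff_exists_nnreal_btwn.1 hη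
      exact ⟨δ, by simpa using hδ, by simpa using h'⟩
    obtain ⟨a, ha⟩ := U.exists_norm_sub_lt hδ
    refine ⟨a.1, isMarcinkiewicz_bcf 1 a.1, A.exists_hasMeanValue_vec a.2, lt_of_le_of_lt ?_ hδη⟩
    refine (besicovitchSeminorm_mono_exponent (Fact.out : 1 ≤ p)
      fun R => (memLp_cond_ball ((U - A.toBesicovitchFun F p a).isMarcinkiewicz.1 R)).1).trans ?_
    have h2 := (U - A.toBesicovitchFun F p a).enorm_def
    change besicovitchSeminorm p (U - A.toBesicovitchFun F p a).toFun ≤ _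
    rw [← h2, ← ofReal_norm]
    exact ENNReal.ofReal_le_ofReal ha.le
  obtain ⟨c, hc⟩ := h
  rw [hc.meanValue_eq]
  exact hc

/-- The mean value on the Besicovitch space of functions. -/
def MeanValueAlgebra.meanFunCLM [CompleteSpace F] (A : MeanValueAlgebra m) (p : ℝ≥0∞)
    [Fact (1 ≤ p)] : A.BesicovitchFun F p →L[ℝ] F :=
  LinearMap.mkContinuous
    { toFun := fun U => meanValue U.toFun
      map_add' := fun U V => ((U.hasMeanValue.add V.hasMeanValue
        (U.isMarcinkiewicz.mono_exponent Fact.out)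
        (V.isMarcinkiewicz.mono_exponent Fact.out))).meanValue_eq
      map_smul' := fun c U => (U.hasMeanValue.smul c).meanValue_eq } 1
    fun U => by
      have h : ‖meanValue U.toFun‖ₑ ≤ ‖U‖ₑ := by
        rw [U.enorm_def]
        exact U.hasMeanValue.enorm_le.trans (besicovitchSeminorm_mono_exponent Fact.out
          fun R => (memLp_cond_ball (U.isMarcinkiewicz.1 R)).1)
      rw [one_mul]
      exact enorm_le_iff_norm_le.1 h

/-- The mean value on the Besicovitch space of classes. -/
def MeanValueAlgebra.meanCLM [CompleteSpace F] (A : MeanValueAlgebra m) (p : ℝ≥0∞)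
    [Fact (1 ≤ p)] : A.Besicovitch F p →L[ℝ] F :=
  SeparationQuotient.liftCLM (A.meanFunCLM p)
    fun _ _ h => (h.map (A.meanFunCLM p).continuous).eq

lemma MeanValueAlgebra.meanCLM_mk [CompleteSpace F] (U : A.BesicovitchFun F p) :
    A.meanCLM p (SeparationQuotient.mk U) = meanValue U.toFun := rfl

end Besicovitch

/-! ### The duality map `t ↦ |t|^{p-1} sign t` and a quantitative strict convexity inequality -/

section Scalar

/-- The function `t ↦ |t|^s sign t`. -/
def signedPow (s t : ℝ) : ℝ := max t 0 ^ s - max (-t) 0 ^ s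

lemma signedPow_of_nonneg {s t : ℝ} (hs : 0 < s) (ht : 0 ≤ t) : signedPow s t = t ^ s := by
  simp [signedPow, ht, Real.zero_rpow hs.ne']

lemma signedPow_neg (s t : ℝ) : signedPow s (-t) = -signedPow s t := by
  simp [signedPow]

lemma continuous_signedPow {s : ℝ} (hs : 0 < s) : Continuous (signedPow s) := by
  have h := Real.continuous_rpow_const hs.le
  exact (h.comp (continuous_id.max continuous_const)).sub
    (h.comp (continuous_neg.max continuous_const))

lemma abs_signedPow {s : ℝ} (hs : 0 < s) (t : ℝ) : |signedPow s t| = |t| ^ s := by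
  rcases le_total 0 t with ht | ht
  · rw [signedPow_of_nonneg hs ht, abs_of_nonneg ht, abs_of_nonneg (Real.rpow_nonneg ht s)]
  · have h := signedPow_of_nonneg hs (neg_nonneg.2 ht)
    rw [signedPow_neg] at h
    rw [← abs_neg, h, abs_of_nonpos ht, abs_of_nonneg (Real.rpow_nonneg (neg_nonneg.2 ht) s)]

lemma signedPow_mul_self {p : ℝ} (hp : 1 < p) (t : ℝ) : signedPow (p - 1) t * t = |t| ^ p := by
  have hs : 0 < p - 1 := by linarith
  have key : ∀ t : ℝ, 0 ≤ t → t ^ (p - 1) * t = t ^ p := fun t ht => by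
    rw [← Real.rpow_add_one' ht (by linarith), sub_add_cancel]
  rcases le_total 0 t with ht | ht
  · rw [signedPow_of_nonneg hs ht, abs_of_nonneg ht, key t ht]
  · have h := signedPow_of_nonneg hs (neg_nonneg.2 ht)
    rw [signedPow_neg] at h
    rw [abs_of_nonpos ht, ← key _ (neg_nonneg.2 ht), ← h]
    ring

lemma signedPow_mul {s c : ℝ} (hs : 0 < s) (hc : 0 ≤ c) (t : ℝ) :
    signedPow s (c * t) = c ^ s * signedPow s t := by
  rcases le_total 0 t with ht | ht
  · rw [signedPow_of_nonneg hs (mul_nonneg hc ht), signedPow_of_nonneg hs ht, Real.mul_rpow hc ht]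
  · have ht' := neg_nonneg.2 ht
    have h := signedPow_of_nonneg hs (mul_nonneg hc ht')
    rw [Real.mul_rpow hc ht', mul_neg, signedPow_neg, ← signedPow_of_nonneg hs ht',
      signedPow_neg] at h
    linarith

/-- The Bregman divergence of `|·|^p`. -/
def bregman (p a b : ℝ) : ℝ := |a| ^ p + (p - 1) * |b| ^ p - p * (a * signedPow (p - 1) b)

lemma bregman_neg (p a b : ℝ) : bregman p (-a) (-b) = bregman p a b := by
  simp [bregman, signedPow_neg]

/-- Homogeneity is what reduces the inequality for all pairs to a compactness argument on normalized
ones. -/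
lemma bregman_mul {p c : ℝ} (hp : 1 < p) (hc : 0 ≤ c) (a b : ℝ) :
    bregman p (c * a) (c * b) = c ^ p * bregman p a b := by
  have h : c ^ p = c ^ (p - 1) * c := by
    rw [← Real.rpow_add_one' hc (by linarith), sub_add_cancel]
  simp only [bregman, abs_mul, abs_of_nonneg hc, Real.mul_rpow hc (abs_nonneg _),
    signedPow_mul (sub_pos.2 hp) hc, h]
  ring

/-- For `a < 0` the cross term has the favourable sign. For `a ≥ 0` this is the strict Bernoulli
inequality `1 + p (a / b - 1) < (a / b)^p`, multiplied by `b^p`. -/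
lemma bregman_pos_of_pos {p a b : ℝ} (hp : 1 < p) (hb : 0 < b) (hab : a ≠ b) :
    0 < bregman p a b := by
  have hs : 0 < p - 1 := by linarith
  have hbp : 0 < b ^ p := Real.rpow_pos_of_pos hb p
  have hbs : 0 < b ^ (p - 1) := Real.rpow_pos_of_pos hb _
  rw [bregman, signedPow_of_nonneg hs hb.le, abs_of_pos hb]
  rcases lt_or_ge a 0 with ha | ha
  · have h1 : 0 ≤ |a| ^ p := by positivity
    have h2 : 0 < (p - 1) * b ^ p := by positivity
    have h3 : p * (a * b ^ (p - 1)) < 0 :=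
      mul_neg_of_pos_of_neg (by linarith) (mul_neg_of_neg_of_pos ha hbs)
    linarith
  · have h := one_add_mul_self_lt_rpow_one_add (s := a / b - 1)
      (by have := div_nonneg ha hb.le; linarith)
      (by rw [sub_ne_zero, Ne, div_eq_one_iff_eq hb.ne']; exact hab) hp
    rw [add_sub_cancel, Real.div_rpow ha hb.le, lt_div_iff₀ hbp] at h
    have h4 : b ^ p = b ^ (p - 1) * b := by
      rw [← Real.rpow_add_one' hb.le (by linarith), sub_add_cancel]
    have h5 : (1 + p * (a / b - 1)) * b ^ p = (1 - p) * b ^ p + p * (a * b ^ (p - 1)) := by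
      have : a / b * b ^ p = a * b ^ (p - 1) := by
        rw [h4]
        field_simp
      linear_combination p * this
    rw [abs_of_nonneg ha]
    linarith

lemma bregman_pos {p a b : ℝ} (hp : 1 < p) (hab : a ≠ b) : 0 < bregman p a b := by
  rcases lt_trichotomy b 0 with hb | rfl | hb
  · rw [← bregman_neg]
    exact bregman_pos_of_pos hp (neg_pos.2 hb) (by simpa using hab)
  · have h0 : signedPow (p - 1) 0 = 0 := by simp [signedPow]
    have hp0 : p ≠ 0 := by linarith
    simp only [bregman, h0, abs_zero, Real.zero_rpow hp0, mul_zero, sub_zero, add_zero]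
    exact Real.rpow_pos_of_pos (abs_pos.2 hab) p
  · exact bregman_pos_of_pos hp hb hab

lemma bregman_nonneg {p : ℝ} (hp : 1 < p) (a b : ℝ) : 0 ≤ bregman p a b := by
  rcases eq_or_ne a b with rfl | hab
  · have h := signedPow_mul_self hp a
    rw [bregman, mul_comm a, h]
    apply le_of_eq
    ring
  · exact (bregman_pos hp hab).le

/-- Quantitative strict convexity of `|·|^p`: the distance is controlled by the Bregman
divergence. -/
lemma exists_abs_sub_rpow_le {p : ℝ} (hp : 1 < p) {δ : ℝ} (hδ : 0 < δ) :
    ∃ C : ℝ, 0 ≤ C ∧ ∀ a b : ℝ,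
      |a - b| ^ p ≤ C * bregman p a b + δ * (|a| ^ p + |b| ^ p) := by
  have hp0 : 0 < p := by linarith
  have hc := Real.continuous_rpow_const hp0.le
  have hb : Continuous fun z : ℝ × ℝ => bregman p z.1 z.2 := by
    have h1 := continuous_signedPow (sub_pos.2 hp)
    unfold bregman
    exact ((hc.comp continuous_fst.abs).add (continuous_const.mul (hc.comp continuous_snd.abs))).sub
      (continuous_const.mul (continuous_fst.mul (h1.comp continuous_snd)))
  -- Normalized pairs for which the `δ` term alone does not suffice. They form a compact set off the
  -- diagonal, so the divergence has a positive minimum there.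
  let K : Set (ℝ × ℝ) := {z | |z.1| ^ p + |z.2| ^ p = 1 ∧ δ ≤ |z.1 - z.2| ^ p}
  have hKb : ∀ z ∈ K, |z.1| ≤ 1 ∧ |z.2| ≤ 1 := by
    rintro z ⟨hz, -⟩
    have h1 : 0 ≤ |z.1| ^ p := by positivity
    have h2 : 0 ≤ |z.2| ^ p := by positivity
    constructor
    · by_contra! h
      linarith [Real.one_lt_rpow h hp0]
    · by_contra! h
      linarith [Real.one_lt_rpow h hp0]
  have hKc : IsCompact K := by
    refine Metric.isCompact_of_isClosed_isBounded ?_ ?_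
    · refine IsClosed.inter (s₁ := {z : ℝ × ℝ | |z.1| ^ p + |z.2| ^ p = 1})
        (s₂ := {z : ℝ × ℝ | δ ≤ |z.1 - z.2| ^ p}) (isClosed_eq ?_ continuous_const)
        (isClosed_le continuous_const ?_)
      · exact (hc.comp continuous_fst.abs).add (hc.comp continuous_snd.abs)
      · exact hc.comp (continuous_fst.sub continuous_snd).abs
    · refine (Metric.isBounded_closedBall (x := (0 : ℝ × ℝ)) (r := 1)).subset fun z hz => ?_
      rw [mem_closedBall_zero_iff, Prod.norm_def]
      exact max_le (hKb z hz).1 (hKb z hz).2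
  obtain ⟨C, hC0, hC⟩ : ∃ C : ℝ, 0 ≤ C ∧ ∀ z ∈ K, |z.1 - z.2| ^ p ≤ C * bregman p z.1 z.2 := by
    rcases K.eq_empty_or_nonempty with hK | hK
    · exact ⟨0, le_rfl, by simp [hK]⟩
    obtain ⟨z₀, hz₀, hmin⟩ := hKc.exists_isMinOn hK hb.continuousOn
    have hpos : 0 < bregman p z₀.1 z₀.2 := by
      refine bregman_pos hp fun h => ?_
      have := hz₀.2
      rw [h, sub_self, abs_zero, Real.zero_rpow hp0.ne'] at this
      linarith
    -- On `K` both coordinates are at most `1` in absolute value, so `2 ^ p` bounds the left side,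
    -- while the minimum bounds the divergence from below.
    refine ⟨2 ^ p / bregman p z₀.1 z₀.2, by positivity, fun z hz => ?_⟩
    have h1 : |z.1 - z.2| ^ p ≤ 2 ^ p :=
      Real.rpow_le_rpow (abs_nonneg _) ((abs_sub _ _).trans
        (by linarith [(hKb z hz).1, (hKb z hz).2])) hp0.le
    refine h1.trans ?_
    rw [div_mul_eq_mul_div, le_div_iff₀ hpos]
    exact mul_le_mul_of_nonneg_left (hmin hz) (by positivity)
  refine ⟨C, hC0, fun a b => ?_⟩
  have ha0 : 0 ≤ |a| ^ p := by positivity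
  have hb0 : 0 ≤ |b| ^ p := by positivity
  rcases (add_nonneg ha0 hb0).eq_or_lt with h0 | hpos
  · have ha : a = 0 := by
      by_contra h
      linarith [Real.rpow_pos_of_pos (abs_pos.2 h) p]
    have hb : b = 0 := by
      by_contra h
      linarith [Real.rpow_pos_of_pos (abs_pos.2 h) p]
    subst ha hb
    have h00 : |(0 : ℝ) - 0| ^ p = 0 := by simp [Real.zero_rpow hp0.ne']
    rw [h00]
    exact add_nonneg (mul_nonneg hC0 (bregman_nonneg hp _ _)) (mul_nonneg hδ.le h0.le)
  -- Dividing both numbers by `t` normalizes the pair; every term scales by `t ^ p`.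
  · set t := (|a| ^ p + |b| ^ p) ^ p⁻¹ with ht
    have ht0 : 0 < t := Real.rpow_pos_of_pos hpos _
    have htp : t ^ p = |a| ^ p + |b| ^ p := Real.rpow_inv_rpow hpos.le hp0.ne'
    have hab : ∀ c : ℝ, c = t * (t⁻¹ * c) := fun c => by field_simp
    have hsc : ∀ c : ℝ, |t⁻¹ * c| ^ p = |c| ^ p / (|a| ^ p + |b| ^ p) := fun c => by
      rw [abs_mul, abs_of_pos (inv_pos.2 ht0), Real.mul_rpow (inv_pos.2 ht0).le (abs_nonneg _),
        Real.inv_rpow ht0.le, htp, inv_mul_eq_div]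
    have hsub := hsc (a - b)
    have hbr : bregman p a b = (|a| ^ p + |b| ^ p) * bregman p (t⁻¹ * a) (t⁻¹ * b) := by
      conv_lhs => rw [hab a, hab b]
      rw [bregman_mul hp ht0.le, htp]
    have hbn : 0 ≤ C * bregman p a b := mul_nonneg hC0 (bregman_nonneg hp a b)
    by_cases hδ' : |a - b| ^ p < δ * (|a| ^ p + |b| ^ p)
    · linarith
    · have hz : (t⁻¹ * a, t⁻¹ * b) ∈ K := by
        refine ⟨?_, ?_⟩
        · simp only [hsc]
          rw [← add_div, div_self hpos.ne']
        · simp only [← mul_sub, hsub]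
          rw [le_div_iff₀ hpos]
          exact not_lt.1 hδ'
      have h := hC _ hz
      simp only [← mul_sub, hsub] at h
      rw [div_le_iff₀ hpos] at h
      rw [hbr]
      have : 0 ≤ δ * (|a| ^ p + |b| ^ p) := by positivity
      linarith

end Scalar

/-! ### Norms and duality in `L^p` -/

section LpDual

variable {α : Type*} {mα : MeasurableSpace α} {μ : Measure α} {E : Type*} [NormedAddCommGroup E]
  {p : ℝ≥0∞} [Fact (1 ≤ p)]

lemma lp_norm_rpow_eq_integral (hp : p ≠ ∞) (f : Lp E p μ) :
    ‖f‖ ^ p.toReal = ∫ x, ‖f x‖ ^ p.toReal ∂μ := by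
  have h1 : (1 : ℝ≥0∞) ≤ p := Fact.out
  have hp0 : p ≠ 0 := (zero_lt_one.trans_le h1).ne'
  have h0 : 0 ≤ ∫ x, ‖f x‖ ^ p.toReal ∂μ := integral_nonneg fun x => by positivity
  rw [Lp.norm_def, (Lp.memLp f).eLpNorm_eq_integral_rpow_norm hp0 hp,
    ENNReal.toReal_ofReal (by positivity), Real.rpow_inv_rpow h0 (ENNReal.toReal_pos hp0 hp).ne']

lemma lp_integrable_norm_rpow (hp : p ≠ ∞) (f : Lp E p μ) :
    Integrable (fun x => ‖f x‖ ^ p.toReal) μ := by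
  have h1 : (1 : ℝ≥0∞) ≤ p := Fact.out
  exact (Lp.memLp f).integrable_norm_rpow (zero_lt_one.trans_le h1).ne' hp

lemma conjExponent_ne_top (hp : 1 < p) : p.conjExponent ≠ ∞ := by
  simp [ENNReal.conjExponent, tsub_eq_zero_iff_le, hp]

lemma conjExponent_holder (hp : 1 < p) (hp' : p ≠ ∞) :
    p.toReal.HolderConjugate p.conjExponent.toReal :=
  ENNReal.HolderConjugate.toReal (by simpa using (ENNReal.toReal_lt_toReal (by simp) hp').2 hp)

lemma one_lt_toReal (hp : 1 < p) (hp' : p ≠ ∞) : 1 < p.toReal := by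
  simpa using (ENNReal.toReal_lt_toReal (by simp) hp').2 hp

/-- Common to the scalar and the Bochner case: `V` and `f` stand for the `p`-th powers of the two
norms, `D` for the pairing with the dual, `S` for the `p`-th power of the distance. -/
lemma integral_le_of_le_bregman {V f D S : α → ℝ} {C k l δ : ℝ} (iV : Integrable V μ)
    (jf : Integrable f μ) (iD : Integrable D μ) (iS : Integrable S μ)
    (h : ∀ᵐ x ∂μ, S x ≤ C * (V x + k * f x - l * D x) + δ * (V x + f x)) :
    ∫ x, S x ∂μ ≤ C * (∫ x, V x ∂μ + k * ∫ x, f x ∂μ - l * ∫ x, D x ∂μ) +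
      δ * (∫ x, V x ∂μ + ∫ x, f x ∂μ) := by
  have i1 : Integrable (fun x => V x + k * f x) μ := iV.add (jf.const_mul k)
  have i2 : Integrable (fun x => V x + k * f x - l * D x) μ := i1.sub (iD.const_mul l)
  have i3 : Integrable (fun x => V x + f x) μ := iV.add jf
  refine (integral_mono_ae iS ((i2.const_mul C).add (i3.const_mul δ)) h).trans (le_of_eq ?_)
  rw [integral_add' (i2.const_mul C) (i3.const_mul δ), integral_const_mul, integral_const_mul,
    integral_sub i1 (iD.const_mul l), integral_add iV (jf.const_mul k), integral_add iV jf,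
    integral_const_mul, integral_const_mul]

/-- `g` is the image of `f` under the duality map `L^p → L^{p'}`. -/
def IsLpDual (f : Lp ℝ p μ) (g : Lp ℝ p.conjExponent μ) : Prop :=
  g =ᵐ[μ] fun x => signedPow (p.toReal - 1) (f x)

/-- The duality pairing between `L^p` and `L^{p'}`. -/
def dualPairing (μ : Measure α) (p : ℝ≥0∞) [Fact (1 ≤ p)] :
    Lp ℝ p μ →L[ℝ] Lp ℝ p.conjExponent μ →L[ℝ] ℝ :=
  (ContinuousLinearMap.mul ℝ ℝ).lpPairing μ p p.conjExponent

lemma dualPairing_eq (f : Lp ℝ p μ) (g : Lp ℝ p.conjExponent μ) :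
    dualPairing μ p f g = ∫ x, f x * g x ∂μ :=
  ContinuousLinearMap.lpPairing_eq_integral _ f g

lemma dualPairing_integrable (f : Lp ℝ p μ) (g : Lp ℝ p.conjExponent μ) :
    Integrable (fun x => f x * g x) μ :=
  memLp_one_iff_integrable.1
    ((ContinuousLinearMap.mul ℝ ℝ).memLp_of_bilin 1 (Lp.memLp f) (Lp.memLp g))

lemma IsLpDual.pairing_self (hp : 1 < p) (hp' : p ≠ ∞) {f : Lp ℝ p μ}
    {g : Lp ℝ p.conjExponent μ} (h : IsLpDual f g) :
    dualPairing μ p f g = ‖f‖ ^ p.toReal := by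
  rw [dualPairing_eq, lp_norm_rpow_eq_integral hp']
  refine integral_congr_ae (h.mono fun x hx => ?_)
  simp only [hx]
  rw [mul_comm, signedPow_mul_self (one_lt_toReal hp hp'), Real.norm_eq_abs]

/-- The identity `(p - 1) p' = p`, applied pointwise. -/
lemma IsLpDual.norm_rpow (hp : 1 < p) (hp' : p ≠ ∞) {f : Lp ℝ p μ}
    {g : Lp ℝ p.conjExponent μ} (h : IsLpDual f g) :
    ‖g‖ ^ p.conjExponent.toReal = ‖f‖ ^ p.toReal := by
  rw [lp_norm_rpow_eq_integral hp', lp_norm_rpow_eq_integral (conjExponent_ne_top hp)]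
  refine integral_congr_ae (h.mono fun x hx => ?_)
  have h1 := one_lt_toReal hp hp'
  simp only [hx]
  rw [Real.norm_eq_abs, Real.norm_eq_abs, abs_signedPow (by linarith), ← Real.rpow_mul (abs_nonneg _),
    (conjExponent_holder hp hp').sub_one_mul_conj]

/-- The pointwise inequality is integrated with `a = v`, `b = f`; the cross term of the divergence
integrates to the pairing of `v` with the dual of `f`. Norm distance is thereby controlled by
quantities that pass to the limit. -/
lemma IsLpDual.norm_sub_rpow_le (hp' : p ≠ ∞) {C δ : ℝ}
    (hC : ∀ a b : ℝ, |a - b| ^ p.toReal ≤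
      C * bregman p.toReal a b + δ * (|a| ^ p.toReal + |b| ^ p.toReal))
    (v : Lp ℝ p μ) {f : Lp ℝ p μ} {g : Lp ℝ p.conjExponent μ} (h : IsLpDual f g) :
    ‖v - f‖ ^ p.toReal ≤ C * (‖v‖ ^ p.toReal + (p.toReal - 1) * ‖f‖ ^ p.toReal -
      p.toReal * dualPairing μ p v g) + δ * (‖v‖ ^ p.toReal + ‖f‖ ^ p.toReal) := by
  rw [lp_norm_rpow_eq_integral hp' v, lp_norm_rpow_eq_integral hp' f, dualPairing_eq,
    lp_norm_rpow_eq_integral hp']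
  refine integral_le_of_le_bregman (lp_integrable_norm_rpow hp' v) (lp_integrable_norm_rpow hp' f)
    (dualPairing_integrable v g) (lp_integrable_norm_rpow hp' _) ?_
  filter_upwards [h, Lp.coeFn_sub v f] with x hx hs
  have := hC (v x) (f x)
  simp only [hs, hx, Pi.sub_apply, Real.norm_eq_abs]
  exact this

end LpDual

/-! ### The pairing of Besicovitch spaces -/

section BesicovitchPairing

variable {m n : ℕ} {A : MeanValueAlgebra m} {G₂ : Set (Eu n)} {p : ℝ≥0∞} [Fact (1 ≤ p)]

/-- The integral as a continuous linear form on `L¹(G)`. -/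
def integralL1 (G₂ : Set (Eu n)) : LpOn G₂ 1 →L[ℝ] ℝ := L1.integralCLM' ℝ

lemma integralL1_apply (f : LpOn G₂ 1) : integralL1 G₂ f = ∫ ζ in G₂, f ζ := by
  rw [integralL1, ← L1.integral_eq', L1.integral_eq_integral]

lemma integralL1_mulL1 (f : LpOn G₂ p) (g : LpOn G₂ p.conjExponent) :
    integralL1 G₂ (mulL1 G₂ p f g) = dualPairing (volume.restrict G₂) p f g := rfl

/-- The pairing `(b, c) ↦ ∫_{G₂} M(b(·, ζ) c(·, ζ)) dζ` of Besicovitch spaces. -/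
def MeanValueAlgebra.besicovitchPairing (A : MeanValueAlgebra m) (G₂ : Set (Eu n)) (p : ℝ≥0∞)
    [Fact (1 ≤ p)] : A.Besicovitch (LpOn G₂ p) p →L[ℝ]
      A.Besicovitch (LpOn G₂ p.conjExponent) p.conjExponent →L[ℝ] ℝ :=
  (ContinuousLinearMap.postcomp _ ((integralL1 G₂).comp (A.meanCLM 1))).comp
    (A.bilin (r := 1) (mulL1 G₂ p))

lemma MeanValueAlgebra.besicovitchPairing_apply (b : A.Besicovitch (LpOn G₂ p) p)
    (c : A.Besicovitch (LpOn G₂ p.conjExponent) p.conjExponent) :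
    A.besicovitchPairing G₂ p b c =
      integralL1 G₂ (A.meanCLM 1 (A.bilin (r := 1) (mulL1 G₂ p) b c)) := rfl

/-- Exhibits the pairing as a restriction of a continuous bilinear form, to which Hölder's
inequality for Bochner spaces applies. -/
lemma meanPairing_eq_besicovitchPairing (b : A.Besicovitch (LpOn G₂ p) p)
    (a : A.vec (LpOn G₂ p.conjExponent)) :
    meanPairing b a = A.besicovitchPairing G₂ p b (A.toBesicovitch _ _ a) := by
  obtain ⟨U, rfl⟩ := SeparationQuotient.surjective_mk b
  rw [A.besicovitchPairing_apply, A.toBesicovitch_apply, A.bilin_mk, integralL1_apply,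
    A.meanCLM_mk]
  rfl

/-- `a'` is the image of `a` under the duality map `L^p → L^{p'}`, pointwise. -/
def IsVecDual (a : A.vec (LpOn G₂ p)) (a' : A.vec (LpOn G₂ p.conjExponent)) : Prop :=
  ∀ y, IsLpDual ((a : Eu m →ᵇ LpOn G₂ p) y) ((a' : Eu m →ᵇ LpOn G₂ p.conjExponent) y)

/-- If the averages of `‖w‖^p` converge, the limsup defining the seminorm is a genuine limit. -/
lemma HasMeanValue.besicovitchSeminorm_rpow {F : Type*} [NormedAddCommGroup F] [NormedSpace ℝ F]
    (hp : p ≠ ∞) {w : Eu m → F} (hw : IsMarcinkiewicz p w) {M : ℝ}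
    (h : HasMeanValue (fun y => ‖w y‖ ^ p.toReal) M) :
    (besicovitchSeminorm p w).toReal ^ p.toReal = M := by
  have h1 : (1 : ℝ≥0∞) ≤ p := Fact.out
  have hp0 : p ≠ 0 := (zero_lt_one.trans_le h1).ne'
  have hpp := ENNReal.toReal_pos hp0 hp
  have hM : 0 ≤ M := ge_of_tendsto' h fun R => by
    rw [setAverage_ball_eq]
    exact integral_nonneg fun y => by positivity
  have h2 : Tendsto (fun R : ℝ => eLpNorm w p (volume[|Metric.ball (0 : Eu m) R])) atTop
      (𝓝 (ENNReal.ofReal (M ^ p.toReal⁻¹))) := by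
    refine Tendsto.congr (fun R => ?_) (ENNReal.tendsto_ofReal
      (((Real.continuous_rpow_const (inv_nonneg.2 hpp.le)).tendsto M).comp h))
    rw [(memLp_cond_ball (hw.1 R)).eLpNorm_eq_integral_rpow_norm hp0 hp, Function.comp_apply,
      setAverage_ball_eq]
  rw [besicovitchSeminorm, h2.limsup_eq, ENNReal.toReal_ofReal (by positivity),
    Real.rpow_inv_rpow hM hpp.ne']

section Dual

variable {a : A.vec (LpOn G₂ p)} {a' : A.vec (LpOn G₂ p.conjExponent)}

/-- The function `y ↦ ‖a y‖^p` coincides with `y ↦ ⟨a y, a' y⟩`, which belongs to `A` as a product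
of elements of the vector-valued algebras. This is the purpose of having a dual inside the algebra.
-/
lemma IsVecDual.exists_mean (hp : 1 < p) (hp' : p ≠ ∞) (h : IsVecDual a a') :
    ∃ M : ℝ, HasMeanValue (fun y => ‖(a : Eu m →ᵇ LpOn G₂ p) y‖ ^ p.toReal) M ∧
      ∀ φ : Eu m → ℝ, Integrable φ →
        Tendsto (fun ε : ℝ => ∫ x, ‖(a : Eu m →ᵇ LpOn G₂ p) (ε⁻¹ • x)‖ ^ p.toReal * φ x)
          (𝓝[>] 0) (𝓝 (M * ∫ x, φ x)) := by
  obtain ⟨M, h1, h2⟩ := A.exists_hasMeanValue (A.mem_carrier_of_mem_vec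
    (A.bcfBilin_mem_vec (dualPairing (volume.restrict G₂) p) a.2 a'.2))
  have : ∀ y, bcfBilin m (dualPairing (volume.restrict G₂) p) a.1 a'.1 y =
      ‖(a : Eu m →ᵇ LpOn G₂ p) y‖ ^ p.toReal := fun y => (h y).pairing_self hp hp'
  simp only [this] at h2
  have h3 : (bcfBilin m (dualPairing (volume.restrict G₂) p) a.1 a'.1 : Eu m → ℝ) =
      fun y => ‖(a : Eu m →ᵇ LpOn G₂ p) y‖ ^ p.toReal := funext this
  rw [h3] at h1
  exact ⟨M, h1, h2⟩

lemma IsVecDual.norm_toBesicovitch_rpow (hp' : p ≠ ∞) {M : ℝ}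
    (hM : HasMeanValue (fun y => ‖(a : Eu m →ᵇ LpOn G₂ p) y‖ ^ p.toReal) M) :
    ‖A.toBesicovitch _ p a‖ ^ p.toReal = M :=
  hM.besicovitchSeminorm_rpow hp' (isMarcinkiewicz_bcf p a.1)

lemma IsVecDual.tendsto_integral (hp : 1 < p) (hp' : p ≠ ∞) (h : IsVecDual a a')
    {φ : Eu m → ℝ} (hφ : Integrable φ) :
    Tendsto (fun ε : ℝ => ∫ x, ‖(a : Eu m →ᵇ LpOn G₂ p) (ε⁻¹ • x)‖ ^ p.toReal * φ x)
      (𝓝[>] 0) (𝓝 (‖A.toBesicovitch _ p a‖ ^ p.toReal * ∫ x, φ x)) := by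
  obtain ⟨M, h1, h2⟩ := h.exists_mean hp hp'
  rw [IsVecDual.norm_toBesicovitch_rpow hp' h1]
  exact h2 φ hφ

lemma IsVecDual.norm_rpow_toBesicovitch (hp : 1 < p) (hp' : p ≠ ∞) (h : IsVecDual a a') :
    ‖A.toBesicovitch _ p.conjExponent a'‖ ^ p.conjExponent.toReal =
      ‖A.toBesicovitch _ p a‖ ^ p.toReal := by
  obtain ⟨M, h1, -⟩ := h.exists_mean hp hp'
  rw [IsVecDual.norm_toBesicovitch_rpow hp' h1]
  refine HasMeanValue.besicovitchSeminorm_rpow (conjExponent_ne_top hp)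
    (isMarcinkiewicz_bcf _ a'.1) ?_
  simp only [(h _).norm_rpow hp hp']
  exact h1

lemma IsVecDual.pairing_self (hp : 1 < p) (hp' : p ≠ ∞) (h : IsVecDual a a') :
    A.besicovitchPairing G₂ p (A.toBesicovitch _ _ a) (A.toBesicovitch _ _ a') =
      ‖A.toBesicovitch _ p a‖ ^ p.toReal := by
  obtain ⟨M, h1, -⟩ := h.exists_mean hp hp'
  rw [IsVecDual.norm_toBesicovitch_rpow hp' h1]
  rw [A.besicovitchPairing_apply, A.toBesicovitch_apply, A.toBesicovitch_apply, A.bilin_mk,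
    A.meanCLM_mk]
  -- The mean value commutes with the continuous linear form `∫_{G₂}`, which reduces the claim to
  -- the scalar mean `M`.
  have h2 := (A.funBilin (r := 1) (mulL1 G₂ p) (A.toBesicovitchFun _ p a)
    (A.toBesicovitchFun _ p.conjExponent a')).hasMeanValue.clm_comp
    (MeanValueAlgebra.BesicovitchFun.isMarcinkiewicz (p := 1) _) (integralL1 G₂)
  refine tendsto_nhds_unique h2 ?_
  have : ∀ y, integralL1 G₂ ((A.funBilin (r := 1) (mulL1 G₂ p) (A.toBesicovitchFun _ p a)
      (A.toBesicovitchFun _ p.conjExponent a')).toFun y) = ‖(a : Eu m →ᵇ LpOn G₂ p) y‖ ^ p.toReal :=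
    fun y => (h y).pairing_self hp hp'
  simp only [this]
  exact h1

end Dual

end BesicovitchPairing

/-! ### Density of functions with a dual function -/

section StepFunctions

variable {m n : ℕ} {A : MeanValueAlgebra m} {G₂ : Set (Eu n)} {p : ℝ≥0∞} [Fact (1 ≤ p)]

/-- Weierstrass: on the interval containing the values of `w`, `f` is a uniform limit of
polynomials; polynomials in `w` lie in `A`, and `A` is closed. -/
lemma MeanValueAlgebra.exists_comp_mem (A : MeanValueAlgebra m) {f : ℝ → ℝ} (hf : Continuous f)
    {w : Eu m →ᵇ ℝ} (hw : w ∈ A.carrier) : ∃ g ∈ A.carrier, ∀ y, g y = f (w y) := by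
  have hwb : ∀ y, w y ∈ Set.Icc (-‖w‖) ‖w‖ := fun y => abs_le.1 (w.norm_coe_le_norm y)
  obtain ⟨C, hC⟩ := (isCompact_Icc (a := -‖w‖) (b := ‖w‖)).exists_bound_of_continuousOn
    hf.continuousOn
  let g : Eu m →ᵇ ℝ := BoundedContinuousFunction.ofNormedAddCommGroup (fun y => f (w y))
    (hf.comp w.continuous) C fun y => hC _ (hwb y)
  refine ⟨g, ?_, fun _ => rfl⟩
  have hcl : g ∈ closure (A.carrier : Set (Eu m →ᵇ ℝ)) := by
    refine Metric.mem_closure_iff.2 fun η hη => ?_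
    obtain ⟨P, hP⟩ := exists_polynomial_near_of_continuousOn (-‖w‖) ‖w‖ f hf.continuousOn (η / 2)
      (half_pos hη)
    have hev : ∀ y, (Polynomial.aeval w P : Eu m →ᵇ ℝ) y = P.eval (w y) := fun y => by
      clear hP
      induction P using Polynomial.induction_on' with
      | add P Q hP hQ => simp [hP, hQ]
      | monomial k c => simp [Polynomial.aeval_monomial]
    refine ⟨Polynomial.aeval w P, ?_, ?_⟩
    · exact Algebra.adjoin_le (Set.singleton_subset_iff.2 hw)
        (Polynomial.aeval_mem_adjoin_singleton ℝ w)
    · refine lt_of_le_of_lt ((BoundedContinuousFunction.dist_le (half_pos hη).le).2 fun y => ?_)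
        (half_lt_self hη)
      rw [hev, dist_comm, Real.dist_eq]
      exact (hP _ (hwb y)).le
  exact A.isClosed.closure_subset hcl

variable [hfin : IsFiniteMeasure ((volume : Measure (Eu n)).restrict G₂)]

/-- The function `y ↦ (ζ ↦ w (s ζ) y)` for a finite measurable partition `s`. -/
def stepFun (G₂ : Set (Eu n)) [IsFiniteMeasure ((volume : Measure (Eu n)).restrict G₂)]
    (p : ℝ≥0∞) [Fact (1 ≤ p)] {ι : Type} [Fintype ι] {s : Eu n → ι}
    (hs : ∀ i, MeasurableSet (s ⁻¹' {i})) (w : ι → Eu m →ᵇ ℝ) : Eu m →ᵇ LpOn G₂ p :=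
  ∑ i, tmul (w i) (indicatorConstLp p (hs i) (measure_ne_top _ _) (1 : ℝ))

lemma stepFun_mem_vec {ι : Type} [Fintype ι] {s : Eu n → ι}
    (hs : ∀ i, MeasurableSet (s ⁻¹' {i})) {w : ι → Eu m →ᵇ ℝ} (hw : ∀ i, w i ∈ A.carrier) :
    stepFun G₂ p hs w ∈ A.vec (LpOn G₂ p) :=
  Submodule.sum_mem _ fun i _ => A.tmul_mem_vec (hw i) _

lemma stepFun_coeFn {ι : Type} [Fintype ι] {s : Eu n → ι}
    (hs : ∀ i, MeasurableSet (s ⁻¹' {i})) (w : ι → Eu m →ᵇ ℝ) (y : Eu m) :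
    (stepFun G₂ p hs w y : Eu n → ℝ) =ᵐ[volume.restrict G₂] fun ζ => w (s ζ) y := by
  classical
  have h1 : stepFun G₂ p hs w y =
      ∑ i, w i y • indicatorConstLp p (hs i) (measure_ne_top _ _) (1 : ℝ) := by
    rw [stepFun, BoundedContinuousFunction.sum_apply]
    rfl
  rw [h1]
  have h2 : ∀ᵐ ζ ∂(volume.restrict G₂), ∀ i : ι,
      (w i y • indicatorConstLp p (hs i) (measure_ne_top (volume.restrict G₂) _) (1 : ℝ) :
        LpOn G₂ p) ζ = w i y * (s ⁻¹' {i}).indicator (fun _ => (1 : ℝ)) ζ := by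
    refine ae_all_iff.2 fun i => ?_
    filter_upwards [Lp.coeFn_smul (w i y) (indicatorConstLp p (hs i)
      (measure_ne_top (volume.restrict G₂) _) (1 : ℝ)),
      indicatorConstLp_coeFn (p := p) (hs := hs i)
        (hμs := measure_ne_top (volume.restrict G₂) _) (c := (1 : ℝ))] with ζ h3 h4
    rw [h3, Pi.smul_apply, h4, smul_eq_mul]
  filter_upwards [Lp.coeFn_finsetSum Finset.univ fun i =>
    (w i y • indicatorConstLp p (hs i) (measure_ne_top (volume.restrict G₂) _) (1 : ℝ) :
      LpOn G₂ p), h2] with ζ h3 h4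
  rw [h3]
  simp only [Finset.sum_apply, h4]
  rw [Finset.sum_eq_single (s ζ)]
  · simp
  · intro i _ hi
    rw [Set.indicator_of_notMem, mul_zero]
    simpa using hi.symm
  · simp

/-- The subspace of the functions `y ↦ (ζ ↦ w (s ζ) y)`, `s` a finite measurable partition and
`w i ∈ A`. -/
def MeanValueAlgebra.stepSubmodule (A : MeanValueAlgebra m) (G₂ : Set (Eu n))
    [IsFiniteMeasure ((volume : Measure (Eu n)).restrict G₂)] (p : ℝ≥0∞) [Fact (1 ≤ p)] :
    Submodule ℝ (Eu m →ᵇ LpOn G₂ p) where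
  carrier := {a | ∃ (ι : Type) (_ : Fintype ι) (s : Eu n → ι) (hs : ∀ i, MeasurableSet (s ⁻¹' {i}))
    (w : ι → Eu m →ᵇ ℝ), (∀ i, w i ∈ A.carrier) ∧ a = stepFun G₂ p hs w}
  zero_mem' := ⟨Unit, inferInstance, fun _ => (), fun _ => by simp, fun _ => 0,
    fun _ => zero_mem _, by ext1 y; simp [stepFun]⟩
  add_mem' := by
    rintro _ _ ⟨ι, _, s, hs, w, hw, rfl⟩ ⟨κ, _, t, ht, v, hv, rfl⟩
    -- The sum is a step function for the common refinement of the two partitions.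
    have hst : ∀ i : ι × κ, MeasurableSet ((fun ζ => (s ζ, t ζ)) ⁻¹' {i}) := fun i => by
      have : (fun ζ => (s ζ, t ζ)) ⁻¹' {i} = s ⁻¹' {i.1} ∩ t ⁻¹' {i.2} := by
        ext ζ
        simp [Prod.ext_iff]
      rw [this]
      exact (hs _).inter (ht _)
    refine ⟨ι × κ, inferInstance, fun ζ => (s ζ, t ζ), hst, fun i => w i.1 + v i.2,
      fun i => add_mem (hw _) (hv _), ?_⟩
    ext1 y
    refine Lp.ext ?_
    rw [BoundedContinuousFunction.add_apply]
    filter_upwards [stepFun_coeFn (G₂ := G₂) (p := p) hs w y,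
      stepFun_coeFn (G₂ := G₂) (p := p) ht v y,
      stepFun_coeFn (G₂ := G₂) (p := p) hst (fun i => w i.1 + v i.2) y,
      Lp.coeFn_add (stepFun G₂ p hs w y) (stepFun G₂ p ht v y)] with ζ h1 h2 h3 h4
    rw [h4, Pi.add_apply, h1, h2, h3]
    rfl
  smul_mem' := by
    rintro c _ ⟨ι, _, s, hs, w, hw, rfl⟩
    refine ⟨ι, inferInstance, s, hs, fun i => c • w i, fun i => Subalgebra.smul_mem _ (hw i) c, ?_⟩
    ext1 y
    refine Lp.ext ?_
    rw [BoundedContinuousFunction.smul_apply]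
    filter_upwards [stepFun_coeFn (G₂ := G₂) (p := p) hs w y,
      stepFun_coeFn (G₂ := G₂) (p := p) hs (fun i => c • w i) y,
      Lp.coeFn_smul c (stepFun G₂ p hs w y)] with ζ h1 h2 h3
    rw [h3, Pi.smul_apply, h1, h2]
    rfl

/-- Since the pieces of the partition are disjoint, the duality map acts on each coefficient `w i`
separately, and `signedPow ∘ w i` stays in `A`. -/
lemma MeanValueAlgebra.exists_isVecDual_of_mem_step (hp : 1 < p) (hp' : p ≠ ∞)
    {b : Eu m →ᵇ LpOn G₂ p} (hb : b ∈ A.stepSubmodule G₂ p) :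
    ∃ (hbA : b ∈ A.vec (LpOn G₂ p)) (b' : A.vec (LpOn G₂ p.conjExponent)),
      IsVecDual ⟨b, hbA⟩ b' := by
  obtain ⟨ι, _, s, hs, w, hw, rfl⟩ := hb
  have hs0 : 0 < p.toReal - 1 := by
    have := one_lt_toReal hp hp'
    linarith
  choose v hv hvw using fun i => A.exists_comp_mem (continuous_signedPow hs0) (hw i)
  refine ⟨stepFun_mem_vec hs hw, ⟨stepFun G₂ _ hs v, stepFun_mem_vec hs hv⟩, fun y => ?_⟩
  unfold IsLpDual
  filter_upwards [stepFun_coeFn (G₂ := G₂) (p := p) hs w y,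
    stepFun_coeFn (G₂ := G₂) (p := p.conjExponent) hs v y] with ζ h1 h2
  rw [h1, h2, hvw]

/-- The map `v ↦ u ⊗ v` as a continuous linear map. -/
def tmulCLM {F : Type*} [NormedAddCommGroup F] [NormedSpace ℝ F] (u : Eu m →ᵇ ℝ) :
    F →L[ℝ] (Eu m →ᵇ F) :=
  LinearMap.mkContinuous
    { toFun := tmul u
      map_add' := fun v w => by ext1 y; simp
      map_smul' := fun c v => by ext1 y; exact smul_comm _ _ _ } ‖u‖
    fun v => BoundedContinuousFunction.norm_ofNormedAddCommGroup_le _ (by positivity) fun y => by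
      rw [norm_smul]
      exact mul_le_mul_of_nonneg_right (u.norm_coe_le_norm y) (norm_nonneg v)

lemma tmulCLM_apply {F : Type*} [NormedAddCommGroup F] [NormedSpace ℝ F] (u : Eu m →ᵇ ℝ) (v : F) :
    tmulCLM u v = tmul u v := rfl

/-- It is enough to treat tensors `u ⊗ v`. As `p < ∞`, simple functions are dense in `L^p(G₂)`, so
`v` may be taken to be a multiple of an indicator; the partition is then the set and its complement.
-/
lemma MeanValueAlgebra.vec_le_step (hp' : p ≠ ∞) :
    A.vec (LpOn G₂ p) ≤ (A.stepSubmodule G₂ p).topologicalClosure := by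
  classical
  refine A.vec_le (Submodule.isClosed_topologicalClosure _) fun u hu v => ?_
  induction v using Lp.induction hp' with
  | @indicatorConst c s hs hμs =>
    have hs' : ∀ i, MeasurableSet ((fun ζ => decide (ζ ∈ s)) ⁻¹' {i}) := fun i => by
      cases i
      · have : (fun ζ => decide (ζ ∈ s)) ⁻¹' {false} = sᶜ := by ext ζ; simp
        rw [this]
        exact hs.compl
      · have : (fun ζ => decide (ζ ∈ s)) ⁻¹' {true} = s := by ext ζ; simp
        rw [this]
        exact hs
    refine Submodule.le_topologicalClosure _ ⟨Bool, inferInstance, fun ζ => decide (ζ ∈ s),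
      hs', fun i => if i then c • u else 0, fun i => ?_, ?_⟩
    · cases i
      · simp
      · simpa using Subalgebra.smul_mem _ hu c
    · ext1 y
      refine Lp.ext ?_
      rw [tmul_apply, Lp.simpleFunc.coe_indicatorConst]
      refine (Lp.coeFn_smul _ _).trans ?_
      filter_upwards [stepFun_coeFn (G₂ := G₂) (p := p) hs' (fun i => if i then c • u else 0) y,
        indicatorConstLp_coeFn (p := p) (hs := hs) (hμs := hμs.ne) (c := c)] with ζ h1 h2
      rw [h1, Pi.smul_apply, h2]
      by_cases h : ζ ∈ s <;> simp [h, mul_comm]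
  | add hf hg _ h1 h2 =>
    have := add_mem h1 h2
    rwa [← tmulCLM_apply, ← tmulCLM_apply, ← map_add, tmulCLM_apply] at this
  | isClosed =>
    exact (Submodule.isClosed_topologicalClosure (A.stepSubmodule G₂ p)).preimage
      (tmulCLM u).continuous

lemma MeanValueAlgebra.exists_isVecDual_near (hp : 1 < p) (hp' : p ≠ ∞) (a : A.vec (LpOn G₂ p))
    {η : ℝ} (hη : 0 < η) : ∃ (b : A.vec (LpOn G₂ p)) (b' : A.vec (LpOn G₂ p.conjExponent)),
      IsVecDual b b' ∧ ‖a - b‖ < η := by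
  obtain ⟨b, hb, hab⟩ := Metric.mem_closure_iff.1 (A.vec_le_step hp' a.2) η hη
  obtain ⟨hbA, b', h⟩ := A.exists_isVecDual_of_mem_step hp hp' hb
  refine ⟨⟨b, hbA⟩, b', h, ?_⟩
  rw [dist_eq_norm] at hab
  exact hab

lemma MeanValueAlgebra.Besicovitch.exists_isVecDual_near (hp : 1 < p) (hp' : p ≠ ∞)
    (b : A.Besicovitch (LpOn G₂ p) p) {η : ℝ} (hη : 0 < η) :
    ∃ (a : A.vec (LpOn G₂ p)) (a' : A.vec (LpOn G₂ p.conjExponent)),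
      IsVecDual a a' ∧ ‖b - A.toBesicovitch _ p a‖ < η := by
  obtain ⟨c, hc⟩ := MeanValueAlgebra.Besicovitch.exists_norm_sub_lt b (half_pos hη)
  obtain ⟨a, a', h, hca⟩ := A.exists_isVecDual_near hp hp' c (half_pos hη)
  refine ⟨a, a', h, ?_⟩
  have h1 : b - A.toBesicovitch _ p a =
      (b - A.toBesicovitch _ p c) + A.toBesicovitch _ p (c - a) := by
    rw [map_sub]
    abel
  rw [h1]
  refine (norm_add_le _ _).trans_lt ?_
  linarith [A.norm_toBesicovitch_le (p := p) (c - a)]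

end StepFunctions

/-! ### From functions on a product to Bochner functions -/

section Curry

variable {α β : Type*} {mα : MeasurableSpace α} {mβ : MeasurableSpace β} {p : ℝ≥0∞}
  [Fact (1 ≤ p)]

/-- By second countability an open set is a countable union of balls, and the preimage of a ball is
a sublevel set of a distance function. -/
lemma measurable_of_measurable_edist {X : Type*} [PseudoEMetricSpace X]
    [SecondCountableTopology X] [MeasurableSpace X] [BorelSpace X] {U : α → X}
    (h : ∀ c, Measurable fun x => edist (U x) c) : Measurable U := by
  refine measurable_of_isOpen fun O hO => ?_
  let S : Set (Set X) := {B | B ⊆ O ∧ ∃ c r, B = Metric.eball c r}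
  obtain ⟨T, hTc, hTS, hT⟩ := TopologicalSpace.isOpen_sUnion_countable S (by
    rintro _ ⟨-, c, r, rfl⟩
    exact Metric.isOpen_eball)
  have hO' : O = ⋃₀ T := by
    rw [hT]
    refine Set.Subset.antisymm (fun x hx => ?_) (Set.sUnion_subset fun B hB => hB.1)
    obtain ⟨r, hr, hrO⟩ := EMetric.isOpen_iff.1 hO x hx
    exact ⟨_, ⟨hrO, x, r, rfl⟩, Metric.mem_eball_self hr⟩
  rw [hO', Set.preimage_sUnion]
  refine MeasurableSet.biUnion hTc fun B hB => ?_
  obtain ⟨-, c, r, rfl⟩ := hTS hB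
  exact measurableSet_lt (h c) measurable_const

lemma stronglyMeasurable_of_measurable_edist {X : Type*} [PseudoEMetricSpace X]
    [SecondCountableTopology X] {U : α → X} (h : ∀ c, Measurable fun x => edist (U x) c) :
    StronglyMeasurable U := by
  let _ : MeasurableSpace X := borel _
  have : BorelSpace X := ⟨rfl⟩
  exact (measurable_of_measurable_edist h).stronglyMeasurable

lemma measurable_eLpNorm_section {ν : Measure β} [SFinite ν] (hp' : p ≠ ∞) {h : α × β → ℝ}
    (hh : StronglyMeasurable h) : Measurable fun x => eLpNorm (fun ζ => h (x, ζ)) p ν := by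
  have h1 : (1 : ℝ≥0∞) ≤ p := Fact.out
  simp only [eLpNorm_eq_lintegral_rpow_enorm_toReal (zero_lt_one.trans_le h1).ne' hp']
  exact ((hh.enorm.pow_const _).lintegral_prod_right').pow_const _

lemma edist_toLp_section {ν : Measure β} {k : α × β → ℝ}
    (hkm : ∀ x, MemLp (fun ζ => k (x, ζ)) p ν) (c : Lp ℝ p ν) (x : α) :
    edist ((hkm x).toLp) c = eLpNorm (fun ζ => k (x, ζ) - c ζ) p ν := by
  rw [Lp.edist_def]
  refine eLpNorm_congr_ae ?_
  filter_upwards [(hkm x).coeFn_toLp] with ζ hζ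
  rw [Pi.sub_apply, hζ]

/-- Separability of `L^p(ν)`, `p < ∞`, reduces the claim to distances to fixed elements, and these
are parametric integrals, measurable by Tonelli. -/
lemma stronglyMeasurable_toLp_section {ν : Measure β} [SFinite ν] [hp' : Fact (p ≠ ∞)]
    [MeasureTheory.IsSeparable ν] {k : α × β → ℝ} (hk : StronglyMeasurable k)
    (hkm : ∀ x, MemLp (fun ζ => k (x, ζ)) p ν) : StronglyMeasurable fun x => (hkm x).toLp := by
  refine stronglyMeasurable_of_measurable_edist fun c => ?_
  have hc : StronglyMeasurable fun z : α × β => k z - c z.2 :=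
    hk.sub ((Lp.stronglyMeasurable c).comp_measurable measurable_snd)
  have h := measurable_eLpNorm_section (p := p) (ν := ν) hp'.out hc
  simp only [edist_toLp_section hkm c]
  beta_reduce at h
  exact h

lemma exists_lp_curry_of_stronglyMeasurable {μ : Measure α} {ν : Measure β} [SFinite μ] [SFinite ν]
    [Fact (p ≠ ∞)] [MeasureTheory.IsSeparable ν] {g : α × β → ℝ} (hg : StronglyMeasurable g)
    (hgp : eLpNorm g p (μ.prod ν) < ∞) :
    ∃ U : Lp (Lp ℝ p ν) p μ, (∀ᵐ x ∂μ, U x =ᵐ[ν] fun ζ => g (x, ζ)) ∧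
      ‖U‖ = (eLpNorm g p (μ.prod ν)).toReal := by
  have h1 : (1 : ℝ≥0∞) ≤ p := Fact.out
  have hp0 : p ≠ 0 := (zero_lt_one.trans_le h1).ne'
  have hp' : p ≠ ∞ := Fact.out
  have hpp : 0 < p.toReal := ENNReal.toReal_pos hp0 hp'
  let S : Set α := {x | eLpNorm (fun ζ => g (x, ζ)) p ν < ∞}
  have hS : MeasurableSet S := measurableSet_lt (measurable_eLpNorm_section hp' hg) measurable_const
  have hlint : ∫⁻ x, eLpNorm (fun ζ => g (x, ζ)) p ν ^ p.toReal ∂μ =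
      eLpNorm g p (μ.prod ν) ^ p.toReal := by
    simp only [eLpNorm_eq_lintegral_rpow_enorm_toReal hp0 hp', one_div,
      ENNReal.rpow_inv_rpow hpp.ne']
    exact (lintegral_prod _ (hg.enorm.pow_const _).aemeasurable).symm
  have hSae : ∀ᵐ x ∂μ, x ∈ S := by
    have hlt : ∫⁻ x, eLpNorm (fun ζ => g (x, ζ)) p ν ^ p.toReal ∂μ ≠ ∞ := by
      rw [hlint]
      exact (ENNReal.rpow_lt_top_of_nonneg hpp.le hgp.ne).ne
    filter_upwards [ae_lt_top ((measurable_eLpNorm_section hp' hg).pow_const _) hlt] with x hx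
    exact (ENNReal.rpow_lt_top_iff_of_pos hpp).1 hx
  -- Cutting off the null set of bad sections makes `toLp` meaningful at every `x`.
  let k : α × β → ℝ := (S ×ˢ Set.univ).indicator g
  have hk : StronglyMeasurable k := hg.indicator (hS.prod MeasurableSet.univ)
  have hkS : ∀ x ∈ S, (fun ζ => k (x, ζ)) = fun ζ => g (x, ζ) := fun x hx => by
    ext ζ
    exact Set.indicator_of_mem (by simpa using hx) g
  have hkm : ∀ x, MemLp (fun ζ => k (x, ζ)) p ν := fun x => by
    refine ⟨(hk.comp_measurable measurable_prodMk_left).aestronglyMeasurable, ?_⟩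
    by_cases hx : x ∈ S
    · rw [hkS x hx]
      exact hx
    · have : (fun ζ => k (x, ζ)) = 0 := by
        ext ζ
        exact Set.indicator_of_notMem (by simpa using hx) g
      rw [this]
      simp
  let W : α → Lp ℝ p ν := fun x => (hkm x).toLp
  have hW : StronglyMeasurable W := stronglyMeasurable_toLp_section hk hkm
  have hWn : eLpNorm W p μ = eLpNorm g p (μ.prod ν) := by
    refine ENNReal.rpow_left_injective hpp.ne' ?_
    change eLpNorm W p μ ^ p.toReal = eLpNorm g p (μ.prod ν) ^ p.toReal
    rw [← hlint, eLpNorm_eq_lintegral_rpow_enorm_toReal hp0 hp', one_div,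
      ENNReal.rpow_inv_rpow hpp.ne']
    refine lintegral_congr_ae (hSae.mono fun x hx => ?_)
    simp only [W, Lp.enorm_toLp, hkS x hx]
  have hWm : MemLp W p μ := ⟨hW.aestronglyMeasurable, by rw [hWn]; exact hgp⟩
  refine ⟨hWm.toLp, ?_, by rw [Lp.norm_toLp, hWn]⟩
  filter_upwards [hWm.coeFn_toLp, hSae] with x hx hxS
  rw [hx, ← hkS x hxS]
  exact (hkm x).coeFn_toLp

/-- A function in `L^p(μ × ν)` is, up to null sets, a Bochner function in `L^p(μ; L^p(ν))`. -/
lemma exists_lp_curry {μ : Measure α} {ν : Measure β} [SFinite μ] [SFinite ν]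
    (hp' : p ≠ ∞) [MeasureTheory.IsSeparable ν] {g : α × β → ℝ} (hg : MemLp g p (μ.prod ν)) :
    ∃ U : Lp (Lp ℝ p ν) p μ, (∀ᵐ x ∂μ, U x =ᵐ[ν] fun ζ => g (x, ζ)) ∧
      ‖U‖ = (eLpNorm g p (μ.prod ν)).toReal := by
  have : Fact (p ≠ ∞) := ⟨hp'⟩
  obtain ⟨⟨g', hg', hgg'⟩, hlt⟩ := hg
  rw [eLpNorm_congr_ae hgg'] at hlt ⊢
  obtain ⟨U, hU, hUn⟩ := exists_lp_curry_of_stronglyMeasurable (p := p) hg' hlt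
  refine ⟨U, ?_, hUn⟩
  filter_upwards [hU, Measure.ae_ae_of_ae_prod hgg'] with x h1 h2
  exact h1.trans (h2.mono fun _ h => h.symm)

end Curry

/-! ### Rescaling of the thin domain -/

section Rescaling

variable {d₁ d₂ : ℕ} {G₁ : Set (Eu d₁)} {G₂ : Set (Eu d₂)} {p : ℝ≥0∞}

lemma restrict_smul_eq {ε : ℝ} (hε : 0 < ε) :
    (volume : Measure (Eu d₂)).restrict (ε • G₂) =
      ENNReal.ofReal (ε ^ d₂) • (volume.restrict G₂).map (fun ζ => ε • ζ) := by
  let e : Eu d₂ ≃ᵐ Eu d₂ := (Homeomorph.smulOfNeZero ε hε.ne').toMeasurableEquiv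
  have he : (e : Eu d₂ → Eu d₂) = fun ζ => ε • ζ := rfl
  have h1 : e ⁻¹' (ε • G₂) = G₂ := by
    ext ζ
    exact Set.smul_mem_smul_set_iff₀ hε.ne' G₂ ζ
  have h2 := e.restrict_map (volume : Measure (Eu d₂)) (ε • G₂)
  rw [h1, he, Measure.map_addHaar_smul _ hε.ne', Measure.restrict_smul] at h2
  rw [← h2, smul_smul, ← ENNReal.ofReal_mul (by positivity), finrank_euclideanSpace_fin,
    abs_of_pos (by positivity), mul_inv_cancel₀ (by positivity), ENNReal.ofReal_one, one_smul]

lemma restrict_thinDomain_eq {ε : ℝ} (hε : 0 < ε) :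
    (volume : Measure (Eu d₁ × Eu d₂)).restrict (thinDomain G₁ G₂ ε) =
      ENNReal.ofReal (ε ^ d₂) • ((volume.restrict G₁).prod (volume.restrict G₂)).map
        (fun z => (z.1, ε • z.2)) := by
  rw [thinDomain, Measure.volume_eq_prod, ← Measure.prod_restrict, restrict_smul_eq hε,
    Measure.prod_smul_right]
  congr 1
  have := Measure.map_prod_map (volume.restrict G₁ : Measure (Eu d₁))
    (volume.restrict G₂ : Measure (Eu d₂)) measurable_id (measurable_const_smul ε)
  rw [Measure.map_id] at this
  exact this

lemma memLp_rescale {ε : ℝ} (hε : 0 < ε) {h : Eu d₁ × Eu d₂ → ℝ}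
    (hh : MemLp h p (volume.restrict (thinDomain G₁ G₂ ε))) :
    MemLp (fun z : Eu d₁ × Eu d₂ => h (z.1, ε • z.2)) p
      ((volume.restrict G₁).prod (volume.restrict G₂)) := by
  have hc : ENNReal.ofReal (ε ^ d₂) ≠ 0 := by simpa using pow_pos hε _
  have hm : Measurable fun z : Eu d₁ × Eu d₂ => (z.1, ε • z.2) := by fun_prop
  rw [restrict_thinDomain_eq hε] at hh
  have h2 := hh.smul_measure (c := (ENNReal.ofReal (ε ^ d₂))⁻¹) (ENNReal.inv_ne_top.2 hc)
  rw [smul_smul, ENNReal.inv_mul_cancel hc ENNReal.ofReal_ne_top, one_smul] at h2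
  exact h2.comp_of_map hm.aemeasurable

/-- The Jacobian `ε ^ d₂` enters the norm with exponent `1 / p`, exactly compensated by the weight
in strong convergence. -/
lemma eLpNorm_rescale (hp' : p ≠ ∞) {ε : ℝ} (hε : 0 < ε) {h : Eu d₁ × Eu d₂ → ℝ}
    (hh : MemLp h p (volume.restrict (thinDomain G₁ G₂ ε))) :
    ε ^ (-(d₂ : ℝ) / p.toReal) *
      (eLpNorm h p (volume.restrict (thinDomain G₁ G₂ ε))).toReal =
    (eLpNorm (fun z : Eu d₁ × Eu d₂ => h (z.1, ε • z.2)) p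
      ((volume.restrict G₁).prod (volume.restrict G₂))).toReal := by
  have hc : ENNReal.ofReal (ε ^ d₂) ≠ 0 := by simpa using pow_pos hε _
  have hm : Measurable fun z : Eu d₁ × Eu d₂ => (z.1, ε • z.2) := by fun_prop
  have hh' := hh.1
  rw [restrict_thinDomain_eq hε] at hh' ⊢
  have h2 := hh'.smul_measure (ENNReal.ofReal (ε ^ d₂))⁻¹
  rw [smul_smul, ENNReal.inv_mul_cancel hc ENNReal.ofReal_ne_top, one_smul] at h2
  rw [eLpNorm_smul_measure_of_ne_top hp', eLpNorm_map_measure h2 hm.aemeasurable, smul_eq_mul,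
    ENNReal.toReal_mul, ← mul_assoc, ← ENNReal.toReal_rpow,
    ENNReal.toReal_ofReal (by positivity), ← Real.rpow_natCast, ← Real.rpow_mul hε.le,
    ← Real.rpow_add hε]
  have : -(d₂ : ℝ) / p.toReal + d₂ * (1 / p).toReal = 0 := by
    rw [ENNReal.toReal_div]
    simp only [ENNReal.toReal_one]
    ring
  rw [this, Real.rpow_zero, one_mul]
  rfl

end Rescaling

/-! ### The pairings in `L^p(G₁; ·)` -/

section Forms

variable {d₁ d₂ : ℕ} {A : MeanValueAlgebra d₁} {G₁ : Set (Eu d₁)} {G₂ : Set (Eu d₂)} {p : ℝ≥0∞}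
  [Fact (1 ≤ p)] {F : Type*} [NormedAddCommGroup F] [NormedSpace ℝ F]

lemma memLp_eval (ε : ℝ) (f : Lp (A.vec F) p ((volume : Measure (Eu d₁)).restrict G₁)) :
    MemLp (fun x => (f x : Eu d₁ →ᵇ F) (ε⁻¹ • x)) p (volume.restrict G₁) := by
  refine (Lp.memLp f).of_le ?_ (Eventually.of_forall fun x =>
    (f x : Eu d₁ →ᵇ F).norm_coe_le_norm _)
  -- Evaluation is jointly continuous for the sup norm, so `x ↦ f(x)(x / ε)` is measurable.
  have hc : Continuous fun z : A.vec F × Eu d₁ => (z.1 : Eu d₁ →ᵇ F) z.2 :=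
    (continuous_eval (F := Eu d₁ →ᵇ F)).comp
      ((continuous_subtype_val.comp continuous_fst).prodMk continuous_snd)
  exact hc.comp_aestronglyMeasurable ((Lp.aestronglyMeasurable f).prodMk
    (continuous_const_smul ε⁻¹).aestronglyMeasurable)

/-- The map `f ↦ (x ↦ f(x)(x / ε))`. -/
def evalScaledFun (ε : ℝ) (f : Lp (A.vec F) p ((volume : Measure (Eu d₁)).restrict G₁)) :
    Lp F p ((volume : Measure (Eu d₁)).restrict G₁) := (memLp_eval ε f).toLp

lemma evalScaledFun_coeFn (ε : ℝ) (f : Lp (A.vec F) p ((volume : Measure (Eu d₁)).restrict G₁)) :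
    evalScaledFun ε f =ᵐ[volume.restrict G₁] fun x => (f x : Eu d₁ →ᵇ F) (ε⁻¹ • x) :=
  (memLp_eval ε f).coeFn_toLp

lemma evalScaledFun_add (ε : ℝ)
    (f g : Lp (A.vec F) p ((volume : Measure (Eu d₁)).restrict G₁)) :
    evalScaledFun ε (f + g) = evalScaledFun ε f + evalScaledFun ε g := by
  refine Lp.ext ?_
  filter_upwards [evalScaledFun_coeFn ε f, evalScaledFun_coeFn ε g, evalScaledFun_coeFn ε (f + g),
    Lp.coeFn_add f g, Lp.coeFn_add (evalScaledFun ε f) (evalScaledFun ε g)] with x h1 h2 h3 h4 h5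
  rw [h3, h5, Pi.add_apply, h1, h2, h4]
  rfl

lemma evalScaledFun_smul (ε c : ℝ)
    (f : Lp (A.vec F) p ((volume : Measure (Eu d₁)).restrict G₁)) :
    evalScaledFun ε (c • f) = c • evalScaledFun ε f := by
  refine Lp.ext ?_
  filter_upwards [evalScaledFun_coeFn ε f, evalScaledFun_coeFn ε (c • f),
    Lp.coeFn_smul c f, Lp.coeFn_smul c (evalScaledFun ε f)] with x h1 h2 h3 h4
  rw [h2, h4, Pi.smul_apply, h1, h3]
  rfl

lemma norm_evalScaledFun_le (ε : ℝ)
    (f : Lp (A.vec F) p ((volume : Measure (Eu d₁)).restrict G₁)) :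
    ‖evalScaledFun ε f‖ ≤ ‖f‖ := by
  refine Lp.norm_le_norm_of_ae_le ?_
  filter_upwards [evalScaledFun_coeFn ε f] with x hx
  rw [hx]
  exact (f x : Eu d₁ →ᵇ F).norm_coe_le_norm _

/-- The map `f ↦ (x ↦ f(x)(x / ε))` as a continuous linear map. -/
def evalScaled (A : MeanValueAlgebra d₁) (G₁ : Set (Eu d₁)) (F : Type*) [NormedAddCommGroup F]
    [NormedSpace ℝ F] (p : ℝ≥0∞) [Fact (1 ≤ p)] (ε : ℝ) :
    Lp (A.vec F) p ((volume : Measure (Eu d₁)).restrict G₁) →L[ℝ]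
      Lp F p ((volume : Measure (Eu d₁)).restrict G₁) :=
  LinearMap.mkContinuous
    { toFun := evalScaledFun ε
      map_add' := evalScaledFun_add ε
      map_smul' := evalScaledFun_smul ε } 1
    fun f => (norm_evalScaledFun_le ε f).trans_eq (one_mul _).symm

lemma evalScaled_apply (ε : ℝ) (f : Lp (A.vec F) p ((volume : Measure (Eu d₁)).restrict G₁)) :
    evalScaled A G₁ F p ε f = evalScaledFun ε f := rfl

/-- The duality pairing of `L^p(G₁; L^p(G₂))` and `L^{p'}(G₁; L^{p'}(G₂))`. -/
def bochnerPairing (G₁ : Set (Eu d₁)) (G₂ : Set (Eu d₂)) (p : ℝ≥0∞) [Fact (1 ≤ p)] :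
    Lp (LpOn G₂ p) p ((volume : Measure (Eu d₁)).restrict G₁) →L[ℝ]
      Lp (LpOn G₂ p.conjExponent) p.conjExponent ((volume : Measure (Eu d₁)).restrict G₁) →L[ℝ] ℝ :=
  (dualPairing (volume.restrict G₂) p).lpPairing (volume.restrict G₁) p p.conjExponent

lemma bochnerPairing_eq (U : Lp (LpOn G₂ p) p ((volume : Measure (Eu d₁)).restrict G₁))
    (f : Lp (LpOn G₂ p.conjExponent) p.conjExponent ((volume : Measure (Eu d₁)).restrict G₁)) :
    bochnerPairing G₁ G₂ p U f = ∫ x in G₁, dualPairing (volume.restrict G₂) p (U x) (f x) :=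
  ContinuousLinearMap.lpPairing_eq_integral _ _ _

/-- The pairing of the limit space and the test space. -/
def limitPairing (A : MeanValueAlgebra d₁) (G₁ : Set (Eu d₁)) (G₂ : Set (Eu d₂)) (p : ℝ≥0∞)
    [Fact (1 ≤ p)] : LimitSpace A G₁ G₂ p →L[ℝ] TestSpace A G₁ G₂ p →L[ℝ] ℝ :=
  ((A.besicovitchPairing G₂ p).bilinearComp (ContinuousLinearMap.id ℝ _)
    (A.toBesicovitch _ _)).lpPairing (volume.restrict G₁) p p.conjExponent

lemma limitPairing_eq (u : LimitSpace A G₁ G₂ p) (f : TestSpace A G₁ G₂ p) :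
    limitPairing A G₁ G₂ p u f = ∫ x in G₁, meanPairing (u x) (f x) := by
  rw [limitPairing, ContinuousLinearMap.lpPairing_eq_integral]
  simp only [meanPairing_eq_besicovitchPairing]
  rfl

/-- `U` is the rescaled function `x ↦ (ζ ↦ u (x, ε ζ))` of `u`. -/
def IsRescaling (ε : ℝ) (u : Eu d₁ × Eu d₂ → ℝ)
    (U : Lp (LpOn G₂ p) p ((volume : Measure (Eu d₁)).restrict G₁)) : Prop :=
  ∀ᵐ x ∂(volume.restrict G₁), U x =ᵐ[volume.restrict G₂] fun ζ => u (x, ε • ζ)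

/-- The change of variables `z = ε ζ` in the inner integral produces the factor `ε ^ d₂` that the
weight cancels. -/
lemma IsRescaling.testIntegral_eq {ε : ℝ} (hε : 0 < ε) {u : Eu d₁ × Eu d₂ → ℝ}
    {U : Lp (LpOn G₂ p) p ((volume : Measure (Eu d₁)).restrict G₁)} (h : IsRescaling ε u U)
    (f : TestSpace A G₁ G₂ p) :
    (ε ^ d₂)⁻¹ * testIntegral ε u f =
      bochnerPairing G₁ G₂ p U (evalScaledFun ε f) := by
  rw [bochnerPairing_eq, testIntegral]
  refine (integral_const_mul (ε ^ d₂)⁻¹ _).symm.trans (integral_congr_ae ?_)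
  have hfe := evalScaledFun_coeFn (A := A) (G₁ := G₁) (F := LpOn G₂ p.conjExponent) ε f
  filter_upwards [h, hfe] with x hx hf
  rw [hf, dualPairing_eq]
  have h1 := Measure.setIntegral_comp_smul_of_pos (volume : Measure (Eu d₂))
    (fun z => u (x, z) * ((f x : Eu d₁ →ᵇ LpOn G₂ p.conjExponent) (ε⁻¹ • x)) (ε⁻¹ • z)) G₂ hε
  rw [finrank_euclideanSpace_fin, smul_eq_mul] at h1
  rw [← h1]
  refine integral_congr_ae (hx.mono fun ζ hζ => ?_)
  simp only [hζ, inv_smul_smul₀ hε.ne']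

lemma exists_isRescaling (hp' : p ≠ ∞) {ε : ℝ} (hε : 0 < ε) {u : Eu d₁ × Eu d₂ → ℝ}
    (hu : MemLp u p (volume.restrict (thinDomain G₁ G₂ ε))) :
    ∃ U : Lp (LpOn G₂ p) p ((volume : Measure (Eu d₁)).restrict G₁), IsRescaling ε u U ∧
      ‖U‖ = ε ^ (-(d₂ : ℝ) / p.toReal) *
        (eLpNorm u p (volume.restrict (thinDomain G₁ G₂ ε))).toReal := by
  rw [eLpNorm_rescale hp' hε hu]
  exact exists_lp_curry hp' (memLp_rescale hε hu)

end Forms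

/-! ### Boundedness of weakly convergent sequences -/

section Bounded

variable {d₁ d₂ : ℕ} {A : MeanValueAlgebra d₁} {G₁ : Set (Eu d₁)} {G₂ : Set (Eu d₂)} {p : ℝ≥0∞}
  [Fact (1 ≤ p)]

/-- `g` is the image of `f` under the duality map, pointwise in `x ∈ G₁`. -/
def IsBochnerDual (f : Lp (LpOn G₂ p) p ((volume : Measure (Eu d₁)).restrict G₁))
    (g : Lp (LpOn G₂ p.conjExponent) p.conjExponent ((volume : Measure (Eu d₁)).restrict G₁)) :
    Prop :=
  ∀ᵐ x ∂(volume.restrict G₁), IsLpDual (f x) (g x)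

section Dual

variable {f : Lp (LpOn G₂ p) p ((volume : Measure (Eu d₁)).restrict G₁)}
  {g : Lp (LpOn G₂ p.conjExponent) p.conjExponent ((volume : Measure (Eu d₁)).restrict G₁)}

lemma IsBochnerDual.pairing_self (hp : 1 < p) (hp' : p ≠ ∞) (h : IsBochnerDual f g) :
    bochnerPairing G₁ G₂ p f g = ‖f‖ ^ p.toReal := by
  rw [bochnerPairing_eq, lp_norm_rpow_eq_integral hp']
  exact integral_congr_ae (h.mono fun x hx => hx.pairing_self hp hp')

lemma IsBochnerDual.norm_rpow (hp : 1 < p) (hp' : p ≠ ∞) (h : IsBochnerDual f g) :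
    ‖g‖ ^ p.conjExponent.toReal = ‖f‖ ^ p.toReal := by
  rw [lp_norm_rpow_eq_integral hp', lp_norm_rpow_eq_integral (conjExponent_ne_top hp)]
  exact integral_congr_ae (h.mono fun x hx => hx.norm_rpow hp hp')

lemma IsBochnerDual.norm_sub_rpow_le (hp' : p ≠ ∞) {C δ : ℝ}
    (hC : ∀ a b : ℝ, |a - b| ^ p.toReal ≤
      C * bregman p.toReal a b + δ * (|a| ^ p.toReal + |b| ^ p.toReal))
    (v : Lp (LpOn G₂ p) p ((volume : Measure (Eu d₁)).restrict G₁)) (h : IsBochnerDual f g) :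
    ‖v - f‖ ^ p.toReal ≤ C * (‖v‖ ^ p.toReal + (p.toReal - 1) * ‖f‖ ^ p.toReal -
      p.toReal * bochnerPairing G₁ G₂ p v g) + δ * (‖v‖ ^ p.toReal + ‖f‖ ^ p.toReal) := by
  rw [lp_norm_rpow_eq_integral hp' v, lp_norm_rpow_eq_integral hp' f, bochnerPairing_eq,
    lp_norm_rpow_eq_integral hp']
  refine integral_le_of_le_bregman (lp_integrable_norm_rpow hp' v) (lp_integrable_norm_rpow hp' f)
    (memLp_one_iff_integrable.1 ((dualPairing (volume.restrict G₂) p).memLp_of_bilin 1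
      (Lp.memLp v) (Lp.memLp g))) (lp_integrable_norm_rpow hp' _) ?_
  filter_upwards [h, Lp.coeFn_sub v f] with x hx hs
  rw [hs, Pi.sub_apply]
  exact hx.norm_sub_rpow_le hp' hC (v x)

end Dual

lemma eq_rpow_sub_one_of_rpow_eq (hp : 1 < p) (hp' : p ≠ ∞) {a b : ℝ} (ha : 0 ≤ a) (hb : 0 ≤ b)
    (h : b ^ p.conjExponent.toReal = a ^ p.toReal) : b = a ^ (p.toReal - 1) := by
  have hc := conjExponent_holder hp hp'
  refine (Real.rpow_left_inj hb (by positivity) hc.symm.pos.ne').1 ?_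
  rw [h, ← Real.rpow_mul ha, hc.sub_one_mul_conj]

/-- The inclusion of `F` into `A(ℝ^m; F)` as constant functions. -/
def constVec (A : MeanValueAlgebra d₁) (F : Type*) [NormedAddCommGroup F] [NormedSpace ℝ F] :
    F →L[ℝ] A.vec F :=
  (tmulCLM 1).codRestrict (A.vec F) fun v => A.tmul_mem_vec (one_mem _) v

lemma constVec_apply {F : Type*} [NormedAddCommGroup F] [NormedSpace ℝ F] (v : F) (y : Eu d₁) :
    (constVec A F v : Eu d₁ →ᵇ F) y = v := one_smul ℝ v

lemma evalScaledFun_constVec {F : Type*} [NormedAddCommGroup F] [NormedSpace ℝ F] (ε : ℝ)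
    (f : Lp F p ((volume : Measure (Eu d₁)).restrict G₁)) :
    evalScaledFun ε ((constVec A F).compLp f) = f := by
  refine Lp.ext ?_
  have h1 := evalScaledFun_coeFn (A := A) (G₁ := G₁) ε ((constVec A F).compLp f)
  filter_upwards [h1, (constVec A F).coeFn_compLp f] with x h2 h3
  rw [h2, h3, constVec_apply]

/-- Constant functions of `y` provide a right inverse of `evalScaled` whose norm does not depend on
`ε`, so a bound on the composite is a bound on `T`. -/
lemma norm_clm_le_of_comp_evalScaled {F : Type*} [NormedAddCommGroup F] [NormedSpace ℝ F]
    {ε C : ℝ} (T : Lp F p ((volume : Measure (Eu d₁)).restrict G₁) →L[ℝ] ℝ)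
    (hT : ‖T.comp (evalScaled A G₁ F p ε)‖ ≤ C)
    (f : Lp F p ((volume : Measure (Eu d₁)).restrict G₁)) :
    ‖T f‖ ≤ C * ‖constVec A F‖ * ‖f‖ := by
  have h := (T.comp (evalScaled A G₁ F p ε)).le_of_opNorm_le hT ((constVec A F).compLp f)
  rw [ContinuousLinearMap.comp_apply, evalScaled_apply, evalScaledFun_constVec] at h
  refine h.trans ?_
  rw [mul_assoc]
  exact mul_le_mul_of_nonneg_left ((constVec A F).norm_compLp_le f)
    ((ContinuousLinearMap.opNorm_nonneg _).trans hT)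

lemma memLp_signedPow {α : Type*} {mα : MeasurableSpace α} {μ : Measure α} (hp : 1 < p)
    (hp' : p ≠ ∞) {h : α → ℝ} (hh : MemLp h p μ) :
    MemLp (fun x => signedPow (p.toReal - 1) (h x)) p.conjExponent μ := by
  have hs : 0 < p.toReal - 1 := sub_pos.2 (one_lt_toReal hp hp')
  have h1 : (1 : ℝ≥0∞) ≤ p.conjExponent := Fact.out
  refine (integrable_norm_rpow_iff ((continuous_signedPow hs).comp_aestronglyMeasurable hh.1)
    (zero_lt_one.trans_le h1).ne' (conjExponent_ne_top hp)).1 ?_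
  refine (hh.integrable_norm_rpow (zero_lt_one.trans hp).ne' hp').congr
    (Eventually.of_forall fun x => ?_)
  simp only [Real.norm_eq_abs, abs_signedPow hs]
  rw [← Real.rpow_mul (abs_nonneg _), (conjExponent_holder hp hp').sub_one_mul_conj]

/-- The duality map is applied to the scalar function on `G₁ × G₂` and the result is curried, so
measurability in `x` comes from `exists_lp_curry`. -/
lemma IsRescaling.exists_dual (hp : 1 < p) (hp' : p ≠ ∞) {ε : ℝ} (hε : 0 < ε)
    {u : Eu d₁ × Eu d₂ → ℝ} (hu : MemLp u p (volume.restrict (thinDomain G₁ G₂ ε)))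
    {U : Lp (LpOn G₂ p) p ((volume : Measure (Eu d₁)).restrict G₁)} (h : IsRescaling ε u U) :
    ∃ U' : Lp (LpOn G₂ p.conjExponent) p.conjExponent ((volume : Measure (Eu d₁)).restrict G₁),
      IsBochnerDual U U' := by
  obtain ⟨U', hU', -⟩ := exists_lp_curry (conjExponent_ne_top hp)
    (memLp_signedPow hp hp' (memLp_rescale hε hu))
  refine ⟨U', ?_⟩
  filter_upwards [h, hU'] with x h1 h2
  filter_upwards [h1, h2] with ζ h3 h4
  rw [h3, h4]

lemma exists_norm_clm_le_of_tendsto {E : Type*} [NormedAddCommGroup E] [NormedSpace ℝ E]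
    [CompleteSpace E] (T : ℕ → E →L[ℝ] ℝ) (l : E → ℝ)
    (h : ∀ f, Tendsto (fun n => T n f) atTop (𝓝 (l f))) : ∃ C, ∀ n, ‖T n‖ ≤ C :=
  banach_steinhaus fun f => by
    obtain ⟨C, hC⟩ := (Metric.isBounded_range_of_tendsto _ (h f)).exists_norm_le
    exact ⟨C, fun n => hC _ ⟨n, rfl⟩⟩

set_option maxHeartbeats 1000000 in
/-- A weakly `Σ`-convergent sequence is bounded. -/
lemma exists_norm_le_of_tendsto (hp : 1 < p) (hp' : p ≠ ∞) {ε : ℕ → ℝ} (hε : ∀ n, 0 < ε n)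
    {u : ℕ → Eu d₁ × Eu d₂ → ℝ}
    (hu : ∀ n, MemLp (u n) p (volume.restrict (thinDomain G₁ G₂ (ε n))))
    {U : ℕ → Lp (LpOn G₂ p) p ((volume : Measure (Eu d₁)).restrict G₁)}
    (hU : ∀ n, IsRescaling (ε n) (u n) (U n)) {l : TestSpace A G₁ G₂ p → ℝ}
    (h : ∀ f : TestSpace A G₁ G₂ p, Tendsto
      (fun n => bochnerPairing G₁ G₂ p (U n) (evalScaledFun (ε n) f)) atTop (𝓝 (l f))) :
    ∃ C : ℝ, ∀ n, ‖U n‖ ≤ C := by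
  obtain ⟨C, hC⟩ := exists_norm_clm_le_of_tendsto (fun n => (bochnerPairing G₁ G₂ p (U n)).comp
    (evalScaled A G₁ (LpOn G₂ p.conjExponent) p.conjExponent (ε n))) l h
  have hC0 : 0 ≤ C := (norm_nonneg _).trans (hC 0)
  refine ⟨C * ‖constVec A (LpOn G₂ p.conjExponent)‖, fun n => ?_⟩
  -- Testing against the dual of `U n` gives `‖U‖^p = ⟨U, U'⟩ ≤ C' ‖U'‖ = C' ‖U‖^{p-1}`, where `C'`
  -- is the claimed bound; one divides when `U n ≠ 0`.
  obtain ⟨U', hU'⟩ := (hU n).exists_dual hp hp' (hε n) (hu n)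
  have h1 := hU'.pairing_self hp hp'
  have h2 := eq_rpow_sub_one_of_rpow_eq hp hp' (norm_nonneg _) (norm_nonneg _)
    (hU'.norm_rpow hp hp')
  rcases (norm_nonneg (U n)).eq_or_lt with h0 | h0
  · rw [← h0]
    positivity
  have h3 : ‖U n‖ ^ p.toReal ≤ C * ‖constVec A (LpOn G₂ p.conjExponent)‖ *
      ‖U n‖ ^ (p.toReal - 1) := by
    rw [← h1, ← h2]
    exact (le_abs_self _).trans (norm_clm_le_of_comp_evalScaled _ (hC n) U')
  have h5 : ‖U n‖ ^ p.toReal = ‖U n‖ * ‖U n‖ ^ (p.toReal - 1) := by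
    rw [mul_comm, ← Real.rpow_add_one h0.ne', sub_add_cancel]
  rw [h5] at h3
  exact le_of_mul_le_mul_right h3 (Real.rpow_pos_of_pos h0 _)

end Bounded

/-! ### Approximation of strongly convergent sequences -/

section Strong

variable {d₁ d₂ : ℕ} {A : MeanValueAlgebra d₁} {G₁ : Set (Eu d₁)} {G₂ : Set (Eu d₂)} {p : ℝ≥0∞}
  [Fact (1 ≤ p)]

/-- The canonical map `L^p(G₁; A(ℝ^m; F)) → L^p(G₁; 𝓑_A^p(ℝ^m; F))`. -/
def toLimit (A : MeanValueAlgebra d₁) (G₁ : Set (Eu d₁)) (F : Type*) [NormedAddCommGroup F]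
    [NormedSpace ℝ F] (p : ℝ≥0∞) [Fact (1 ≤ p)]
    (ψ : Lp (A.vec F) p ((volume : Measure (Eu d₁)).restrict G₁)) :
    Lp (A.Besicovitch F p) p ((volume : Measure (Eu d₁)).restrict G₁) :=
  (A.toBesicovitch F p).compLp ψ

lemma toLimit_coeFn {F : Type*} [NormedAddCommGroup F] [NormedSpace ℝ F]
    (ψ : Lp (A.vec F) p ((volume : Measure (Eu d₁)).restrict G₁)) :
    toLimit A G₁ F p ψ =ᵐ[volume.restrict G₁] fun x => A.toBesicovitch F p (ψ x) :=
  (A.toBesicovitch F p).coeFn_compLp ψ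

/-- The pairing of `L^p(G₁; 𝓑_A^p)` and `L^{p'}(G₁; 𝓑_A^{p'})`. -/
def limitDuality (A : MeanValueAlgebra d₁) (G₁ : Set (Eu d₁)) (G₂ : Set (Eu d₂)) (p : ℝ≥0∞)
    [Fact (1 ≤ p)] : LimitSpace A G₁ G₂ p →L[ℝ]
      Lp (A.Besicovitch (LpOn G₂ p.conjExponent) p.conjExponent) p.conjExponent
        ((volume : Measure (Eu d₁)).restrict G₁) →L[ℝ] ℝ :=
  (A.besicovitchPairing G₂ p).lpPairing (volume.restrict G₁) p p.conjExponent

/-- The pairing sees a test function only through its class. Estimates may therefore use its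
Besicovitch norm, known for dual functions by `norm_toLimit_dual`, instead of a sup norm that is not
controlled along the approximation. -/
lemma limitPairing_eq_limitDuality (u : LimitSpace A G₁ G₂ p) (f : TestSpace A G₁ G₂ p) :
    limitPairing A G₁ G₂ p u f = limitDuality A G₁ G₂ p u (toLimit A G₁ _ _ f) := by
  rw [limitPairing, limitDuality, ContinuousLinearMap.lpPairing_eq_integral,
    ContinuousLinearMap.lpPairing_eq_integral]
  refine integral_congr_ae ?_
  have h := toLimit_coeFn (A := A) (G₁ := G₁) (F := LpOn G₂ p.conjExponent) f
  filter_upwards [h] with x hx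
  rw [hx]
  rfl

section Dual

variable {ψ : Lp (A.vec (LpOn G₂ p)) p ((volume : Measure (Eu d₁)).restrict G₁)}
  {ψ' : TestSpace A G₁ G₂ p}

lemma isBochnerDual_evalScaledFun (h : ∀ᵐ x ∂(volume.restrict G₁), IsVecDual (ψ x) (ψ' x)) (ε : ℝ) :
    IsBochnerDual (evalScaledFun ε ψ) (evalScaledFun ε ψ') := by
  have h1 := evalScaledFun_coeFn (A := A) (G₁ := G₁) (F := LpOn G₂ p) ε ψ
  have h2 := evalScaledFun_coeFn (A := A) (G₁ := G₁) (F := LpOn G₂ p.conjExponent) ε ψ'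
  unfold IsBochnerDual
  filter_upwards [h, h1, h2] with x h3 h4 h5
  rw [h4, h5]
  exact h3 _

lemma norm_toLimit_dual (hp : 1 < p) (hp' : p ≠ ∞)
    (h : ∀ᵐ x ∂(volume.restrict G₁), IsVecDual (ψ x) (ψ' x)) :
    ‖toLimit A G₁ _ _ ψ'‖ = ‖toLimit A G₁ _ _ ψ‖ ^ (p.toReal - 1) := by
  refine eq_rpow_sub_one_of_rpow_eq hp hp' (norm_nonneg _) (norm_nonneg _) ?_
  rw [lp_norm_rpow_eq_integral hp', lp_norm_rpow_eq_integral (conjExponent_ne_top hp)]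
  refine integral_congr_ae ?_
  have h1 := toLimit_coeFn (A := A) (G₁ := G₁) (F := LpOn G₂ p) ψ
  have h2 := toLimit_coeFn (A := A) (G₁ := G₁) (F := LpOn G₂ p.conjExponent) ψ'
  filter_upwards [h, h1, h2] with x h3 h4 h5
  rw [h4, h5]
  exact h3.norm_rpow_toBesicovitch hp hp'

lemma limitDuality_self (hp : 1 < p) (hp' : p ≠ ∞)
    (h : ∀ᵐ x ∂(volume.restrict G₁), IsVecDual (ψ x) (ψ' x)) :
    limitDuality A G₁ G₂ p (toLimit A G₁ _ _ ψ) (toLimit A G₁ _ _ ψ') =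
      ‖toLimit A G₁ _ _ ψ‖ ^ p.toReal := by
  rw [limitDuality, ContinuousLinearMap.lpPairing_eq_integral, lp_norm_rpow_eq_integral hp']
  refine integral_congr_ae ?_
  have h1 := toLimit_coeFn (A := A) (G₁ := G₁) (F := LpOn G₂ p) ψ
  have h2 := toLimit_coeFn (A := A) (G₁ := G₁) (F := LpOn G₂ p.conjExponent) ψ'
  filter_upwards [h, h1, h2] with x h3 h4 h5
  rw [h4, h5]
  exact h3.pairing_self hp hp'

end Dual

/-- Splitting over the level sets of `g` leaves a fixed function against each indicator, the form in
which weak-* convergence applies. -/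
lemma setIntegral_simpleFunc_comp {X : Type*} (hG₁ : MeasurableSet G₁) (g : SimpleFunc (Eu d₁) X)
    (h : X → Eu d₁ → ℝ)
    (hi : ∀ b, Integrable fun x => h b x * (g ⁻¹' {b} ∩ G₁).indicator (fun _ => (1 : ℝ)) x) :
    ∫ x in G₁, h (g x) x =
      ∑ b ∈ g.range, ∫ x, h b x * (g ⁻¹' {b} ∩ G₁).indicator (fun _ => (1 : ℝ)) x := by
  classical
  rw [← integral_finsetSum _ fun b _ => hi b, ← integral_indicator hG₁]
  congr 1
  ext x
  rw [Finset.sum_eq_single (g x)]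
  · by_cases hx : x ∈ G₁ <;> simp [hx]
  · intro b _ hb
    rw [Set.indicator_of_notMem, mul_zero]
    simp [hb.symm]
  · intro hx
    exact absurd (g.mem_range_self x) hx

variable [IsFiniteMeasure ((volume : Measure (Eu d₁)).restrict G₁)]
  [IsFiniteMeasure ((volume : Measure (Eu d₂)).restrict G₂)]

set_option maxHeartbeats 1000000 in
-- A simple function near `v₀` has finitely many values, and each is replaced by a nearby class
-- having a dual. Then `‖ψ_ε‖^p` is a finite sum of integrals of rescaled elements of `A` against
-- indicators, and each term converges.
lemma exists_approx_with_dual (hp : 1 < p) (hp' : p ≠ ∞) (hG₁ : MeasurableSet G₁)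
    (v₀ : LimitSpace A G₁ G₂ p) {η : ℝ} (hη : 0 < η) :
    ∃ (ψ : Lp (A.vec (LpOn G₂ p)) p ((volume : Measure (Eu d₁)).restrict G₁))
      (ψ' : TestSpace A G₁ G₂ p), (∀ᵐ x ∂(volume.restrict G₁), IsVecDual (ψ x) (ψ' x)) ∧
      ‖v₀ - toLimit A G₁ _ _ ψ‖ < η ∧
      Tendsto (fun ε : ℝ => ‖evalScaledFun ε ψ‖ ^ p.toReal) (𝓝[>] 0)
        (𝓝 (‖toLimit A G₁ _ _ ψ‖ ^ p.toReal)) := by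
  have hp0 : p ≠ 0 := (zero_lt_one.trans hp).ne'
  obtain ⟨c, hc0, hc⟩ : ∃ c : ℝ, 0 ≤ c ∧
      c = (((volume : Measure (Eu d₁)).restrict G₁).real Set.univ) ^ p.toReal⁻¹ :=
    ⟨_, by positivity, rfl⟩
  obtain ⟨g, hg, hgm⟩ := (Lp.memLp v₀).exists_simpleFunc_eLpNorm_sub_lt hp'
    (ε := ENNReal.ofReal (η / 2)) (by simpa using hη)
  -- With `c = |G₁|^{1/p}`, replacing the values costs at most `c η / (2 (c + 1)) ≤ η / 2`; the `+
  -- 1` allows `c = 0`.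
  have hη' : 0 < η / (2 * (c + 1)) := by positivity
  choose κ κ' hκ hκη using fun b : A.Besicovitch (LpOn G₂ p) p =>
    MeanValueAlgebra.Besicovitch.exists_isVecDual_near hp hp' b hη'
  have hm : MemLp (g.map κ) p ((volume : Measure (Eu d₁)).restrict G₁) :=
    SimpleFunc.memLp_of_isFiniteMeasure _ _ _
  have hm' : MemLp (g.map κ') p.conjExponent ((volume : Measure (Eu d₁)).restrict G₁) :=
    SimpleFunc.memLp_of_isFiniteMeasure _ _ _
  have hlim := toLimit_coeFn (A := A) (G₁ := G₁) (F := LpOn G₂ p) hm.toLp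
  have hlim' : toLimit A G₁ _ _ hm.toLp =ᵐ[volume.restrict G₁]
      fun x => A.toBesicovitch (LpOn G₂ p) p (κ (g x)) := by
    filter_upwards [hlim, hm.coeFn_toLp] with x h1 h2
    rw [h1, h2]
    rfl
  refine ⟨hm.toLp, hm'.toLp, ?_, ?_, ?_⟩
  · filter_upwards [hm.coeFn_toLp, hm'.coeFn_toLp] with x h1 h2
    rw [h1, h2]
    exact hκ (g x)
  · have hgv : ‖v₀ - hgm.toLp‖ < η / 2 := by
      rw [Lp.norm_def]
      refine (ENNReal.toReal_lt_of_lt_ofReal (lt_of_eq_of_lt (eLpNorm_congr_ae ?_) hg))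
      filter_upwards [Lp.coeFn_sub v₀ hgm.toLp, hgm.coeFn_toLp] with x h1 h2
      rw [h1, Pi.sub_apply, Pi.sub_apply, h2]
    have hgκ : ‖hgm.toLp - toLimit A G₁ _ _ hm.toLp‖ ≤ c * (η / (2 * (c + 1))) := by
      refine (Lp.norm_le_of_ae_bound hη'.le ?_).trans_eq (by rw [hc]; rfl)
      filter_upwards [Lp.coeFn_sub hgm.toLp (toLimit A G₁ _ _ hm.toLp), hgm.coeFn_toLp,
        hlim'] with x h1 h2 h3
      rw [h1, Pi.sub_apply, h2, h3]
      exact (hκη (g x)).le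
    have hcη : c * (η / (2 * (c + 1))) ≤ η / 2 := by
      rw [← mul_div_assoc, div_le_div_iff₀ (by positivity) two_pos]
      nlinarith
    have := norm_sub_le_norm_sub_add_norm_sub v₀ hgm.toLp (toLimit A G₁ _ _ hm.toLp)
    linarith
  · have hφ : ∀ b, Integrable ((g ⁻¹' {b} ∩ G₁).indicator (fun _ => (1 : ℝ))) := fun b => by
      refine (integrable_indicator_iff ((g.measurableSet_fiber b).inter hG₁)).2
        (integrableOn_const (ne_top_of_le_ne_top (measure_ne_top
          ((volume : Measure (Eu d₁)).restrict G₁) Set.univ) ?_))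
      rw [Measure.restrict_apply_univ]
      exact measure_mono Set.inter_subset_right
    have h1 : ‖toLimit A G₁ _ _ hm.toLp‖ ^ p.toReal = ∑ b ∈ g.range,
        ‖A.toBesicovitch (LpOn G₂ p) p (κ b)‖ ^ p.toReal *
          ∫ x, (g ⁻¹' {b} ∩ G₁).indicator (fun _ => (1 : ℝ)) x := by
      rw [lp_norm_rpow_eq_integral hp']
      simp only [← integral_const_mul]
      rw [← setIntegral_simpleFunc_comp hG₁ g
        (fun b _ => ‖A.toBesicovitch (LpOn G₂ p) p (κ b)‖ ^ p.toReal)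
        fun b => (hφ b).const_mul _]
      refine integral_congr_ae (hlim'.mono fun x hx => ?_)
      simp only [hx]
    have h2 : ∀ ε : ℝ, ‖evalScaledFun ε hm.toLp‖ ^ p.toReal = ∑ b ∈ g.range,
        ∫ x, ‖(κ b : Eu d₁ →ᵇ LpOn G₂ p) (ε⁻¹ • x)‖ ^ p.toReal *
          (g ⁻¹' {b} ∩ G₁).indicator (fun _ => (1 : ℝ)) x := fun ε => by
      rw [lp_norm_rpow_eq_integral hp']
      rw [← setIntegral_simpleFunc_comp hG₁ g
        (fun b x => ‖(κ b : Eu d₁ →ᵇ LpOn G₂ p) (ε⁻¹ • x)‖ ^ p.toReal) fun b => ?_]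
      · have h3 := evalScaledFun_coeFn (A := A) (G₁ := G₁) (F := LpOn G₂ p) ε hm.toLp
        refine integral_congr_ae ?_
        filter_upwards [h3, hm.coeFn_toLp] with x h4 h5
        rw [h4, h5]
        rfl
      · refine (hφ b).bdd_mul (c := ‖(κ b : Eu d₁ →ᵇ LpOn G₂ p)‖ ^ p.toReal) ?_ ?_
        · refine Continuous.aestronglyMeasurable ?_
          refine (Real.continuous_rpow_const ENNReal.toReal_nonneg).comp ?_
          exact ((κ b : Eu d₁ →ᵇ LpOn G₂ p).continuous.comp (continuous_const_smul ε⁻¹)).norm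
        · refine Eventually.of_forall fun x => ?_
          rw [Real.norm_of_nonneg (by positivity)]
          exact Real.rpow_le_rpow (norm_nonneg _) ((κ b : Eu d₁ →ᵇ LpOn G₂ p).norm_coe_le_norm _)
            ENNReal.toReal_nonneg
    simp only [h1, h2]
    exact tendsto_finsetSum _ fun b _ => (hκ b).tendsto_integral hp hp' (hφ b)

set_option maxHeartbeats 1000000 in
/-- A strongly `Σ`-convergent sequence is close in norm to the rescaled functions associated with
an approximation of its limit. -/
lemma exists_approx_of_strong (hp : 1 < p) (hp' : p ≠ ∞) (hG₁ : MeasurableSet G₁)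
    {ε : ℕ → ℝ} (hε : Tendsto ε atTop (𝓝[>] 0)) (v₀ : LimitSpace A G₁ G₂ p)
    {V : ℕ → Lp (LpOn G₂ p) p ((volume : Measure (Eu d₁)).restrict G₁)}
    (hV : ∀ f : TestSpace A G₁ G₂ p, Tendsto
      (fun n => bochnerPairing G₁ G₂ p (V n) (evalScaledFun (ε n) f)) atTop
      (𝓝 (limitPairing A G₁ G₂ p v₀ f)))
    (hVn : Tendsto (fun n => ‖V n‖) atTop (𝓝 ‖v₀‖)) {η : ℝ} (hη : 0 < η) :
    ∃ ψ : Lp (A.vec (LpOn G₂ p)) p ((volume : Measure (Eu d₁)).restrict G₁),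
      ‖v₀ - toLimit A G₁ _ _ ψ‖ < η ∧
      ∀ᶠ n in atTop, ‖V n - evalScaledFun (ε n) ψ‖ < η := by
  have hpr := one_lt_toReal hp hp'
  have hpp : 0 < p.toReal := zero_lt_one.trans hpr
  have hrp := Real.continuous_rpow_const hpp.le
  have hrq := Real.continuous_rpow_const (sub_pos.2 hpr).le
  set P := p.toReal with hP
  have hv0 : 0 ≤ ‖v₀‖ ^ P := by positivity
  have hηp : 0 < η ^ P := Real.rpow_pos_of_pos hη P
  -- Ensures `2 δ ‖v₀‖^P < η^P`, also for `v₀ = 0`. The order of choices is `δ`, then `C`, then `k`,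
  -- and finally `n`.
  set δ : ℝ := η ^ P / (2 * ‖v₀‖ ^ P + 1) with hδ
  have hδ0 : 0 < δ := by positivity
  obtain ⟨C, hC0, hC⟩ := exists_abs_sub_rpow_le hpr hδ0
  set K : ℝ := ‖limitDuality A G₁ G₂ p‖ with hK
  choose ψ ψ' hdual hclose hconv using fun k : ℕ =>
    exists_approx_with_dual hp hp' hG₁ v₀ (Nat.one_div_pos_of_nat (α := ℝ) (n := k))
  have hk0 := tendsto_one_div_add_atTop_nhds_zero_nat (𝕜 := ℝ)
  have hN : Tendsto (fun k => ‖toLimit A G₁ _ _ (ψ k)‖) atTop (𝓝 ‖v₀‖) := by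
    have h1 : Tendsto (fun k => toLimit A G₁ _ _ (ψ k)) atTop (𝓝 v₀) := by
      refine tendsto_iff_norm_sub_tendsto_zero.2 (squeeze_zero (fun _ => norm_nonneg _)
        (fun k => ?_) hk0)
      rw [norm_sub_rev]
      exact (hclose k).le
    exact h1.norm
  -- As `k → ∞` the factor of `C` vanishes, and only the `δ` term survives.
  have hB : Tendsto (fun k : ℕ => C * (‖v₀‖ ^ P - ‖toLimit A G₁ _ _ (ψ k)‖ ^ P +
      P * (K * (1 / ((k : ℝ) + 1)) * ‖toLimit A G₁ _ _ (ψ k)‖ ^ (P - 1))) +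
      δ * (‖v₀‖ ^ P + ‖toLimit A G₁ _ _ (ψ k)‖ ^ P)) atTop
      (𝓝 (C * (‖v₀‖ ^ P - ‖v₀‖ ^ P + P * (K * 0 * ‖v₀‖ ^ (P - 1))) +
        δ * (‖v₀‖ ^ P + ‖v₀‖ ^ P))) := by
    have h1 := (hrp.tendsto _).comp hN
    have h2 := (hrq.tendsto _).comp hN
    exact ((((tendsto_const_nhds.sub h1).add (((hk0.const_mul K).mul h2).const_mul P)).const_mul
      C).add ((tendsto_const_nhds.add h1).const_mul δ))
  have hlt : C * (‖v₀‖ ^ P - ‖v₀‖ ^ P + P * (K * 0 * ‖v₀‖ ^ (P - 1))) +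
      δ * (‖v₀‖ ^ P + ‖v₀‖ ^ P) < η ^ P := by
    have : δ * (2 * ‖v₀‖ ^ P + 1) = η ^ P := div_mul_cancel₀ _ (by positivity)
    linarith
  obtain ⟨k, hk1, hk2⟩ := ((hB.eventually_lt_const hlt).and (hk0.eventually_lt_const hη)).exists
  refine ⟨ψ k, (hclose k).trans hk2, ?_⟩
  -- Write `⟨v₀, ψ'⟩ = ⟨ψ, ψ'⟩ + ⟨v₀ - ψ, ψ'⟩` with `⟨ψ, ψ'⟩ = ‖ψ‖^P`: the coefficient `P - 1`
  -- becomes `-1`, and the remainder is at most `K ‖v₀ - ψ‖ ‖ψ‖^{P-1}`.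
  have hD : ‖v₀‖ ^ P + (P - 1) * ‖toLimit A G₁ _ _ (ψ k)‖ ^ P -
      P * limitPairing A G₁ G₂ p v₀ (ψ' k) ≤ ‖v₀‖ ^ P - ‖toLimit A G₁ _ _ (ψ k)‖ ^ P +
      P * (K * (1 / ((k : ℝ) + 1)) * ‖toLimit A G₁ _ _ (ψ k)‖ ^ (P - 1)) := by
    have h1 := limitDuality_self hp hp' (hdual k)
    have h2 : |limitDuality A G₁ G₂ p (v₀ - toLimit A G₁ _ _ (ψ k)) (toLimit A G₁ _ _ (ψ' k))| ≤
        K * (1 / ((k : ℝ) + 1)) * ‖toLimit A G₁ _ _ (ψ k)‖ ^ (P - 1) := by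
      rw [← norm_toLimit_dual hp hp' (hdual k)]
      refine ((limitDuality A G₁ G₂ p).le_opNorm₂ _ _).trans ?_
      gcongr
      exact (hclose k).le
    rw [map_sub, sub_apply, h1] at h2
    rw [limitPairing_eq_limitDuality]
    have h3 := mul_le_mul_of_nonneg_left (neg_le_of_abs_le h2) hpp.le
    linarith
  -- With `k` fixed, `n → ∞`: the norms of `V n` converge by strong convergence, those of `ψ_ε` by
  -- `hconv`, and the pairing because `ψ'` is a test function.
  have hlimit : Tendsto (fun n => C * (‖V n‖ ^ P +
      (P - 1) * ‖evalScaledFun (ε n) (ψ k)‖ ^ P -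
      P * bochnerPairing G₁ G₂ p (V n) (evalScaledFun (ε n) (ψ' k))) +
      δ * (‖V n‖ ^ P + ‖evalScaledFun (ε n) (ψ k)‖ ^ P)) atTop
      (𝓝 (C * (‖v₀‖ ^ P + (P - 1) * ‖toLimit A G₁ _ _ (ψ k)‖ ^ P -
      P * limitPairing A G₁ G₂ p v₀ (ψ' k)) +
      δ * (‖v₀‖ ^ P + ‖toLimit A G₁ _ _ (ψ k)‖ ^ P))) := by
    have h1 := (hrp.tendsto _).comp hVn
    have h2 := (hconv k).comp hε
    exact (((h1.add (h2.const_mul (P - 1))).sub ((hV (ψ' k)).const_mul P)).const_mul C).add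
      ((h1.add h2).const_mul δ)
  have hfin : C * (‖v₀‖ ^ P + (P - 1) * ‖toLimit A G₁ _ _ (ψ k)‖ ^ P -
      P * limitPairing A G₁ G₂ p v₀ (ψ' k)) +
      δ * (‖v₀‖ ^ P + ‖toLimit A G₁ _ _ (ψ k)‖ ^ P) < η ^ P :=
    lt_of_le_of_lt (add_le_add_left (mul_le_mul_of_nonneg_left hD hC0) _) hk1
  filter_upwards [hlimit.eventually_lt_const hfin] with n hn
  have h1 := (isBochnerDual_evalScaledFun (hdual k) (ε n)).norm_sub_rpow_le hp' hC (V n)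
  exact (Real.rpow_lt_rpow_iff (norm_nonneg _) hη.le hpp).1 (h1.trans_lt hn)

end Strong

/-! ### Products -/

/-- Obtained by cancelling the finite number `1 / q` in `1/q + 1/p + 1/r' = 1 = 1/q + 1/q'`. It puts
the product of a function in `L^p` and a test function for exponent `r` into `L^{q'}`. -/
lemma holderTriple_conjExponent {p q r : ℝ≥0∞} [Fact (1 ≤ q)] [Fact (1 ≤ r)]
    [h : ENNReal.HolderTriple q p r] :
    ENNReal.HolderTriple p r.conjExponent q.conjExponent := by
  have h1 : (1 : ℝ≥0∞) ≤ q := Fact.out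
  refine ⟨?_⟩
  have h2 := (inferInstance : ENNReal.HolderConjugate q q.conjExponent).inv_add_inv_eq_inv
  have h3 := (inferInstance : ENNReal.HolderConjugate r r.conjExponent).inv_add_inv_eq_inv
  rw [← h.inv_add_inv_eq_inv, ← h2, add_assoc] at h3
  exact (ENNReal.add_right_inj (ENNReal.inv_ne_top.2 (zero_lt_one.trans_le h1).ne')).1 h3

lemma tendsto_of_forall_approx {s : ℕ → ℝ} {l : ℝ} (h : ∀ δ : ℝ, 0 < δ →
    ∃ (t : ℕ → ℝ) (m : ℝ), Tendsto t atTop (𝓝 m) ∧ |l - m| ≤ δ ∧ ∀ᶠ n in atTop, |s n - t n| ≤ δ) :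
    Tendsto s atTop (𝓝 l) := by
  refine Metric.tendsto_nhds.2 fun δ hδ => ?_
  obtain ⟨t, m, ht, hm, hs⟩ := h (δ / 4) (by positivity)
  filter_upwards [hs, Metric.tendsto_nhds.1 ht (δ / 4) (by positivity)] with n h1 h2
  rw [Real.dist_eq] at h2 ⊢
  have h3 := abs_sub_le (s n) (t n) l
  have h4 := abs_sub_le (t n) m l
  rw [abs_sub_comm m l] at h4
  linarith

section HolderSub

variable {α E F G : Type*} {mα : MeasurableSpace α} {μ : Measure α} {p q r : ℝ≥0∞}
  [Fact (1 ≤ p)] [Fact (1 ≤ q)] [Fact (1 ≤ r)] [ENNReal.HolderTriple p q r]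
  [NormedAddCommGroup E] [NormedAddCommGroup F] [NormedAddCommGroup G]
  [NormedSpace ℝ E] [NormedSpace ℝ F] [NormedSpace ℝ G] (B : E →L[ℝ] F →L[ℝ] G)

lemma holder_sub_left (f₁ f₂ : Lp E p μ) (g : Lp F q μ) :
    B.holder r (f₁ - f₂) g = B.holder r f₁ g - B.holder r f₂ g := by
  exact congrArg (fun T => T g) (map_sub (B.holderL μ p q r) f₁ f₂)

end HolderSub

section Product

variable {d₁ d₂ : ℕ} {A : MeanValueAlgebra d₁} {G₁ : Set (Eu d₁)} {G₂ : Set (Eu d₂)}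

/-- Evaluation at `y = x / ε` respects products; hence `ψ_ε f_ε` is the rescaling of one admissible
test function. -/
lemma evalScaledFun_holder {E F G : Type*} {p q r : ℝ≥0∞}
    [Fact (1 ≤ p)] [Fact (1 ≤ q)] [Fact (1 ≤ r)] [ENNReal.HolderTriple p q r]
    [NormedAddCommGroup E] [NormedAddCommGroup F] [NormedAddCommGroup G]
    [NormedSpace ℝ E] [NormedSpace ℝ F] [NormedSpace ℝ G] (B : E →L[ℝ] F →L[ℝ] G) (ε : ℝ)
    (ψ : Lp (A.vec E) p ((volume : Measure (Eu d₁)).restrict G₁))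
    (f : Lp (A.vec F) q ((volume : Measure (Eu d₁)).restrict G₁)) :
    evalScaledFun ε ((A.vecBilin B).holder r ψ f) =
      B.holder r (evalScaledFun ε ψ) (evalScaledFun ε f) := by
  refine Lp.ext ?_
  filter_upwards [evalScaledFun_coeFn ε ((A.vecBilin B).holder r ψ f),
    (A.vecBilin B).coeFn_holder (r := r) ψ f,
    B.coeFn_holder (r := r) (evalScaledFun ε ψ) (evalScaledFun ε f),
    evalScaledFun_coeFn ε ψ, evalScaledFun_coeFn ε f] with x h1 h2 h3 h4 h5
  rw [h1, h2, h3, h4, h5, A.vecBilin_apply]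

variable {p q r : ℝ≥0∞} [Fact (1 ≤ p)] [Fact (1 ≤ q)] [Fact (1 ≤ r)]

/-- Pointwise multiplication `L^q(G) × L^p(G) → L^r(G)`, `1/r = 1/q + 1/p`. -/
def mulLp (G : Set (Eu d₂)) (q p r : ℝ≥0∞) [Fact (1 ≤ p)] [Fact (1 ≤ q)] [Fact (1 ≤ r)]
    [ENNReal.HolderTriple q p r] : LpOn G q →L[ℝ] LpOn G p →L[ℝ] LpOn G r :=
  (ContinuousLinearMap.mul ℝ ℝ).holderL (volume.restrict G) q p r

lemma mulLp_coeFn [ENNReal.HolderTriple q p r] (u : LpOn G₂ q) (v : LpOn G₂ p) :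
    mulLp G₂ q p r u v =ᵐ[volume.restrict G₂] fun ζ => u ζ * v ζ :=
  (ContinuousLinearMap.mul ℝ ℝ).coeFn_holder u v

lemma mulL1_coeFn (u : LpOn G₂ p) (v : LpOn G₂ p.conjExponent) :
    mulL1 G₂ p u v =ᵐ[volume.restrict G₂] fun ζ => u ζ * v ζ :=
  (ContinuousLinearMap.mul ℝ ℝ).coeFn_holder u v

variable [ENNReal.HolderTriple q p r]
  [ENNReal.HolderTriple p r.conjExponent q.conjExponent]

lemma mulL1_mulLp (u : LpOn G₂ q) (v : LpOn G₂ p) (f : LpOn G₂ r.conjExponent) :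
    mulL1 G₂ r (mulLp G₂ q p r u v) f =
      mulL1 G₂ q u (mulLp G₂ p r.conjExponent q.conjExponent v f) := by
  refine Lp.ext ?_
  filter_upwards [mulL1_coeFn (mulLp G₂ q p r u v) f,
    mulL1_coeFn u (mulLp G₂ p r.conjExponent q.conjExponent v f), mulLp_coeFn (r := r) u v,
    mulLp_coeFn (r := q.conjExponent) v f] with ζ h1 h2 h3 h4
  rw [h1, h2, h3, h4, mul_assoc]

set_option maxHeartbeats 1000000 in
lemma besicovitchPairing_bilin (b : A.Besicovitch (LpOn G₂ q) q) (a : A.vec (LpOn G₂ p))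
    (f : A.vec (LpOn G₂ r.conjExponent)) :
    A.besicovitchPairing G₂ r (A.bilin (mulLp G₂ q p r) b (A.toBesicovitch _ p a))
      (A.toBesicovitch _ _ f) = A.besicovitchPairing G₂ q b
        (A.toBesicovitch _ _ (A.vecBilin (mulLp G₂ p r.conjExponent q.conjExponent) a f)) := by
  obtain ⟨U, rfl⟩ := SeparationQuotient.surjective_mk b
  rw [A.besicovitchPairing_apply, A.besicovitchPairing_apply, A.toBesicovitch_apply,
    A.toBesicovitch_apply, A.toBesicovitch_apply, A.bilin_mk, A.bilin_mk, A.bilin_mk,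
    A.meanCLM_mk, A.meanCLM_mk]
  congr 2
  ext1 y
  exact mulL1_mulLp _ _ _

/-- Associativity of multiplication moves `V` onto the test function, where it can be replaced by
`ψ_ε`. -/
lemma bochnerPairing_holder (U : Lp (LpOn G₂ q) q ((volume : Measure (Eu d₁)).restrict G₁))
    (V : Lp (LpOn G₂ p) p ((volume : Measure (Eu d₁)).restrict G₁))
    (f : Lp (LpOn G₂ r.conjExponent) r.conjExponent ((volume : Measure (Eu d₁)).restrict G₁)) :
    bochnerPairing G₁ G₂ r ((mulLp G₂ q p r).holder r U V) f = bochnerPairing G₁ G₂ q U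
      ((mulLp G₂ p r.conjExponent q.conjExponent).holder q.conjExponent V f) := by
  rw [bochnerPairing_eq, bochnerPairing_eq]
  refine integral_congr_ae ?_
  filter_upwards [(mulLp G₂ q p r).coeFn_holder (r := r) U V,
    (mulLp G₂ p r.conjExponent q.conjExponent).coeFn_holder (r := q.conjExponent) V f]
    with x h1 h2
  rw [h1, h2, ← integralL1_mulL1, ← integralL1_mulL1, mulL1_mulLp]

/-- The product of the limits. -/
def limitMul (A : MeanValueAlgebra d₁) (G₁ : Set (Eu d₁)) (G₂ : Set (Eu d₂)) (q p r : ℝ≥0∞)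
    [Fact (1 ≤ p)] [Fact (1 ≤ q)] [Fact (1 ≤ r)] [ENNReal.HolderTriple q p r] :
    LimitSpace A G₁ G₂ q →L[ℝ] LimitSpace A G₁ G₂ p →L[ℝ] LimitSpace A G₁ G₂ r :=
  (A.bilin (mulLp G₂ q p r)).holderL (volume.restrict G₁) q p r

lemma limitMul_coeFn (u : LimitSpace A G₁ G₂ q) (v : LimitSpace A G₁ G₂ p) :
    limitMul A G₁ G₂ q p r u v =ᵐ[volume.restrict G₁]
      fun x => A.bilin (mulLp G₂ q p r) (u x) (v x) :=
  (A.bilin (r := r) (mulLp G₂ q p r)).coeFn_holder u v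

set_option maxHeartbeats 1000000 in
lemma limitPairing_limitMul (u : LimitSpace A G₁ G₂ q)
    (ψ : Lp (A.vec (LpOn G₂ p)) p ((volume : Measure (Eu d₁)).restrict G₁))
    (f : TestSpace A G₁ G₂ r) :
    limitPairing A G₁ G₂ r (limitMul A G₁ G₂ q p r u (toLimit A G₁ _ _ ψ)) f =
      limitPairing A G₁ G₂ q u ((A.vecBilin
        (mulLp G₂ p r.conjExponent q.conjExponent)).holder q.conjExponent ψ f) := by
  rw [limitPairing_eq, limitPairing_eq]
  refine integral_congr_ae ?_
  have h := toLimit_coeFn (A := A) (G₁ := G₁) (F := LpOn G₂ p) ψ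
  filter_upwards [limitMul_coeFn (r := r) u (toLimit A G₁ _ _ ψ), h,
    (A.vecBilin (mulLp G₂ p r.conjExponent q.conjExponent)).coeFn_holder
      (r := q.conjExponent) ψ f] with x h1 h2 h3
  rw [h1, h2, h3, meanPairing_eq_besicovitchPairing, meanPairing_eq_besicovitchPairing,
    besicovitchPairing_bilin]

lemma isProduct_bilin (b : A.Besicovitch (LpOn G₂ q) q) (c : A.Besicovitch (LpOn G₂ p) p) :
    IsProduct b c (A.bilin (mulLp G₂ q p r) b c) := by
  rintro U V rfl rfl
  exact ⟨A.funBilin (mulLp G₂ q p r) U V, (A.bilin_mk _ U V).symm,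
    fun y => mulLp_coeFn (r := r) (U.toFun y) (V.toFun y)⟩

lemma IsRescaling.mul {ε : ℝ} {u v : Eu d₁ × Eu d₂ → ℝ}
    {U : Lp (LpOn G₂ q) q ((volume : Measure (Eu d₁)).restrict G₁)}
    {V : Lp (LpOn G₂ p) p ((volume : Measure (Eu d₁)).restrict G₁)} (hu : IsRescaling ε u U)
    (hv : IsRescaling ε v V) :
    IsRescaling ε (fun x => u x * v x) ((mulLp G₂ q p r).holder r U V) := by
  unfold IsRescaling
  filter_upwards [hu, hv, (mulLp G₂ q p r).coeFn_holder (r := r) U V] with x h1 h2 h3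
  rw [h3]
  filter_upwards [h1, h2, mulLp_coeFn (r := r) (U x) (V x)] with ζ h4 h5 h6
  rw [h6, h4, h5]

set_option maxHeartbeats 1000000 in
lemma abs_bochnerPairing_holder_sub_le
    (U : Lp (LpOn G₂ q) q ((volume : Measure (Eu d₁)).restrict G₁))
    (V : Lp (LpOn G₂ p) p ((volume : Measure (Eu d₁)).restrict G₁)) (ε : ℝ)
    (ψ : Lp (A.vec (LpOn G₂ p)) p ((volume : Measure (Eu d₁)).restrict G₁))
    (f : TestSpace A G₁ G₂ r) :
    |bochnerPairing G₁ G₂ r ((mulLp G₂ q p r).holder r U V) (evalScaledFun ε f) -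
      bochnerPairing G₁ G₂ q U (evalScaledFun ε ((A.vecBilin
        (mulLp G₂ p r.conjExponent q.conjExponent)).holder q.conjExponent ψ f))| ≤
      ‖bochnerPairing G₁ G₂ q‖ * ‖U‖ * (‖mulLp G₂ p r.conjExponent q.conjExponent‖ *
        ‖V - evalScaledFun ε ψ‖ * ‖f‖) := by
  rw [bochnerPairing_holder, evalScaledFun_holder, ← map_sub, ← holder_sub_left]
  refine ((bochnerPairing G₁ G₂ q).le_opNorm₂ _ _).trans ?_
  refine mul_le_mul_of_nonneg_left ?_ (by positivity)
  refine (ContinuousLinearMap.norm_holder_apply_apply_le _ _ _).trans ?_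
  exact mul_le_mul_of_nonneg_left (norm_evalScaledFun_le ε f) (by positivity)

set_option maxHeartbeats 1000000 in
lemma abs_limitPairing_limitMul_sub_le (u : LimitSpace A G₁ G₂ q) (v : LimitSpace A G₁ G₂ p)
    (ψ : Lp (A.vec (LpOn G₂ p)) p ((volume : Measure (Eu d₁)).restrict G₁))
    (f : TestSpace A G₁ G₂ r) :
    |limitPairing A G₁ G₂ r (limitMul A G₁ G₂ q p r u v) f -
      limitPairing A G₁ G₂ q u ((A.vecBilin
        (mulLp G₂ p r.conjExponent q.conjExponent)).holder q.conjExponent ψ f)| ≤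
      ‖limitDuality A G₁ G₂ r‖ * (‖limitMul A G₁ G₂ q p r‖ * ‖u‖ *
        ‖v - toLimit A G₁ _ _ ψ‖) * ‖toLimit A G₁ _ _ f‖ := by
  rw [← limitPairing_limitMul, ← sub_apply, ← map_sub, ← map_sub, limitPairing_eq_limitDuality]
  refine ((limitDuality A G₁ G₂ r).le_opNorm₂ _ _).trans ?_
  gcongr
  exact (limitMul A G₁ G₂ q p r).le_opNorm₂ _ _

end Product

/-! ### Convergence of the product -/

section Convergence

variable {d₁ d₂ : ℕ} {A : MeanValueAlgebra d₁} {G₁ : Set (Eu d₁)} {G₂ : Set (Eu d₂)}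

lemma weakSigma_iff {p : ℝ≥0∞} [Fact (1 ≤ p)] {ε : ℕ → ℝ} (hε : ∀ n, 0 < ε n)
    {u : ℕ → Eu d₁ × Eu d₂ → ℝ}
    {U : ℕ → Lp (LpOn G₂ p) p ((volume : Measure (Eu d₁)).restrict G₁)}
    (hU : ∀ n, IsRescaling (ε n) (u n) (U n)) (u₀ : LimitSpace A G₁ G₂ p) :
    WeakSigma A G₁ G₂ p ε u u₀ ↔
      (∀ n, MemLp (u n) p (volume.restrict (thinDomain G₁ G₂ (ε n)))) ∧
      ∀ f : TestSpace A G₁ G₂ p, Tendsto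
        (fun n => bochnerPairing G₁ G₂ p (U n) (evalScaledFun (ε n) f)) atTop
        (𝓝 (limitPairing A G₁ G₂ p u₀ f)) := by
  unfold WeakSigma
  simp only [(hU _).testIntegral_eq (hε _), limitPairing_eq]

variable {p q r : ℝ≥0∞} [Fact (1 ≤ p)] [Fact (1 ≤ q)] [Fact (1 ≤ r)]
  [ENNReal.HolderTriple q p r] [ENNReal.HolderTriple p r.conjExponent q.conjExponent]

lemma exists_pos_mul_le {a b δ : ℝ} (ha : 0 ≤ a) (hb : 0 ≤ b) (hδ : 0 < δ) :
    ∃ η : ℝ, 0 < η ∧ a * η ≤ δ ∧ b * η ≤ δ := by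
  refine ⟨δ / (a + b + 1), by positivity, ?_, ?_⟩ <;>
  · rw [← mul_div_assoc, div_le_iff₀ (by positivity)]
    nlinarith [mul_nonneg ha hδ.le, mul_nonneg hb hδ.le]

/-- The product of a bounded weakly convergent sequence and of a sequence that can be approximated
in norm by rescaled functions converges weakly to the product of the limits. -/
lemma tendsto_bochnerPairing_mul {ε : ℕ → ℝ}
    {U : ℕ → Lp (LpOn G₂ q) q ((volume : Measure (Eu d₁)).restrict G₁)}
    {V : ℕ → Lp (LpOn G₂ p) p ((volume : Measure (Eu d₁)).restrict G₁)}
    {u₀ : LimitSpace A G₁ G₂ q} {v₀ : LimitSpace A G₁ G₂ p} {C : ℝ} (hC : ∀ n, ‖U n‖ ≤ C)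
    (hU : ∀ f : TestSpace A G₁ G₂ q, Tendsto
      (fun n => bochnerPairing G₁ G₂ q (U n) (evalScaledFun (ε n) f)) atTop
      (𝓝 (limitPairing A G₁ G₂ q u₀ f)))
    (hV : ∀ η : ℝ, 0 < η →
      ∃ ψ : Lp (A.vec (LpOn G₂ p)) p ((volume : Measure (Eu d₁)).restrict G₁),
        ‖v₀ - toLimit A G₁ _ _ ψ‖ < η ∧
        ∀ᶠ n in atTop, ‖V n - evalScaledFun (ε n) ψ‖ < η)
    (f : TestSpace A G₁ G₂ r) :
    Tendsto (fun n => bochnerPairing G₁ G₂ r ((mulLp G₂ q p r).holder r (U n) (V n))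
      (evalScaledFun (ε n) f)) atTop
      (𝓝 (limitPairing A G₁ G₂ r (limitMul A G₁ G₂ q p r u₀ v₀) f)) := by
  have hC0 : 0 ≤ C := (norm_nonneg _).trans (hC 0)
  refine tendsto_of_forall_approx fun δ hδ => ?_
  -- The numbers `a` and `b` are the coefficients of `η` in the two error bounds, for the sequence
  -- and for the limit.
  obtain ⟨η, hη, h1, h2⟩ := exists_pos_mul_le
    (a := ‖bochnerPairing G₁ G₂ q‖ * C *
      (‖mulLp G₂ p r.conjExponent q.conjExponent‖ * ‖f‖))
    (b := ‖limitDuality A G₁ G₂ r‖ * (‖limitMul A G₁ G₂ q p r‖ * ‖u₀‖) * ‖toLimit A G₁ _ _ f‖)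
    (by positivity) (by positivity) hδ
  obtain ⟨ψ, hψ, hψV⟩ := hV η hη
  -- The comparison sequence is `⟨U_n, (ψ f)_ε⟩`, which converges by the weak hypothesis with test
  -- function `ψ f`.
  refine ⟨_, _, hU ((A.vecBilin
    (mulLp G₂ p r.conjExponent q.conjExponent)).holder q.conjExponent ψ f), ?_, ?_⟩
  · refine (abs_limitPairing_limitMul_sub_le u₀ v₀ ψ f).trans (le_trans ?_ h2)
    calc _ ≤ ‖limitDuality A G₁ G₂ r‖ * (‖limitMul A G₁ G₂ q p r‖ * ‖u₀‖ * η) *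
        ‖toLimit A G₁ _ _ f‖ := by gcongr
      _ = _ := by ring
  · filter_upwards [hψV] with n hn
    refine (abs_bochnerPairing_holder_sub_le (U n) (V n) (ε n) ψ f).trans (le_trans ?_ h1)
    calc _ ≤ ‖bochnerPairing G₁ G₂ q‖ * C * (‖mulLp G₂ p r.conjExponent q.conjExponent‖ *
        η * ‖f‖) := by
          have := hC n
          gcongr
      _ = _ := by ring

lemma isFiniteMeasure_restrict_of_isBounded {d : ℕ} {G : Set (Eu d)}
    (hG : Bornology.IsBounded G) : IsFiniteMeasure ((volume : Measure (Eu d)).restrict G) :=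
  ⟨by simpa using hG.measure_lt_top⟩

/-- The product of a weakly and a strongly `Σ`-convergent sequence converges weakly to the product
of the limits. -/
lemma weakSigma_mul (hp : 1 < p) (hp' : p ≠ ∞) (hq : 1 < q) (hq' : q ≠ ∞)
    (hG₁ : MeasurableSet G₁) (hG₁b : Bornology.IsBounded G₁) (hG₂b : Bornology.IsBounded G₂)
    {ε : ℕ → ℝ} (hε : ∀ n, 0 < ε n) (hε0 : Tendsto ε atTop (𝓝 0))
    {u v : ℕ → Eu d₁ × Eu d₂ → ℝ} {u₀ : LimitSpace A G₁ G₂ q} {v₀ : LimitSpace A G₁ G₂ p}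
    (hu : WeakSigma A G₁ G₂ q ε u u₀) (hv : StrongSigma A G₁ G₂ p ε v v₀) :
    WeakSigma A G₁ G₂ r ε (fun n x => u n x * v n x) (limitMul A G₁ G₂ q p r u₀ v₀) := by
  have := isFiniteMeasure_restrict_of_isBounded hG₁b
  have := isFiniteMeasure_restrict_of_isBounded hG₂b
  choose U hU hUn using fun n => exists_isRescaling hq' (hε n) (hu.1 n)
  choose V hV hVn using fun n => exists_isRescaling hp' (hε n) (hv.1.1 n)
  have hu' := (weakSigma_iff hε hU u₀).1 hu
  have hv' := (weakSigma_iff hε hV v₀).1 hv.1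
  have hvn : Tendsto (fun n => ‖V n‖) atTop (𝓝 ‖v₀‖) := by
    simp only [hVn]
    exact hv.2
  have hε0' : Tendsto ε atTop (𝓝[>] 0) :=
    tendsto_nhdsWithin_iff.2 ⟨hε0, Eventually.of_forall hε⟩
  obtain ⟨C, hC⟩ := exists_norm_le_of_tendsto hq hq' hε hu.1 hU hu'.2
  refine (weakSigma_iff hε (fun n => (hU n).mul (hV n)) _).2 ⟨fun n => (hv.1.1 n).mul' (hu.1 n),
    fun f => tendsto_bochnerPairing_mul hC hu'.2 (fun η hη => ?_) f⟩
  exact exists_approx_of_strong hp hp' hG₁ hε0' v₀ hv'.2 hvn hη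

end Convergence

end ThinSigma

end

/-! ### Products of weakly and strongly convergent sequences -/

theorem theorem2p4 {d₁ d₂ : ℕ} (hd₁ : 1 ≤ d₁) (hd₂ : 1 ≤ d₂)
    (G₁ : Set (ThinSigma.Eu d₁)) (G₂ : Set (ThinSigma.Eu d₂))
    (hG₁ : IsOpen G₁) (hG₁b : Bornology.IsBounded G₁)
    (hG₂ : IsOpen G₂) (hG₂b : Bornology.IsBounded G₂) (h0 : (0 : ThinSigma.Eu d₂) ∈ closure G₂)
    (A : ThinSigma.MeanValueAlgebra d₁)
    (p q r : ℝ≥0∞) [Fact (1 ≤ p)] [Fact (1 ≤ q)] [Fact (1 ≤ r)]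
    (hp : 1 < p) (hp_top : p < ∞) (hq : 1 < q) (hq_top : q < ∞) (hr : 1 / r = 1 / p + 1 / q)
    (ε : ℕ → ℝ) (hε : ∀ n, 0 < ε n ∧ ε n ≤ 1) (hε0 : Tendsto ε atTop (𝓝 0))
    (u v : ℕ → ThinSigma.Eu d₁ × ThinSigma.Eu d₂ → ℝ)
    (u₀ : ThinSigma.LimitSpace A G₁ G₂ q) (v₀ : ThinSigma.LimitSpace A G₁ G₂ p)
    (hu : ThinSigma.WeakSigma A G₁ G₂ q ε u u₀)
    (hv : ThinSigma.StrongSigma A G₁ G₂ p ε v v₀) :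
    ∃ w₀ : ThinSigma.LimitSpace A G₁ G₂ r,
      (∀ᵐ x ∂(volume.restrict G₁), ThinSigma.IsProduct (u₀ x) (v₀ x) (w₀ x)) ∧
      ThinSigma.WeakSigma A G₁ G₂ r ε (fun n x => u n x * v n x) w₀ := by
  have : ENNReal.HolderTriple q p r := ⟨by
    rw [← one_div, ← one_div, ← one_div, hr, add_comm]⟩
  have := ThinSigma.holderTriple_conjExponent (p := p) (q := q) (r := r)
  refine ⟨ThinSigma.limitMul A G₁ G₂ q p r u₀ v₀, ?_,
    ThinSigma.weakSigma_mul hp hp_top.ne hq hq_top.ne hG₁.measurableSet hG₁b hG₂b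
      (fun n => (hε n).1) hε0 hu hv⟩
  filter_upwards [ThinSigma.limitMul_coeFn (r := r) u₀ v₀] with x hx
  rw [hx]
  exact ThinSigma.isProduct_bilin _ _
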